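/- Let $k$ be a field, $A_1,A_2,A_3$ unital $k$-algebras, and for $1\le i<j\le 3$ let ${}_jM_i$ be an $A_j$-$A_i$-bimodule on which $k$ acts centrally. Let $\mu:{}_3M_2\otimes_k{}_2M_1\to{}_3M_1$ be a $k$-linear map for which the multiplication of lower triangular matrices is associative (that is, $\mu$ is $A_3$-linear on the left, $A_1$-linear on the right and $A_2$-balanced), and let $$\mathcal T=\begin{pmatrix}A_1&&\\ {}_2M_1&A_2&\\ {}_3M_1&{}_3M_2&A_3\end{pmatrix}$$ be the resulting triangular algebra. Let $e_i\in\mathcal T$ be the image of $1_{A_i}$, let $R\subset\mathcal T$ be the $k$-subalgebra generated by $e_1,e_2,e_3$, let $X$ be a $\mathcal T$-bimodule on which $k$ acts centrally, and let ${}_jX_i=e_jXe_i$, an $A_j$-$A_i$-bimodule. Let $\mathcal H$ be the complex with $\mathcal H^l=\mathrm{Hom}_{R\text{-}R}(\mathcal T^{\otimes_R l},X)$ for $l\ge 0$ (so $\mathcal H^0=X^R$) and with the Hochschild coboundary $$(\delta f)(t_1\otimes\cdots\otimes t_{l+1})=t_1f(t_2\otimes\cdots\otimes t_{l+1})+\sum_{i=1}^{l}(-1)^if(t_1\otimes\cdots\otimes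 t_it_{i+1}\otimes\cdots\otimes t_{l+1})+(-1)^{l+1}f(t_1\otimes\cdots\otimes t_l)t_{l+1}.$$ An $l$-trajectory $\tau=(\gamma_l,\dots,\gamma_1)$ of the quiver $e_1\to e_2\to e_3$ is a sequence of $l$ consecutive paths, possibly of length zero (a $0$-trajectory is a vertex); its length $|\tau|$ is the number of its paths of nonzero length. For a path $\gamma$ from $e_i$ to $e_j$ put $M_\gamma=e_j\mathcal Te_i$, and put $M_\tau=M_{\gamma_l}\otimes_k\cdots\otimes_kM_{\gamma_1}$ (for the $0$-trajectory given by the vertex $e_i$, $M_\tau=ke_i$), so that $\mathcal T^{\otimes_R l}=\bigoplus_\tau M_\tau$. Filter $\mathcal H$ by $$F^t\mathcal H^l=\mathrm{Hom}_{R\text{-}R}\Big(\bigoplus_{|\tau|\ge t}M_\tau,\,X\Big),$$ the subspace of those cochains that vanish on $M_\tau$ whenever $|\tau|<t$, and let $E_r^{p,q}$ be the terms of the spectral sequence of this filtered complex, where $p$ is the filtration degree and $p+q$ the degree in $\mathcal H$. Then for every $l\ge 0$ there is an isomorphism of $k$-vector spaces $$E_1^{1,l}\;\cong\;\mathrm{Ext}^{l}_{A_2\text{-}A_1}({}_2M_1,{}_2X_1)\oplus\mathrm{Ext}^{l}_{A_3\text{-}A_2}({}_3M_2,{}_3X_2)\oplus\mathrm{Ext}^{l}_{A_3\text{-}A_1}({}_3M_1,{}_3X_1),$$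 where $\mathrm{Ext}_{A_j\text{-}A_i}$ is taken in the category of $A_j$-$A_i$-bimodules with central action of $k$, i.e. of $A_j\otimes_kA_i^{\mathrm{op}}$-modules; moreover $E_1^{1,-1}=0$. -/

import Mathlib

set_option linter.unusedSectionVars false

universe u

/-- A filtered cochain complex of `k`-modules `C⁰ → C¹ → ⋯`, with a decreasing filtration
`⋯ ⊇ Fᵖ ⊇ Fᵖ⁺¹ ⊇ ⋯` by subcomplexes, indexed by `p : ℤ`. -/
structure FilteredComplex (k : Type u) [Field k] where
  C : ℕ → Type u
  [addCommGroup : ∀ n, AddCommGroup (C n)]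
  [module : ∀ n, Module k (C n)]
  d : ∀ n, C n →ₗ[k] C (n + 1)
  d_comp_d : ∀ n (x : C n), d (n + 1) (d n x) = 0
  F : ℤ → ∀ n, Submodule k (C n)
  F_succ_le : ∀ p n, F (p + 1) n ≤ F p n
  d_mem : ∀ p n (x : C n), x ∈ F p n → d n x ∈ F p (n + 1)

namespace FilteredComplex

attribute [instance] FilteredComplex.addCommGroup FilteredComplex.module

variable {k : Type u} [Field k] (K : FilteredComplex k)

/-- `Z_r^p Cⁿ = {x ∈ Fᵖ Cⁿ | d x ∈ Fᵖ⁺ʳ Cⁿ⁺¹}`. -/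
def Z (r p : ℤ) (n : ℕ) : Submodule k (K.C n) :=
  K.F p n ⊓ (K.F (p + r) (n + 1)).comap (K.d n)

/-- `B_r^p Cⁿ = Fᵖ Cⁿ ∩ d (Fᵖ⁻ʳ Cⁿ⁻¹)`, where `C⁻¹ = 0`. -/
def B (r p : ℤ) : ∀ n : ℕ, Submodule k (K.C n)
  | 0 => ⊥
  | n + 1 => K.F p (n + 1) ⊓ (K.F (p - r) n).map (K.d n)

/-- The term `E_r^{p,q}` with `p + q = n` of the spectral sequence of a filtered complex:
`E_r^{p,n-p} = Z_r^p Cⁿ / (Z_{r-1}^{p+1} Cⁿ + B_{r-1}^p Cⁿ)`. Note that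
`B_{r-1}^p Cⁿ = d (Z_{r-1}^{p-r+1} Cⁿ⁻¹)`. -/
abbrev page (r p : ℤ) (n : ℕ) : Type u :=
  K.Z r p n ⧸ (K.Z (r - 1) (p + 1) n ⊔ K.B (r - 1) p n).submoduleOf (K.Z r p n)

end FilteredComplex

/-- Multiply together the entries of index `i` and `i + 1` of a tuple. -/
def mergeAt {T : Type u} [Mul T] {l : ℕ} (i : Fin l) (t : Fin (l + 1) → T) : Fin l → T :=
  fun m => if m < i then t m.castSucc else if m = i then t m.castSucc * t m.succ else t m.succ

theorem mergeAt_update {T : Type u} [Mul T] {l : ℕ} (i : Fin l) (t : Fin (l + 1) → T)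
    (m : Fin (l + 1)) (x : T) :
    mergeAt i (Function.update t m x) = Function.update (mergeAt i t) (i.predAbove m)
      (if m = i.castSucc then x * t i.succ else if m = i.succ then t i.castSucc * x else x) := by
  ext j
  rcases lt_trichotomy (m : ℕ) i with h | h | h
  · have e : i.predAbove m = ⟨m, by omega⟩ := by
      rw [Fin.predAbove_of_le_castSucc _ _ (by simp [Fin.le_def]; omega)]; rfl
    simp only [mergeAt, e, Function.update_apply, Fin.ext_iff, Fin.lt_def, Fin.val_castSucc,
      Fin.val_succ]
    split_ifs <;> first | rfl | omega
  · have e : i.predAbove m = ⟨m, by omega⟩ := by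
      rw [Fin.predAbove_of_le_castSucc _ _ (by simp [Fin.le_def]; omega)]; rfl
    obtain rfl : m = i.castSucc := Fin.ext h
    simp only [mergeAt, e, Function.update_apply, Fin.ext_iff, Fin.lt_def, Fin.val_castSucc,
      Fin.val_succ]
    split_ifs <;> first | rfl | omega | skip
    have : j = i := Fin.ext (by omega)
    rw [this]
  · have e : i.predAbove m = ⟨m - 1, by omega⟩ := by
      rw [Fin.predAbove_of_castSucc_lt _ _ (by simp [Fin.lt_def]; omega)]; rfl
    simp only [mergeAt, e, Function.update_apply, Fin.ext_iff, Fin.lt_def, Fin.val_castSucc,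
      Fin.val_succ]
    split_ifs <;> first | rfl | omega | skip
    have : j = i := Fin.ext (by omega)
    rw [this]

theorem mergeAt_mergeAt {T : Type u} [Semigroup T] {l : ℕ} (i : Fin (l + 1)) (j : Fin (l + 2))
    (h : j.val ≤ i.val) (w : Fin (l + 3) → T) :
    mergeAt i (mergeAt j w) =
      mergeAt ⟨j.val, by omega⟩ (mergeAt i.succ w) := by
  ext m
  simp only [mergeAt, Fin.ext_iff, Fin.lt_def, Fin.val_castSucc, Fin.val_succ]
  split_ifs <;> first | rfl | omega | simp only [mul_assoc, Fin.succ_castSucc]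

namespace RelHochschild

section

variable {k : Type u} [Field k] {T : Type u} [Ring T] [Algebra k T]
  {X : Type u} [AddCommGroup X] [Module k X] [Module T X] [Module Tᵐᵒᵖ X]
  [SMulCommClass T Tᵐᵒᵖ X] [IsScalarTower k T X] [IsScalarTower k Tᵐᵒᵖ X]

/-- `t₁ ⊗ ⋯ ⊗ t_{l+1} ↦ t₁ f(t₂ ⊗ ⋯ ⊗ t_{l+1})`. -/
def faceLeft {l : ℕ} (f : MultilinearMap k (fun _ : Fin l => T) X) :
    MultilinearMap k (fun _ : Fin (l + 1) => T) X :=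
  MultilinearMap.mk' (fun t => t 0 • f (Fin.tail t))
    (by
      intro t m x y
      refine Fin.cases ?_ (fun m => ?_) m
      · simp [Fin.tail_update_zero, add_smul]
      · simp [Fin.tail_update_succ, Function.update_of_ne (Fin.succ_ne_zero m).symm])
    (by
      intro t m c x
      refine Fin.cases ?_ (fun m => ?_) m
      · simp [Fin.tail_update_zero]
      · simp [Fin.tail_update_succ, Function.update_of_ne (Fin.succ_ne_zero m).symm,
          smul_comm _ c])

/-- `t₁ ⊗ ⋯ ⊗ t_{l+1} ↦ f(t₁ ⊗ ⋯ ⊗ t_l) t_{l+1}`. -/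
def faceRight {l : ℕ} (f : MultilinearMap k (fun _ : Fin l => T) X) :
    MultilinearMap k (fun _ : Fin (l + 1) => T) X :=
  MultilinearMap.mk' (fun t => MulOpposite.op (t (Fin.last l)) • f (Fin.init t))
    (by
      intro t m x y
      refine Fin.lastCases ?_ (fun m => ?_) m
      · simp [Fin.init_update_last, add_smul]
      · simp [Fin.init_update_castSucc, Function.update_of_ne (Fin.castSucc_ne_last m).symm])
    (by
      intro t m c x
      refine Fin.lastCases ?_ (fun m => ?_) m
      · simp [Fin.init_update_last]
      · simp [Fin.init_update_castSucc, Function.update_of_ne (Fin.castSucc_ne_last m).symm,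
          smul_comm _ c])

/-- `t₁ ⊗ ⋯ ⊗ t_{l+1} ↦ f(t₁ ⊗ ⋯ ⊗ tᵢ tᵢ₊₁ ⊗ ⋯ ⊗ t_{l+1})`. -/
def faceMid {l : ℕ} (i : Fin l) (f : MultilinearMap k (fun _ : Fin l => T) X) :
    MultilinearMap k (fun _ : Fin (l + 1) => T) X :=
  MultilinearMap.mk' (fun t => f (mergeAt i t))
    (by
      intro t m x y
      simp only [mergeAt_update]
      split_ifs <;> simp [add_mul, mul_add])
    (by
      intro t m c x
      simp only [mergeAt_update]
      split_ifs <;> simp)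

variable (k T X) in
/-- The Hochschild coboundary
`(δ f)(t₁ ⊗ ⋯ ⊗ t_{l+1}) = t₁ f(t₂ ⊗ ⋯ ⊗ t_{l+1}) + ∑ᵢ (-1)ⁱ f(t₁ ⊗ ⋯ ⊗ tᵢ tᵢ₊₁ ⊗ ⋯ ⊗ t_{l+1})
  + (-1)^{l+1} f(t₁ ⊗ ⋯ ⊗ t_l) t_{l+1}`
on `k`-multilinear maps; for `l = 0` it is `x ↦ (t ↦ t x - x t)`. -/
def coboundary (l : ℕ) : MultilinearMap k (fun _ : Fin l => T) X →ₗ[k]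
    MultilinearMap k (fun _ : Fin (l + 1) => T) X where
  toFun f := faceLeft f + ∑ i : Fin l, (-1 : k) ^ (i.val + 1) • faceMid i f
    + (-1 : k) ^ (l + 1) • faceRight f
  map_add' f g := by
    ext t
    simp [faceLeft, faceMid, faceRight, Finset.sum_add_distrib]
    abel
  map_smul' c f := by
    ext t
    simp [faceLeft, faceMid, faceRight, Finset.smul_sum,
      smul_comm _ c]

theorem coboundary_apply {l : ℕ} (f : MultilinearMap k (fun _ : Fin l => T) X)
    (t : Fin (l + 1) → T) :
    coboundary k T X l f t = t 0 • f (Fin.tail t)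
      + ∑ i : Fin l, (-1 : k) ^ (i.val + 1) • f (mergeAt i t)
      + (-1 : k) ^ (l + 1) • MulOpposite.op (t (Fin.last l)) • f (Fin.init t) := by
  simp [coboundary, faceLeft, faceMid, faceRight]

/-- The map `t₀ ⊗ ⋯ ⊗ t_{l+1} ↦ t₀ f(t₁ ⊗ ⋯ ⊗ t_l) t_{l+1}`. -/
def extend {l : ℕ} (f : MultilinearMap k (fun _ : Fin l => T) X) (w : Fin (l + 2) → T) : X :=
  w 0 • MulOpposite.op (w (Fin.last _)) • f (fun i => w i.succ.castSucc)

theorem extend_one {l : ℕ} (f : MultilinearMap k (fun _ : Fin l => T) X) (t : Fin l → T) :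
    extend f (Fin.cons 1 (Fin.snoc t 1) : Fin (l + 2) → T) = f t := by
  have h1 : (Fin.cons 1 (Fin.snoc t 1 : Fin (l + 1) → T) : Fin (l + 2) → T) (Fin.last _) = 1 := by
    rw [← Fin.succ_last, Fin.cons_succ, Fin.snoc_last]
  have h2 : (fun i : Fin l =>
      (Fin.cons 1 (Fin.snoc t 1 : Fin (l + 1) → T) : Fin (l + 2) → T) i.succ.castSucc) = t := by
    ext i
    rw [← Fin.succ_castSucc, Fin.cons_succ, Fin.snoc_castSucc]
  rw [extend, h1, h2]
  simp

theorem extend_coboundary {l : ℕ} (f : MultilinearMap k (fun _ : Fin l => T) X)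
    (w : Fin (l + 3) → T) :
    extend (coboundary k T X l f) w =
      ∑ j : Fin (l + 2), (-1 : k) ^ j.val • extend f (mergeAt j w) := by
  rw [Fin.sum_univ_succ, Fin.sum_univ_castSucc]
  have e0 : extend f (mergeAt 0 w) = w 0 • MulOpposite.op (w (Fin.last _)) •
      w 1 • f (fun i => w i.succ.castSucc.succ) := by
    have h : (fun i : Fin l => mergeAt (0 : Fin (l + 2)) w i.succ.castSucc) =
        fun i => w i.succ.castSucc.succ := by
      ext i; simp [mergeAt, Fin.ext_iff]
    have h' : mergeAt (0 : Fin (l + 2)) w (Fin.last _) = w (Fin.last _) := by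
      simp [mergeAt, Fin.ext_iff]
    rw [extend, h, h']
    simp [mergeAt, mul_smul, smul_comm (w 1)]
  have e1 : extend f (mergeAt (Fin.last l).succ w) = w 0 • MulOpposite.op (w (Fin.last _)) •
      MulOpposite.op (w (Fin.last _).castSucc) • f (fun i => w i.succ.castSucc.castSucc) := by
    have h : (fun i : Fin l => mergeAt ((Fin.last l).succ : Fin (l + 2)) w i.succ.castSucc) =
        fun i => w i.succ.castSucc.castSucc := by
      ext i; simp [mergeAt, Fin.lt_def]
    rw [extend, h]
    simp [mergeAt, mul_smul, Fin.lt_def]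
  have e2 : ∀ i : Fin l, extend f (mergeAt i.castSucc.succ w) =
      w 0 • MulOpposite.op (w (Fin.last _)) •
        f (mergeAt i (fun m : Fin (l + 1) => w m.succ.castSucc)) := by
    intro i
    have h : (fun m : Fin l => mergeAt (i.castSucc.succ : Fin (l + 2)) w m.succ.castSucc) =
        mergeAt i (fun m : Fin (l + 1) => w m.succ.castSucc) := by
      ext m
      simp only [mergeAt, Fin.ext_iff, Fin.lt_def, Fin.val_castSucc, Fin.val_succ,
        Nat.add_lt_add_iff_right, Nat.add_right_cancel_iff]
      rfl
    have h' : mergeAt (i.castSucc.succ : Fin (l + 2)) w (Fin.last _) = w (Fin.last _) := by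
      have := i.isLt
      simp only [mergeAt, Fin.ext_iff, Fin.lt_def, Fin.val_castSucc, Fin.val_succ, Fin.val_last]
      rw [if_neg (by omega), if_neg (by omega)]
      rfl
    rw [extend, h, h']
    simp [mergeAt, Fin.lt_def]
  simp only [e0, e1, e2]
  rw [extend, coboundary_apply]
  simp only [smul_add, Finset.smul_sum, smul_comm _ ((-1 : k) ^ _)]
  simp only [Fin.val_zero, pow_zero, one_smul, Fin.val_succ, Fin.val_castSucc, Fin.val_last]
  rw [add_assoc]
  rfl

theorem coboundary_coboundary {l : ℕ} (f : MultilinearMap k (fun _ : Fin l => T) X) :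
    coboundary k T X (l + 1) (coboundary k T X l f) = 0 := by
  ext t
  rw [← extend_one, extend_coboundary]
  simp only [extend_coboundary, Finset.smul_sum, smul_smul, zero_apply]
  generalize (Fin.cons 1 (Fin.snoc t 1) : Fin (l + 4) → T) = w
  rw [← Finset.sum_product', Finset.univ_product_univ]
  refine Finset.sum_involution (fun p _ => if h : p.1.val ≤ p.2.val
    then (p.2.succ, ⟨p.1.val, by omega⟩) else (p.2.castSucc, ⟨p.1.val - 1, by omega⟩))
    ?_ ?_ (fun _ _ => Finset.mem_univ _) ?_
  · rintro ⟨a, b⟩ -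
    by_cases h : a.val ≤ b.val
    · simp only [h, dif_pos]
      rw [mergeAt_mergeAt b a h, ← add_smul]
      simp only [Fin.val_succ]
      rw [show ((-1 : k) ^ a.val * (-1) ^ b.val + (-1) ^ (b.val + 1) * (-1) ^ a.val) = 0 by ring,
        zero_smul]
    · simp only [h, dif_neg, not_false_eq_true]
      have hb := mergeAt_mergeAt (⟨a.val - 1, by omega⟩ : Fin (l + 2)) b.castSucc
        (by simp only [Fin.val_castSucc]; omega) w
      have ha : (⟨a.val - 1, by omega⟩ : Fin (l + 2)).succ = a := Fin.ext (by simp; omega)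
      rw [ha] at hb
      simp only [Fin.val_castSucc, Fin.eta] at hb
      rw [hb, ← add_smul]
      simp only [Fin.val_castSucc]
      obtain ⟨c, hc⟩ : ∃ c, a.val = c + 1 := ⟨a.val - 1, by omega⟩
      rw [hc, show ((-1 : k) ^ (c + 1) * (-1) ^ b.val + (-1) ^ b.val * (-1) ^ (c + 1 - 1)) = 0 by
        simp only [Nat.add_sub_cancel]; ring, zero_smul]
  · rintro ⟨a, b⟩ - -
    dsimp only
    split_ifs with h
    · intro e
      have := congrArg (fun p => p.1.val) e
      simp at this; omega
    · intro e
      have := congrArg (fun p => p.1.val) e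
      simp at this; omega
  · rintro ⟨a, b⟩ -
    by_cases h : a.val ≤ b.val
    · have h' : ¬ (b.val + 1 ≤ a.val) := by omega
      simp [h, h']
    · have h' : b.val ≤ a.val - 1 := by omega
      simp only [h, dif_neg, not_false_eq_true, Fin.val_castSucc, h', dif_pos]
      ext <;> simp; omega

/-- Two ways to act by `r` on a cochain at one of the `l + 1` gaps of `t₁ ⊗ ⋯ ⊗ t_l`: here `r`
acts on the object to the left of the gap, i.e. `tⱼ` is replaced by `tⱼ r`, or, at the initial
gap, the value becomes `r f(t)`. -/
def gapLeft {l : ℕ} (f : MultilinearMap k (fun _ : Fin l => T) X) (r : T) (t : Fin l → T)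
    (j : Fin (l + 1)) : X :=
  Fin.cases (motive := fun _ => X) (r • f t) (fun i => f (Function.update t i (t i * r))) j

/-- Here `r` acts on the object to the right of the gap, i.e. `tⱼ₊₁` is replaced by `r tⱼ₊₁`, or,
at the final gap, the value becomes `f(t) r`. -/
def gapRight {l : ℕ} (f : MultilinearMap k (fun _ : Fin l => T) X) (r : T) (t : Fin l → T)
    (j : Fin (l + 1)) : X :=
  Fin.lastCases (motive := fun _ => X) (MulOpposite.op r • f t)
    (fun i => f (Function.update t i (r * t i))) j

variable (X) in
/-- The module `Hom_{R-R}(T ⊗_R ⋯ ⊗_R T, X)` (`l` factors), as the module of `k`-multilinear maps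
`f : Tˡ → X` with `f(r t₁, …) = r f(t₁, …)`, `f(…, t_l r) = f(…, t_l) r` and
`f(…, tᵢ r, tᵢ₊₁, …) = f(…, tᵢ, r tᵢ₊₁, …)` for all `r ∈ R`. For `l = 0` the condition reads
`r f = f r`, so this is `X^R = Hom_{R-R}(R, X)`. -/
def relCochain (R : Subalgebra k T) (l : ℕ) :
    Submodule k (MultilinearMap k (fun _ : Fin l => T) X) where
  carrier := {f | ∀ r ∈ R, ∀ t j, gapLeft f r t j = gapRight f r t j}
  zero_mem' := by
    intro r _ t j
    have h1 : gapLeft (0 : MultilinearMap k (fun _ : Fin l => T) X) r t j = 0 := by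
      refine Fin.cases ?_ (fun i => ?_) j <;> simp [gapLeft]
    have h2 : gapRight (0 : MultilinearMap k (fun _ : Fin l => T) X) r t j = 0 := by
      refine Fin.lastCases ?_ (fun i => ?_) j <;> simp [gapRight]
    rw [h1, h2]
  add_mem' := by
    intro f g hf hg r hr t j
    have h1 : gapLeft (f + g) r t j = gapLeft f r t j + gapLeft g r t j := by
      refine Fin.cases ?_ (fun i => ?_) j <;> simp [gapLeft]
    have h2 : gapRight (f + g) r t j = gapRight f r t j + gapRight g r t j := by
      refine Fin.lastCases ?_ (fun i => ?_) j <;> simp [gapRight]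
    rw [h1, h2, hf r hr, hg r hr]
  smul_mem' := by
    intro c f hf r hr t j
    have h1 : gapLeft (c • f) r t j = c • gapLeft f r t j := by
      refine Fin.cases ?_ (fun i => ?_) j <;> simp [gapLeft, smul_comm _ c]
    have h2 : gapRight (c • f) r t j = c • gapRight f r t j := by
      refine Fin.lastCases ?_ (fun i => ?_) j <;> simp [gapRight, smul_comm _ c]
    rw [h1, h2, hf r hr]

theorem mem_relCochain_iff {R : Subalgebra k T} {l : ℕ}
    {f : MultilinearMap k (fun _ : Fin l => T) X} :
    f ∈ relCochain X R l ↔ ∀ r ∈ R, ∀ (w : Fin (l + 2) → T) (p : Fin (l + 1)),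
      extend f (Function.update w p.castSucc (w p.castSucc * r)) =
        extend f (Function.update w p.succ (r * w p.succ)) := by
  have hL : ∀ (r : T) (w : Fin (l + 2) → T) (p : Fin (l + 1)),
      extend f (Function.update w p.castSucc (w p.castSucc * r)) =
        w 0 • MulOpposite.op (w (Fin.last _)) • gapLeft f r (fun i => w i.succ.castSucc) p := by
    intro r w p
    refine Fin.cases ?_ (fun i => ?_) p
    · simp only [extend, gapLeft, Fin.castSucc_zero, Function.update_self, Fin.cases_zero]
      rw [Function.update_of_ne (by simp [Fin.ext_iff])]
      have : (fun i : Fin l => Function.update w 0 (w 0 * r) i.succ.castSucc) =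
          fun i => w i.succ.castSucc := by
        ext i; rw [Function.update_of_ne (by simp [Fin.ext_iff])]
      rw [this, mul_smul, smul_comm r]
    · simp only [extend, gapLeft, Fin.cases_succ]
      rw [Function.update_of_ne (by simp [Fin.ext_iff]), Function.update_of_ne
        (Fin.castSucc_ne_last _).symm]
      congr 3
      ext m
      simp only [Function.update_apply, Fin.ext_iff, Fin.val_castSucc, Fin.val_succ,
        Nat.add_right_cancel_iff]
  have hR : ∀ (r : T) (w : Fin (l + 2) → T) (p : Fin (l + 1)),
      extend f (Function.update w p.succ (r * w p.succ)) =
        w 0 • MulOpposite.op (w (Fin.last _)) • gapRight f r (fun i => w i.succ.castSucc) p := by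
    intro r w p
    refine Fin.lastCases ?_ (fun i => ?_) p
    · simp only [extend, gapRight, Fin.succ_last, Function.update_self, Fin.lastCases_last]
      rw [Function.update_of_ne (by simp [Fin.ext_iff])]
      have : (fun i : Fin l => Function.update w (Fin.last _) (r * w (Fin.last _))
          i.succ.castSucc) = fun i => w i.succ.castSucc := by
        ext i; rw [Function.update_of_ne (Fin.castSucc_ne_last _)]
      rw [this, MulOpposite.op_mul, mul_smul]
    · simp only [extend, gapRight, Fin.lastCases_castSucc]
      rw [Function.update_of_ne (by simp [Fin.ext_iff]), Function.update_of_ne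
        (by rw [Fin.succ_castSucc]; exact (Fin.castSucc_ne_last _).symm)]
      congr 3
      ext m
      simp only [Function.update_apply, Fin.ext_iff, Fin.val_castSucc, Fin.val_succ,
        Nat.add_right_cancel_iff, Fin.succ_castSucc]
  constructor
  · intro h r hr w p
    rw [hL, hR, h r hr]
  · intro h r hr t j
    have := h r hr (Fin.cons 1 (Fin.snoc t 1 : Fin (l + 1) → T)) j
    rw [hL, hR] at this
    have h1 : (Fin.cons 1 (Fin.snoc t 1 : Fin (l + 1) → T) : Fin (l + 2) → T) (Fin.last _)
        = 1 := by
      rw [← Fin.succ_last, Fin.cons_succ, Fin.snoc_last]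
    have h2 : (fun i : Fin l =>
        (Fin.cons 1 (Fin.snoc t 1 : Fin (l + 1) → T) : Fin (l + 2) → T) i.succ.castSucc) = t := by
      ext i
      rw [← Fin.succ_castSucc, Fin.cons_succ, Fin.snoc_castSucc]
    rw [h1, h2] at this
    simpa using this

theorem coboundary_mem {R : Subalgebra k T} {l : ℕ}
    {f : MultilinearMap k (fun _ : Fin l => T) X} (hf : f ∈ relCochain X R l) :
    coboundary k T X l f ∈ relCochain X R (l + 1) := by
  rw [mem_relCochain_iff] at hf ⊢
  intro r hr w p
  rw [extend_coboundary, extend_coboundary]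
  refine Finset.sum_congr rfl fun j _ => ?_
  congr 1
  rw [mergeAt_update, mergeAt_update]
  rcases lt_trichotomy p.val j.val with h | h | h
  · obtain ⟨q, hq⟩ : ∃ q : Fin (l + 1), q.val = p.val := ⟨⟨p.val, by omega⟩, rfl⟩
    have e1 : j.predAbove p.castSucc = q.castSucc := by
      rw [Fin.predAbove_of_le_castSucc _ _ (by simp only [Fin.le_def, Fin.val_castSucc]; omega)]
      exact Fin.ext hq.symm
    have e2 : j.predAbove p.succ = q.succ := by
      rw [Fin.predAbove_of_le_castSucc _ _
        (by simp only [Fin.le_def, Fin.val_castSucc, Fin.val_succ]; omega)]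
      exact Fin.ext (by simp [hq])
    have hp : q.castSucc = p := Fin.ext hq
    have n1 : p.castSucc ≠ j.castSucc := by simp only [ne_eq, Fin.ext_iff, Fin.val_castSucc]; omega
    have n2 : p.castSucc ≠ j.succ := by
      simp only [ne_eq, Fin.ext_iff, Fin.val_castSucc, Fin.val_succ]; omega
    have n3 : p.succ ≠ j.succ := by simp only [ne_eq, Fin.ext_iff, Fin.val_succ]; omega
    have m1 : mergeAt j w q.castSucc = w p.castSucc := by
      rw [mergeAt, hp, if_pos (Fin.lt_def.2 h)]
    have m2 : mergeAt j w q.succ = if p.succ = j.castSucc then w p.succ * w j.succ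
        else w p.succ := by
      have hq2 : q.succ.castSucc = p.succ := Fin.ext (by simp [hq])
      simp only [mergeAt, hq2]
      by_cases h5 : p.val + 1 = j.val
      · have h6 : q.succ = j := Fin.ext (by simp [hq, h5])
        have h7 : p.succ = j.castSucc := Fin.ext (by simp [h5])
        simp [h6, h7]
      · have h6 : q.succ < j := Fin.lt_def.2 (by simp only [Fin.val_succ]; omega)
        have h7 : p.succ ≠ j.castSucc := by
          simp only [ne_eq, Fin.ext_iff, Fin.val_castSucc, Fin.val_succ]; exact h5
        simp [h6, h7]
    have key := hf r hr (mergeAt j w) q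
    rw [m1, m2] at key
    rw [e1, e2, if_neg n1, if_neg n2, key, if_neg n3]
    split_ifs <;> simp [mul_assoc]
  · obtain rfl : p = j := Fin.ext h
    have n1 : p.succ ≠ p.castSucc := by simp [Fin.ext_iff]
    simp [mul_assoc, n1]
  · obtain ⟨q, hq⟩ : ∃ q : Fin (l + 1), q.val + 1 = p.val :=
      ⟨⟨p.val - 1, by omega⟩, by simp only []; omega⟩
    have e1 : j.predAbove p.castSucc = q.castSucc := by
      rw [Fin.predAbove_of_castSucc_lt _ _ (by simp only [Fin.lt_def, Fin.val_castSucc]; omega)]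
      exact Fin.ext (by simp [← hq])
    have e2 : j.predAbove p.succ = q.succ := by
      rw [Fin.predAbove_of_castSucc_lt _ _
        (by simp only [Fin.lt_def, Fin.val_castSucc, Fin.val_succ]; omega)]
      exact Fin.ext (by simp [hq])
    have hp : q.succ = p := Fin.ext (by simp [hq])
    have n1 : p.castSucc ≠ j.castSucc := by simp only [ne_eq, Fin.ext_iff, Fin.val_castSucc]; omega
    have n2 : p.succ ≠ j.succ := by simp only [ne_eq, Fin.ext_iff, Fin.val_succ]; omega
    have n3 : p.succ ≠ j.castSucc := by
      simp only [ne_eq, Fin.ext_iff, Fin.val_castSucc, Fin.val_succ]; omega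
    have m2 : mergeAt j w q.succ = w p.succ := by
      rw [mergeAt, hp, if_neg (by simp only [Fin.lt_def]; omega),
        if_neg (by simp only [Fin.ext_iff]; omega)]
    have m1 : mergeAt j w q.castSucc = if p.castSucc = j.succ then w j.castSucc * w p.castSucc
        else w p.castSucc := by
      have hq2 : q.castSucc.succ = p.castSucc := Fin.ext (by simp [hq])
      simp only [mergeAt, hq2]
      by_cases h5 : q.val = j.val
      · have h6 : q.castSucc = j := Fin.ext (by simp [h5])
        have h7 : p.castSucc = j.succ := Fin.ext (by simp [← hq, h5])
        simp [h6, h7]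
      · have h6 : ¬ q.castSucc < j := by simp only [Fin.lt_def, Fin.val_castSucc]; omega
        have h8 : q.castSucc ≠ j := by
          simp only [ne_eq, Fin.ext_iff, Fin.val_castSucc]; exact h5
        have h7 : p.castSucc ≠ j.succ := by
          simp only [ne_eq, Fin.ext_iff, Fin.val_castSucc, Fin.val_succ]; omega
        simp [h6, h7, h8]
    have key := hf r hr (mergeAt j w) q
    rw [m1, m2] at key
    rw [e1, e2, if_neg n1, if_neg n2, if_neg n3, ← key]
    split_ifs <;> simp [mul_assoc]

end
end RelHochschild

/-- The quiver `e₁ → e₂ → ⋯ → eₙ`: its vertices are `0, …, n - 1`, and there is exactly one arrow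
`i → j` if `j = i + 1`, and no other arrow. -/
def LinQuiver (n : ℕ) : Type := Fin n

instance (n : ℕ) : Quiver (LinQuiver n) where
  Hom i j := PLift (i.val + 1 = j.val)

namespace LinQuiver

variable {n : ℕ}

theorem length_path {i j : LinQuiver n} (γ : Quiver.Path i j) : i.val + γ.length = j.val := by
  induction γ with
  | nil => rfl
  | cons γ a ih =>
    have := a.down
    rw [Quiver.Path.length_cons]
    omega

theorem length_path_ne_zero_iff {i j : LinQuiver n} (γ : Quiver.Path i j) :
    γ.length ≠ 0 ↔ i ≠ j := by
  have := length_path γ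
  rw [not_iff_not]
  constructor
  · intro h
    exact Fin.ext (by omega)
  · rintro rfl
    omega

/-- An `l`-trajectory `(γ_l, …, γ₁)`: `l` consecutive paths, possibly of length zero. They are
listed in the written order, so that the source of each path is the target of the next one; a
`0`-trajectory is a vertex. -/
structure Trajectory (n l : ℕ) where
  vertex : Fin (l + 1) → LinQuiver n
  path : ∀ i : Fin l, Quiver.Path (vertex i.succ) (vertex i.castSucc)

/-- The length of a trajectory: the number of its paths that have nonzero length. -/
def Trajectory.length {l : ℕ} (τ : Trajectory n l) : ℕ :=
  (Finset.univ.filter fun i => (τ.path i).length ≠ 0).card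

open Classical in
theorem Trajectory.length_eq {l : ℕ} (τ : Trajectory n l) :
    τ.length = (Finset.univ.filter fun i : Fin l =>
      τ.vertex i.succ ≠ τ.vertex i.castSucc).card := by
  unfold Trajectory.length
  congr 1
  ext i
  simp only [Finset.mem_filter, Finset.mem_univ, true_and]
  exact length_path_ne_zero_iff _

open Classical in
/-- Deleting one vertex from a trajectory does not increase its length. -/
theorem Trajectory.exists_delete {l : ℕ} (τ : Trajectory n (l + 1)) (j : Fin (l + 2)) :
    ∃ σ : Trajectory n l, σ.length ≤ τ.length ∧ ∀ i, σ.vertex i = τ.vertex (j.succAbove i) := by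
  have hs : ∀ i : Fin l, Nonempty (Quiver.Path (τ.vertex (j.succAbove i.succ))
      (τ.vertex (j.succAbove i.castSucc))) := by
    intro i
    rcases lt_trichotomy (i.val + 1) j.val with h | h | h
    · have h1 : j.succAbove i.succ = i.castSucc.succ := by
        rw [Fin.succAbove_of_castSucc_lt _ _ (by simpa [Fin.lt_def] using h)]; rfl
      have h2 : j.succAbove i.castSucc = i.castSucc.castSucc := by
        rw [Fin.succAbove_of_castSucc_lt _ _ (by simp [Fin.lt_def]; omega)]
      rw [h1, h2]
      exact ⟨τ.path i.castSucc⟩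
    · have h1 : j.succAbove i.succ = i.succ.succ := by
        rw [Fin.succAbove_of_le_castSucc _ _ (by simp [Fin.le_def]; omega)]
      have h2 : j.succAbove i.castSucc = i.castSucc.castSucc := by
        rw [Fin.succAbove_of_castSucc_lt _ _ (by simp [Fin.lt_def]; omega)]
      rw [h1, h2]
      exact ⟨(τ.path i.succ).comp (τ.path i.castSucc)⟩
    · have h1 : j.succAbove i.succ = i.succ.succ := by
        rw [Fin.succAbove_of_le_castSucc _ _ (by simp [Fin.le_def]; omega)]
      have h2 : j.succAbove i.castSucc = i.succ.castSucc := by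
        rw [Fin.succAbove_of_le_castSucc _ _ (by simp [Fin.le_def]; omega)]; rfl
      rw [h1, h2]
      exact ⟨τ.path i.succ⟩
  refine ⟨⟨fun i => τ.vertex (j.succAbove i), fun i => (hs i).some⟩, ?_, fun _ => rfl⟩
  rw [Trajectory.length_eq, Trajectory.length_eq]
  refine Finset.card_le_card_of_injOn
    (fun i => if i.val + 1 < j.val then i.castSucc
      else if i.val + 1 = j.val ∧ τ.vertex i.castSucc.succ ≠ τ.vertex i.castSucc.castSucc
        then i.castSucc else i.succ) ?_ ?_
  · intro i hi
    simp only [Finset.coe_filter, Finset.mem_univ, true_and, Set.mem_ofPred_eq] at hi ⊢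
    by_cases h : i.val + 1 < j.val
    · rw [if_pos h]
      have h1 : j.succAbove i.succ = i.castSucc.succ := by
        rw [Fin.succAbove_of_castSucc_lt _ _ (by simpa [Fin.lt_def] using h)]; rfl
      have h2 : j.succAbove i.castSucc = i.castSucc.castSucc := by
        rw [Fin.succAbove_of_castSucc_lt _ _ (by simp [Fin.lt_def]; omega)]
      rwa [h1, h2] at hi
    · rw [if_neg h]
      have h1 : j.succAbove i.succ = i.succ.succ := by
        rw [Fin.succAbove_of_le_castSucc _ _ (by simp [Fin.le_def]; omega)]
      by_cases h3 : i.val + 1 = j.val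
      · have h2 : j.succAbove i.castSucc = i.castSucc.castSucc := by
          rw [Fin.succAbove_of_castSucc_lt _ _ (by simp [Fin.lt_def]; omega)]
        rw [h1, h2] at hi
        by_cases h4 : τ.vertex i.castSucc.succ ≠ τ.vertex i.castSucc.castSucc
        · rwa [if_pos ⟨h3, h4⟩]
        · rw [if_neg (fun h => h4 h.2)]
          rw [not_not] at h4
          rwa [← Fin.succ_castSucc, h4]
      · have h2 : j.succAbove i.castSucc = i.succ.castSucc := by
          rw [Fin.succAbove_of_le_castSucc _ _ (by simp [Fin.le_def]; omega)]; rfl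
        rw [h1, h2] at hi
        rwa [if_neg (fun h => h3 h.1)]
  · intro a _ b _ hab
    dsimp only at hab
    split_ifs at hab <;> simp only [Fin.ext_iff, Fin.val_castSucc, Fin.val_succ] at hab ⊢ <;>
      omega

end LinQuiver

namespace RelHochschild

section

variable {k : Type u} [Field k] {T : Type u} [Ring T] [Algebra k T]
  (X : Type u) [AddCommGroup X] [Module k X] [Module T X] [Module Tᵐᵒᵖ X]
  [SMulCommClass T Tᵐᵒᵖ X] [IsScalarTower k T X] [IsScalarTower k Tᵐᵒᵖ X]

/-- For idempotents `e₁, …, eₙ` of `T` and a path `γ` from `i` to `j`, the component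
`M_γ = eⱼ T eᵢ` of `T`. -/
def pathComponent {n : ℕ} (e : LinQuiver n → T) {i j : LinQuiver n} (_γ : Quiver.Path i j) : Set T :=
  {t | e j * t * e i = t}

/-- `Fᵗ = Hom_{R-R}(⨁_{|τ| ≥ t} M_τ, X)`, where `τ` runs through the `l`-trajectories
`(γ_l, …, γ₁)`, and `M_τ = M_{γ_l} ⊗ ⋯ ⊗ M_{γ₁}`: the cochains that vanish on `M_τ` for all `τ`
of length less than `t`. -/
def trajectoryFiltration {n : ℕ} (R : Subalgebra k T) (e : LinQuiver n → T) (t : ℤ) (l : ℕ) :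
    Submodule k (relCochain X R l) where
  carrier := {f | ∀ τ : LinQuiver.Trajectory n l, (τ.length : ℤ) < t →
    ∀ x : Fin l → T, (∀ i, x i ∈ pathComponent e (τ.path i)) → f.1 x = 0}
  zero_mem' := by intro τ _ x _; simp
  add_mem' := by
    intro f g hf hg τ hτ x hx
    simp [hf τ hτ x hx, hg τ hτ x hx]
  smul_mem' := by
    intro c f hf τ hτ x hx
    simp [hf τ hτ x hx]

theorem coboundary_mem_trajectoryFiltration {n : ℕ} {R : Subalgebra k T} {e : LinQuiver n → T}
    (he : ∀ i, e i * e i = e i) {t : ℤ} {l : ℕ} {f : relCochain X R l}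
    (hf : f ∈ trajectoryFiltration X R e t l) :
    (⟨coboundary k T X l f.1, coboundary_mem f.2⟩ : relCochain X R (l + 1)) ∈
      trajectoryFiltration X R e t (l + 1) := by
  intro τ hτ x hx
  have hx' : ∀ i, e (τ.vertex i.castSucc) * x i * e (τ.vertex i.succ) = x i := hx
  have key : ∀ (j : Fin (l + 2)) (y : Fin l → T),
      (∀ i, e (τ.vertex (j.succAbove i.castSucc)) * y i * e (τ.vertex (j.succAbove i.succ))
        = y i) → f.1 y = 0 := by
    intro j y hy
    obtain ⟨σ, hσ, hv⟩ := τ.exists_delete j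
    refine hf σ (by omega) y fun i => ?_
    change e (σ.vertex i.castSucc) * y i * e (σ.vertex i.succ) = y i
    rw [hv, hv]
    exact hy i
  have hl : ∀ i, e (τ.vertex i.castSucc) * x i = x i := fun i => by
    rw [← hx' i, ← mul_assoc, ← mul_assoc, he]
  have hr : ∀ i, x i * e (τ.vertex i.succ) = x i := fun i => by
    rw [← hx' i, mul_assoc, he]
  change coboundary k T X l f.1 x = 0
  rw [coboundary_apply, key 0 (Fin.tail x), key (Fin.last _) (Fin.init x),
    Finset.sum_eq_zero]
  · simp
  · intro i _
    rw [key i.castSucc.succ (mergeAt i x), smul_zero]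
    intro m
    rcases lt_trichotomy m.val i.val with h | h | h
    · have h1 : i.castSucc.succ.succAbove m.succ = m.castSucc.succ := by
        rw [Fin.succAbove_of_castSucc_lt _ _ (by simp only [Fin.lt_def, Fin.val_castSucc, Fin.val_succ]; omega)]; rfl
      have h2 : i.castSucc.succ.succAbove m.castSucc = m.castSucc.castSucc := by
        rw [Fin.succAbove_of_castSucc_lt _ _ (by simp only [Fin.lt_def, Fin.val_castSucc, Fin.val_succ]; omega)]
      have h3 : mergeAt i x m = x m.castSucc := by
        rw [mergeAt, if_pos (Fin.lt_def.2 h)]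
      rw [h1, h2, h3, hx']
    · have h1 : i.castSucc.succ.succAbove m.succ = m.succ.succ := by
        rw [Fin.succAbove_of_le_castSucc _ _ (by simp only [Fin.le_def, Fin.val_castSucc, Fin.val_succ]; omega)]
      have h2 : i.castSucc.succ.succAbove m.castSucc = m.castSucc.castSucc := by
        rw [Fin.succAbove_of_castSucc_lt _ _ (by simp only [Fin.lt_def, Fin.val_castSucc, Fin.val_succ]; omega)]
      have h3 : mergeAt i x m = x m.castSucc * x m.succ := by
        rw [mergeAt, if_neg (by simp only [Fin.lt_def]; omega), if_pos (Fin.ext h)]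
      rw [h1, h2, h3, ← mul_assoc, hl, mul_assoc, hr]
    · have h1 : i.castSucc.succ.succAbove m.succ = m.succ.succ := by
        rw [Fin.succAbove_of_le_castSucc _ _ (by simp only [Fin.le_def, Fin.val_castSucc, Fin.val_succ]; omega)]
      have h2 : i.castSucc.succ.succAbove m.castSucc = m.succ.castSucc := by
        rw [Fin.succAbove_of_le_castSucc _ _ (by simp only [Fin.le_def, Fin.val_castSucc, Fin.val_succ]; omega)]; rfl
      have h3 : mergeAt i x m = x m.succ := by
        rw [mergeAt, if_neg (by simp only [Fin.lt_def]; omega),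
          if_neg (by simp only [Fin.ext_iff]; omega)]
      rw [h1, h2, h3, hx']
  · intro i
    rw [Fin.succAbove_last]
    exact hx' i.castSucc
  · intro i
    rw [Fin.succAbove_zero]
    exact hx' i.succ

/-- The complex of relative Hochschild cochains of `T` with values in the `T`-bimodule `X`,
relative to the subalgebra `R`, filtered by the length of trajectories. -/
def filteredComplex {n : ℕ} (R : Subalgebra k T) (e : LinQuiver n → T) (he : ∀ i, e i * e i = e i) :
    FilteredComplex k where
  C l := relCochain X R l
  d l := (coboundary k T X l).restrict fun _ hf => coboundary_mem hf
  d_comp_d l f := Subtype.ext (coboundary_coboundary f.1)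
  F t l := trajectoryFiltration X R e t l
  F_succ_le t l f hf := fun τ hτ x hx => hf τ (by omega) x hx
  d_mem _ _ _ hf := coboundary_mem_trajectoryFiltration X he hf

end

end RelHochschild

section TriangularAlgebra

open scoped TensorProduct

variable (k : Type u) [Field k]
  (A₁ A₂ A₃ : Type u) [Ring A₁] [Ring A₂] [Ring A₃]
  [Algebra k A₁] [Algebra k A₂] [Algebra k A₃]
  (M₂₁ M₃₂ M₃₁ : Type u)
  [AddCommGroup M₂₁] [Module k M₂₁] [Module A₂ M₂₁] [Module A₁ᵐᵒᵖ M₂₁]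
  [AddCommGroup M₃₂] [Module k M₃₂] [Module A₃ M₃₂] [Module A₂ᵐᵒᵖ M₃₂]
  [AddCommGroup M₃₁] [Module k M₃₁] [Module A₃ M₃₁] [Module A₁ᵐᵒᵖ M₃₁]

/-- The multiplication datum of a triangular algebra of size `3` with diagonal entries `Aᵢ` and
entries `ⱼMᵢ` below the diagonal: a `k`-linear map `μ : ₃M₂ ⊗ ₂M₁ → ₃M₁` for which the
multiplication of lower triangular matrices is associative, i.e. which is `A₃`-linear on the left,
`A₁`-linear on the right, and `A₂`-balanced. -/
structure TriangularDatum where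
  μ : M₃₂ ⊗[k] M₂₁ →ₗ[k] M₃₁
  left_linear : ∀ (c : A₃) (y : M₃₂) (x : M₂₁), μ ((c • y) ⊗ₜ x) = c • μ (y ⊗ₜ x)
  right_linear : ∀ (a : A₁) (y : M₃₂) (x : M₂₁),
    μ (y ⊗ₜ (MulOpposite.op a • x)) = MulOpposite.op a • μ (y ⊗ₜ x)
  balanced : ∀ (b : A₂) (y : M₃₂) (x : M₂₁),
    μ ((MulOpposite.op b • y) ⊗ₜ x) = μ (y ⊗ₜ (b • x))

variable {k A₁ A₂ A₃ M₂₁ M₃₂ M₃₁}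

/-- The triangular algebra: the lower triangular matrices
`(a₁, 0, 0; m₂₁, a₂, 0; m₃₁, m₃₂, a₃)`. -/
@[ext]
structure Triangular (D : TriangularDatum k A₁ A₂ A₃ M₂₁ M₃₂ M₃₁) : Type u where
  a₁ : A₁
  a₂ : A₂
  a₃ : A₃
  m₂₁ : M₂₁
  m₃₂ : M₃₂
  m₃₁ : M₃₁

namespace Triangular

variable {D : TriangularDatum k A₁ A₂ A₃ M₂₁ M₃₂ M₃₁}

instance : Zero (Triangular D) := ⟨⟨0, 0, 0, 0, 0, 0⟩⟩

instance : One (Triangular D) := ⟨⟨1, 1, 1, 0, 0, 0⟩⟩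

instance : Add (Triangular D) := ⟨fun s t =>
  ⟨s.a₁ + t.a₁, s.a₂ + t.a₂, s.a₃ + t.a₃, s.m₂₁ + t.m₂₁, s.m₃₂ + t.m₃₂, s.m₃₁ + t.m₃₁⟩⟩

instance : Neg (Triangular D) := ⟨fun s => ⟨-s.a₁, -s.a₂, -s.a₃, -s.m₂₁, -s.m₃₂, -s.m₃₁⟩⟩

/-- The product of lower triangular matrices. -/
instance : Mul (Triangular D) := ⟨fun s t =>
  ⟨s.a₁ * t.a₁, s.a₂ * t.a₂, s.a₃ * t.a₃,
    MulOpposite.op t.a₁ • s.m₂₁ + s.a₂ • t.m₂₁,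
    MulOpposite.op t.a₂ • s.m₃₂ + s.a₃ • t.m₃₂,
    MulOpposite.op t.a₁ • s.m₃₁ + D.μ (s.m₃₂ ⊗ₜ t.m₂₁) + s.a₃ • t.m₃₁⟩⟩

instance : SMul k (Triangular D) := ⟨fun c s =>
  ⟨c • s.a₁, c • s.a₂, c • s.a₃, c • s.m₂₁, c • s.m₃₂, c • s.m₃₁⟩⟩

theorem zero_def : (0 : Triangular D) = ⟨0, 0, 0, 0, 0, 0⟩ := rfl

theorem one_def : (1 : Triangular D) = ⟨1, 1, 1, 0, 0, 0⟩ := rfl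

theorem add_def (s t : Triangular D) : s + t =
    ⟨s.a₁ + t.a₁, s.a₂ + t.a₂, s.a₃ + t.a₃, s.m₂₁ + t.m₂₁, s.m₃₂ + t.m₃₂, s.m₃₁ + t.m₃₁⟩ := rfl

theorem neg_def (s : Triangular D) :
    -s = ⟨-s.a₁, -s.a₂, -s.a₃, -s.m₂₁, -s.m₃₂, -s.m₃₁⟩ := rfl

theorem mul_def (s t : Triangular D) : s * t =
    ⟨s.a₁ * t.a₁, s.a₂ * t.a₂, s.a₃ * t.a₃,
      MulOpposite.op t.a₁ • s.m₂₁ + s.a₂ • t.m₂₁,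
      MulOpposite.op t.a₂ • s.m₃₂ + s.a₃ • t.m₃₂,
      MulOpposite.op t.a₁ • s.m₃₁ + D.μ (s.m₃₂ ⊗ₜ t.m₂₁) + s.a₃ • t.m₃₁⟩ := rfl

theorem smul_def (c : k) (s : Triangular D) : c • s =
    ⟨c • s.a₁, c • s.a₂, c • s.a₃, c • s.m₂₁, c • s.m₃₂, c • s.m₃₁⟩ := rfl

instance : AddCommGroup (Triangular D) where
  add_assoc _ _ _ := by simp [add_def, add_assoc]
  zero_add _ := by simp [add_def, zero_def]
  add_zero _ := by simp [add_def, zero_def]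
  add_comm _ _ := by simp [add_def, add_comm]
  neg_add_cancel _ := by simp [add_def, neg_def, zero_def]
  nsmul := nsmulRec
  zsmul := zsmulRec

instance : Module k (Triangular D) where
  one_smul _ := by simp [smul_def]
  mul_smul _ _ _ := by simp [smul_def, mul_smul]
  smul_zero _ := by simp [smul_def, zero_def]
  smul_add _ _ _ := by simp [smul_def, add_def]
  add_smul _ _ _ := by simp [smul_def, add_def, add_smul]
  zero_smul _ := by simp [smul_def, zero_def]

variable [SMulCommClass A₂ A₁ᵐᵒᵖ M₂₁] [SMulCommClass A₃ A₂ᵐᵒᵖ M₃₂] [SMulCommClass A₃ A₁ᵐᵒᵖ M₃₁]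

instance : Ring (Triangular D) where
  __ := (inferInstance : AddCommGroup (Triangular D))
  left_distrib _ _ _ := by
    ext <;> simp [mul_def, add_def, mul_add, add_smul, TensorProduct.tmul_add] <;> abel
  right_distrib _ _ _ := by
    ext <;> simp [mul_def, add_def, add_mul, add_smul, TensorProduct.add_tmul] <;> abel
  zero_mul _ := by simp [mul_def, zero_def]
  mul_zero _ := by simp [mul_def, zero_def]
  mul_assoc s t v := by
    ext <;> simp [mul_def, mul_assoc, mul_smul, TensorProduct.add_tmul, TensorProduct.tmul_add,
      D.left_linear, D.right_linear, D.balanced, smul_comm _ (MulOpposite.op v.a₁),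
      smul_comm _ (MulOpposite.op v.a₂)] <;> abel
  one_mul _ := by simp [mul_def, one_def]
  mul_one _ := by simp [mul_def, one_def]

variable [IsScalarTower k A₂ M₂₁] [IsScalarTower k A₁ᵐᵒᵖ M₂₁]
  [IsScalarTower k A₃ M₃₂] [IsScalarTower k A₂ᵐᵒᵖ M₃₂]
  [IsScalarTower k A₃ M₃₁] [IsScalarTower k A₁ᵐᵒᵖ M₃₁]

instance : Algebra k (Triangular D) :=
  Algebra.ofModule
    (fun c s t => by
      ext <;> simp [mul_def, smul_def, ← TensorProduct.smul_tmul', smul_comm _ c])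
    (fun c s t => by
      ext <;> simp [mul_def, smul_def, TensorProduct.tmul_smul, smul_comm _ c])

variable (D)

/-- The inclusion of `A₁` as a diagonal entry. -/
def ι₁ : A₁ →ₙₐ[k] Triangular D where
  toFun a := ⟨a, 0, 0, 0, 0, 0⟩
  map_smul' _ _ := by simp [smul_def]
  map_zero' := rfl
  map_add' _ _ := by simp [add_def]
  map_mul' _ _ := by simp [mul_def]

/-- The inclusion of `A₂` as a diagonal entry. -/
def ι₂ : A₂ →ₙₐ[k] Triangular D where
  toFun a := ⟨0, a, 0, 0, 0, 0⟩
  map_smul' _ _ := by simp [smul_def]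
  map_zero' := rfl
  map_add' _ _ := by simp [add_def]
  map_mul' _ _ := by simp [mul_def]

/-- The inclusion of `A₃` as a diagonal entry. -/
def ι₃ : A₃ →ₙₐ[k] Triangular D where
  toFun a := ⟨0, 0, a, 0, 0, 0⟩
  map_smul' _ _ := by simp [smul_def]
  map_zero' := rfl
  map_add' _ _ := by simp [add_def]
  map_mul' _ _ := by simp [mul_def]

/-- The idempotents `e₁, e₂, e₃` of the triangular algebra, `eᵢ` being the image of
the unit of `Aᵢ`. They are indexed by the vertices of the quiver `e₁ → e₂ → e₃`. -/
def e : LinQuiver 3 → Triangular D :=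
  ![ι₁ D 1, ι₂ D 1, ι₃ D 1]

theorem e_mul_e (i : LinQuiver 3) : e D i * e D i = e D i := by
  match i with
  | (0 : Fin 3) => exact (map_mul (ι₁ D) 1 1).symm.trans (by rw [mul_one]; rfl)
  | (1 : Fin 3) => exact (map_mul (ι₂ D) 1 1).symm.trans (by rw [mul_one]; rfl)
  | (2 : Fin 3) => exact (map_mul (ι₃ D) 1 1).symm.trans (by rw [mul_one]; rfl)

/-- The subalgebra `R` of the triangular algebra generated by `e₁, e₂, e₃`, i.e. the diagonal
matrices with entries in `k`. -/
def diagonal : Subalgebra k (Triangular D) := Algebra.adjoin k (Set.range (e D))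

variable (X : Type u) [AddCommGroup X] [Module k X] [Module (Triangular D) X]
  [Module (Triangular D)ᵐᵒᵖ X] [SMulCommClass (Triangular D) (Triangular D)ᵐᵒᵖ X]
  [IsScalarTower k (Triangular D) X] [IsScalarTower k (Triangular D)ᵐᵒᵖ X]

/-- The complex `Hom_{R-R}(T^{⊗_R •}, X)` that computes the Hochschild cohomology of the triangular
algebra `T` with coefficients in `X`, filtered by the length of the trajectories of the quiver of
`T`. -/
def filteredComplex : FilteredComplex k :=
  RelHochschild.filteredComplex X (diagonal D) (e D) (e_mul_e D)

end Triangular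

end TriangularAlgebra

section Corner

variable {k : Type u} [Field k] {B A T : Type u} [Ring B] [Ring A] [Ring T]
  [Algebra k B] [Algebra k A] [Algebra k T] (f : B →ₙₐ[k] T) (g : A →ₙₐ[k] T)
  (X : Type u) [AddCommGroup X] [Module k X] [Module T X] [Module Tᵐᵒᵖ X]
  [SMulCommClass T Tᵐᵒᵖ X] [IsScalarTower k T X] [IsScalarTower k Tᵐᵒᵖ X]

/-- For (not necessarily unital) homomorphisms `f : B → T` and `g : A → T`, the subspace
`f(1) X g(1)` of a `T`-bimodule `X`. -/
def cornerSubmodule : Submodule k X where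
  carrier := {x | ∃ y : X, f 1 • MulOpposite.op (g 1) • y = x}
  zero_mem' := ⟨0, by simp⟩
  add_mem' := by
    rintro _ _ ⟨x, rfl⟩ ⟨y, rfl⟩
    exact ⟨x + y, by simp⟩
  smul_mem' := by
    rintro c _ ⟨x, rfl⟩
    exact ⟨c • x, by simp [smul_comm _ c]⟩

/-- The subspace `f(1) X g(1)`, seen as a `B`-`A`-bimodule through `f` and `g`. -/
def Corner : Type u := cornerSubmodule f g X

namespace Corner

instance : AddCommGroup (Corner f g X) := inferInstanceAs (AddCommGroup (cornerSubmodule f g X))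

instance : Module k (Corner f g X) := inferInstanceAs (Module k (cornerSubmodule f g X))

variable {f g X}

theorem left_one (x : Corner f g X) : f 1 • x.1 = x.1 := by
  obtain ⟨x, y, rfl⟩ := x
  change f 1 • f 1 • _ = f 1 • _
  rw [← mul_smul, ← map_mul, mul_one]

theorem right_one (x : Corner f g X) : MulOpposite.op (g 1) • x.1 = x.1 := by
  obtain ⟨x, y, rfl⟩ := x
  change MulOpposite.op (g 1) • f 1 • _ = f 1 • _
  rw [← smul_comm (f 1), ← mul_smul (MulOpposite.op _), ← MulOpposite.op_mul, ← map_mul, mul_one]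

instance : SMul B (Corner f g X) :=
  ⟨fun b x => ⟨f b • x.1, f b • x.1, by
    rw [← smul_comm (f b), ← mul_smul, ← map_mul, one_mul, right_one]⟩⟩

instance : SMul Aᵐᵒᵖ (Corner f g X) :=
  ⟨fun a x => ⟨MulOpposite.op (g a.unop) • x.1, MulOpposite.op (g a.unop) • x.1, by
    rw [← mul_smul (MulOpposite.op _), ← MulOpposite.op_mul, ← map_mul, mul_one, smul_comm,
      left_one]⟩⟩

theorem smul_def (b : B) (x : Corner f g X) : (b • x).1 = f b • x.1 := rfl

theorem op_smul_def (a : Aᵐᵒᵖ) (x : Corner f g X) :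
    (a • x).1 = MulOpposite.op (g a.unop) • x.1 := rfl

theorem ext' {x y : Corner f g X} (h : x.1 = y.1) : x = y := Subtype.ext h

theorem val_add (x y : Corner f g X) : (x + y).1 = x.1 + y.1 := rfl

theorem val_zero : (0 : Corner f g X).1 = 0 := rfl

theorem val_smul (c : k) (x : Corner f g X) : (c • x).1 = c • x.1 := rfl

instance : Module B (Corner f g X) where
  one_smul x := ext' (left_one x)
  mul_smul b c x := ext' (by simp only [smul_def, map_mul, mul_smul])
  smul_zero b := ext' (by simp only [smul_def, val_zero, smul_zero])
  smul_add b x y := ext' (by simp only [smul_def, val_add, smul_add])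
  add_smul b c x := ext' (by simp only [smul_def, val_add, map_add, add_smul])
  zero_smul x := ext' (by simp only [smul_def, val_zero, map_zero, zero_smul])

instance : Module Aᵐᵒᵖ (Corner f g X) where
  one_smul x := ext' (right_one x)
  mul_smul b c x := ext' (by
    simp only [op_smul_def, MulOpposite.unop_mul, map_mul, MulOpposite.op_mul, mul_smul])
  smul_zero b := ext' (by simp only [op_smul_def, val_zero, smul_zero])
  smul_add b x y := ext' (by simp only [op_smul_def, val_add, smul_add])
  add_smul b c x := ext' (by
    simp only [op_smul_def, val_add, MulOpposite.unop_add, map_add, MulOpposite.op_add, add_smul])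
  zero_smul x := ext' (by
    simp only [op_smul_def, val_zero, MulOpposite.unop_zero, map_zero, MulOpposite.op_zero,
      zero_smul])

instance : SMulCommClass B Aᵐᵒᵖ (Corner f g X) where
  smul_comm b a x := ext' (smul_comm (f b) (MulOpposite.op (g a.unop)) x.1)

instance : IsScalarTower k B (Corner f g X) where
  smul_assoc c b x := ext' (by simp only [smul_def, val_smul, map_smul, smul_assoc])

instance : IsScalarTower k Aᵐᵒᵖ (Corner f g X) where
  smul_assoc c a x := ext' (by
    simp only [op_smul_def, val_smul, MulOpposite.unop_smul, map_smul, MulOpposite.op_smul,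
      smul_assoc])

end Corner

end Corner

section BimoduleExt

open scoped TensorProduct

variable (k : Type u) [Field k] (B A : Type u) [Ring B] [Ring A] [Algebra k B] [Algebra k A]

/-- A `B`-`A`-bimodule (with the same action of `k` on both sides) as a module over
`B ⊗ Aᵒᵖ`, with `(b ⊗ a) m = b m a`. -/
noncomputable def bimoduleObj (M : Type u) [AddCommGroup M] [Module k M] [Module B M]
    [Module Aᵐᵒᵖ M] [SMulCommClass B Aᵐᵒᵖ M] [IsScalarTower k B M] [IsScalarTower k Aᵐᵒᵖ M] :
    ModuleCat.{u} (B ⊗[k] Aᵐᵒᵖ) :=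
  letI : Module (B ⊗[k] Aᵐᵒᵖ) M := TensorProduct.Algebra.module
  ModuleCat.of (B ⊗[k] Aᵐᵒᵖ) M

/-- The `k`-vector space `Ext^l_{B-A}(M, N)` for `B`-`A`-bimodules `M` and `N`: the extension group
in the abelian category of `B`-`A`-bimodules, i.e. of `B ⊗ Aᵒᵖ`-modules. -/
abbrev BimoduleExt (M N : Type u)
    [AddCommGroup M] [Module k M] [Module B M]
    [Module Aᵐᵒᵖ M] [SMulCommClass B Aᵐᵒᵖ M] [IsScalarTower k B M] [IsScalarTower k Aᵐᵒᵖ M]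
    [AddCommGroup N] [Module k N] [Module B N]
    [Module Aᵐᵒᵖ N] [SMulCommClass B Aᵐᵒᵖ N] [IsScalarTower k B N] [IsScalarTower k Aᵐᵒᵖ N]
    (l : ℕ) : Type u :=
  CategoryTheory.Abelian.Ext (bimoduleObj k B A M) (bimoduleObj k B A N) l

end BimoduleExt

/-! The term `E_1^{1,l}` is the cohomology of `F¹/F²` in degree `l + 1`, that is, of cochains on
trajectories of length exactly one. Such a trajectory stays at a vertex `i`, makes a single jump to
some `j > i` and stays there, so that `M_τ = A_j ⊗ ⋯ ⊗ A_j ⊗ ⱼMᵢ ⊗ A_i ⊗ ⋯ ⊗ A_i`. Hence the graded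
complex splits into three pieces, one for each entry below the diagonal. The map `μ` plays no role,
because it multiplies factors of two different jumps.

The piece of the entry `M = ⱼMᵢ` is the relative cochain complex of a triangular algebra of size
two, with diagonal `B = A_j`, `A = A_i` and entry `M`, over `k × k`, with coefficients in `N = ⱼXᵢ`,
where `B` acts on the left, `A` on the right, and `M` by zero. The identification is restriction
along the embedding `σ` (`restrictEntry`); it is a chain map on `F¹`, has a section given by
extension by zero (`extendEntry`), and the three restrictions together have kernel `F²` on `F¹` in
positive degrees (`restrictEntries_eq_zero_iff`).

It remains to see that this complex has cohomology `Ext^l(M, N)` in degree `l + 1`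
(`exists_surjective_ext`); the shift by one accounts for the factor `M`. There are no cochains in
degree zero, and a cocycle of degree one is a bimodule homomorphism `M → N`, which is the case `l =
0`. Over a field the cochains are an exact functor of `N`, and `N` embeds into the coinduced
bimodule `Hom_k(B ⊗ Aᵒᵖ, N)`. The latter is injective, and with these coefficients every cocycle of
degree at least two is a coboundary (`exists_relCoboundary_eq`): one homotopy moves the first entry
of a cochain into `M`, another one the last entry, and a relative cochain vanishes when two
different entries lie in `M`. Dimension shifting (`exists_surjective_succ`) does the rest. -/

open scoped TensorProduct

/-! ### The triangular algebra of size two and its action on bimodules -/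

/-- The algebra of lower triangular matrices `(a, 0; m, b)` with `a ∈ A`, `b ∈ B` and `m` in the
`B`-`A`-bimodule `M`. -/
@[ext]
structure TriangularTwo (k B A M : Type u) : Type u where
  b : B
  m : M
  a : A

namespace TriangularTwo

section Algebra

variable {k : Type u} [Field k] {B A M : Type u} [Ring B] [Ring A] [Algebra k B] [Algebra k A]
  [AddCommGroup M] [Module k M] [Module B M] [Module Aᵐᵒᵖ M]

instance : Zero (TriangularTwo k B A M) := ⟨⟨0, 0, 0⟩⟩

instance : One (TriangularTwo k B A M) := ⟨⟨1, 0, 1⟩⟩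

instance : Add (TriangularTwo k B A M) := ⟨fun s t => ⟨s.b + t.b, s.m + t.m, s.a + t.a⟩⟩

instance : Neg (TriangularTwo k B A M) := ⟨fun s => ⟨-s.b, -s.m, -s.a⟩⟩

instance : Mul (TriangularTwo k B A M) :=
  ⟨fun s t => ⟨s.b * t.b, s.b • t.m + MulOpposite.op t.a • s.m, s.a * t.a⟩⟩

instance : SMul k (TriangularTwo k B A M) := ⟨fun c s => ⟨c • s.b, c • s.m, c • s.a⟩⟩

@[simp] theorem zero_b : (0 : TriangularTwo k B A M).b = 0 := rfl
@[simp] theorem zero_m : (0 : TriangularTwo k B A M).m = 0 := rfl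
@[simp] theorem zero_a : (0 : TriangularTwo k B A M).a = 0 := rfl
@[simp] theorem one_b : (1 : TriangularTwo k B A M).b = 1 := rfl
@[simp] theorem one_m : (1 : TriangularTwo k B A M).m = 0 := rfl
@[simp] theorem one_a : (1 : TriangularTwo k B A M).a = 1 := rfl

section

variable (s t : TriangularTwo k B A M) (c : k)

@[simp] theorem add_b : (s + t).b = s.b + t.b := rfl
@[simp] theorem add_m : (s + t).m = s.m + t.m := rfl
@[simp] theorem add_a : (s + t).a = s.a + t.a := rfl
@[simp] theorem neg_b : (-s).b = -s.b := rfl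
@[simp] theorem neg_m : (-s).m = -s.m := rfl
@[simp] theorem neg_a : (-s).a = -s.a := rfl
@[simp] theorem mul_b : (s * t).b = s.b * t.b := rfl
@[simp] theorem mul_m : (s * t).m = s.b • t.m + MulOpposite.op t.a • s.m := rfl
@[simp] theorem mul_a : (s * t).a = s.a * t.a := rfl
@[simp] theorem smul_b : (c • s).b = c • s.b := rfl
@[simp] theorem smul_m : (c • s).m = c • s.m := rfl
@[simp] theorem smul_a : (c • s).a = c • s.a := rfl

end

instance : AddCommGroup (TriangularTwo k B A M) where
  add_assoc _ _ _ := by ext <;> simp [add_assoc]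
  zero_add _ := by ext <;> simp
  add_zero _ := by ext <;> simp
  add_comm _ _ := by ext <;> simp [add_comm]
  neg_add_cancel _ := by ext <;> simp
  nsmul := nsmulRec
  zsmul := zsmulRec

instance : Module k (TriangularTwo k B A M) where
  one_smul _ := by ext <;> simp
  mul_smul _ _ _ := by ext <;> simp [mul_smul]
  smul_zero _ := by ext <;> simp
  smul_add _ _ _ := by ext <;> simp
  add_smul _ _ _ := by ext <;> simp [add_smul]
  zero_smul _ := by ext <;> simp

variable [SMulCommClass B Aᵐᵒᵖ M]

instance : Ring (TriangularTwo k B A M) where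
  __ := (inferInstance : AddCommGroup (TriangularTwo k B A M))
  left_distrib _ _ _ := by ext <;> simp [mul_add, add_smul]; abel
  right_distrib _ _ _ := by ext <;> simp [add_mul, add_smul]; abel
  zero_mul _ := by ext <;> simp
  mul_zero _ := by ext <;> simp
  mul_assoc s t v := by
    ext <;> simp [mul_assoc, mul_smul, smul_comm _ (MulOpposite.op v.a)]
    abel
  one_mul _ := by ext <;> simp
  mul_one _ := by ext <;> simp

variable [IsScalarTower k B M] [IsScalarTower k Aᵐᵒᵖ M]

instance : Algebra k (TriangularTwo k B A M) :=
  Algebra.ofModule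
    (fun c s t => by ext <;> simp [smul_comm _ c])
    (fun c s t => by ext <;> simp [smul_comm _ c])

variable (k B A M)

/-- The projection to the lower diagonal entry. -/
def fstHom : TriangularTwo k B A M →ₐ[k] B :=
  AlgHom.ofLinearMap ⟨⟨fun s => s.b, fun _ _ => rfl⟩, fun _ _ => rfl⟩ rfl fun _ _ => rfl

/-- The projection to the upper diagonal entry. -/
def sndHom : TriangularTwo k B A M →ₐ[k] A :=
  AlgHom.ofLinearMap ⟨⟨fun s => s.a, fun _ _ => rfl⟩, fun _ _ => rfl⟩ rfl fun _ _ => rfl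

/-- The inclusion of the lower diagonal entry. -/
def inB : B →ₗ[k] TriangularTwo k B A M where
  toFun b := ⟨b, 0, 0⟩
  map_add' _ _ := by ext <;> simp
  map_smul' _ _ := by ext <;> simp

/-- The inclusion of the entry below the diagonal. -/
def inM : M →ₗ[k] TriangularTwo k B A M where
  toFun m := ⟨0, m, 0⟩
  map_add' _ _ := by ext <;> simp
  map_smul' _ _ := by ext <;> simp

/-- The inclusion of the upper diagonal entry. -/
def inA : A →ₗ[k] TriangularTwo k B A M where
  toFun a := ⟨0, 0, a⟩
  map_add' _ _ := by ext <;> simp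
  map_smul' _ _ := by ext <;> simp

/-- The projection to the entry below the diagonal. -/
def projM : TriangularTwo k B A M →ₗ[k] M where
  toFun s := s.m
  map_add' _ _ := rfl
  map_smul' _ _ := rfl

/-- The diagonal matrices with entries in `k`. -/
def diag : Subalgebra k (TriangularTwo k B A M) where
  carrier := {s | ∃ β α : k, s = ⟨algebraMap k B β, 0, algebraMap k A α⟩}
  mul_mem' := by
    rintro _ _ ⟨β, α, rfl⟩ ⟨β', α', rfl⟩
    exact ⟨β * β', α * α', by ext <;> simp⟩
  add_mem' := by
    rintro _ _ ⟨β, α, rfl⟩ ⟨β', α', rfl⟩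
    exact ⟨β + β', α + α', by ext <;> simp⟩
  algebraMap_mem' c := ⟨c, c, by
    ext <;> simp [Algebra.algebraMap_eq_smul_one]⟩

variable {k B A M}

@[simp] theorem inB_b (b : B) : (inB k B A M b).b = b := rfl
@[simp] theorem inB_m (b : B) : (inB k B A M b).m = 0 := rfl
@[simp] theorem inB_a (b : B) : (inB k B A M b).a = 0 := rfl
@[simp] theorem inM_b (m : M) : (inM k B A M m).b = 0 := rfl
@[simp] theorem inM_m (m : M) : (inM k B A M m).m = m := rfl
@[simp] theorem inM_a (m : M) : (inM k B A M m).a = 0 := rfl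
@[simp] theorem inA_b (a : A) : (inA k B A M a).b = 0 := rfl
@[simp] theorem inA_m (a : A) : (inA k B A M a).m = 0 := rfl
@[simp] theorem inA_a (a : A) : (inA k B A M a).a = a := rfl

theorem inB_one_mem : inB k B A M 1 ∈ diag k B A M := ⟨1, 0, by ext <;> simp⟩

theorem inA_one_mem : inA k B A M 1 ∈ diag k B A M := ⟨0, 1, by ext <;> simp⟩

end Algebra

section Bimodule

variable {k : Type u} [Field k] {B A M : Type u} [Ring B] [Ring A] [Algebra k B] [Algebra k A]
  [AddCommGroup M] [Module k M] [Module B M] [Module Aᵐᵒᵖ M] [SMulCommClass B Aᵐᵒᵖ M]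
  [IsScalarTower k B M] [IsScalarTower k Aᵐᵒᵖ M]
  {N : Type u} [AddCommGroup N] [Module k N] [Module (B ⊗[k] Aᵐᵒᵖ) N]
  [IsScalarTower k (B ⊗[k] Aᵐᵒᵖ) N]

/-- A `B`-`A`-bimodule is a left module over the triangular algebra, through the projection
to `B`. -/
instance : Module (TriangularTwo k B A M) N :=
  Module.compHom N
    ((Algebra.TensorProduct.includeLeft : B →ₐ[k] B ⊗[k] Aᵐᵒᵖ).comp (fstHom k B A M)).toRingHom

/-- A `B`-`A`-bimodule is a right module over the triangular algebra, through the projection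
to `A`. -/
instance : Module (TriangularTwo k B A M)ᵐᵒᵖ N :=
  Module.compHom N
    ((Algebra.TensorProduct.includeRight : Aᵐᵒᵖ →ₐ[k] B ⊗[k] Aᵐᵒᵖ).comp
      (AlgHom.op (sndHom k B A M))).toRingHom

theorem smul_eq (s : TriangularTwo k B A M) (n : N) :
    s • n = (s.b ⊗ₜ[k] (1 : Aᵐᵒᵖ)) • n := rfl

theorem op_smul_eq (s : TriangularTwo k B A M) (n : N) :
    MulOpposite.op s • n = ((1 : B) ⊗ₜ[k] MulOpposite.op s.a) • n := rfl

instance : SMulCommClass (TriangularTwo k B A M) (TriangularTwo k B A M)ᵐᵒᵖ N where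
  smul_comm s t n := by
    obtain ⟨t, rfl⟩ := MulOpposite.op_surjective t
    simp only [smul_eq, op_smul_eq, ← mul_smul, Algebra.TensorProduct.tmul_mul_tmul, one_mul,
      mul_one]

instance : IsScalarTower k (TriangularTwo k B A M) N where
  smul_assoc c s n := by
    rw [smul_eq, smul_eq, smul_b, ← smul_assoc, TensorProduct.smul_tmul']

instance : IsScalarTower k (TriangularTwo k B A M)ᵐᵒᵖ N where
  smul_assoc c s n := by
    obtain ⟨s, rfl⟩ := MulOpposite.op_surjective s
    rw [← MulOpposite.op_smul, op_smul_eq, op_smul_eq, smul_a, ← smul_assoc,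
      ← TensorProduct.tmul_smul, MulOpposite.op_smul]

end Bimodule

end TriangularTwo

/-! ### Gap conditions, and faces of a tuple with one entry added -/

namespace RelHochschild

section

variable {k : Type u} [Field k] {T : Type u} [Ring T] [Algebra k T]
  {X : Type u} [AddCommGroup X] [Module k X] [Module T X] [Module Tᵐᵒᵖ X]
  [SMulCommClass T Tᵐᵒᵖ X] [IsScalarTower k T X] [IsScalarTower k Tᵐᵒᵖ X]

theorem gapLeft_zero {l : ℕ} (f : MultilinearMap k (fun _ : Fin l => T) X) (r : T)
    (t : Fin l → T) : gapLeft f r t 0 = r • f t := rfl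

theorem gapLeft_succ {l : ℕ} (f : MultilinearMap k (fun _ : Fin l => T) X) (r : T)
    (t : Fin l → T) (i : Fin l) :
    gapLeft f r t i.succ = f (Function.update t i (t i * r)) := rfl

theorem gapRight_last {l : ℕ} (f : MultilinearMap k (fun _ : Fin l => T) X) (r : T)
    (t : Fin l → T) : gapRight f r t (Fin.last l) = MulOpposite.op r • f t := by
  simp [gapRight]

theorem gapRight_castSucc {l : ℕ} (f : MultilinearMap k (fun _ : Fin l => T) X) (r : T)
    (t : Fin l → T) (i : Fin l) :
    gapRight f r t i.castSucc = f (Function.update t i (r * t i)) := by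
  simp [gapRight]

/-- The coboundary of the complex of relative Hochschild cochains. -/
def relCoboundary (R : Subalgebra k T) (l : ℕ) : relCochain X R l →ₗ[k] relCochain X R (l + 1) :=
  (coboundary k T X l).restrict fun _ hf => coboundary_mem hf

theorem relCoboundary_relCoboundary (R : Subalgebra k T) {l : ℕ} (f : relCochain X R l) :
    relCoboundary R (l + 1) (relCoboundary R l f) = 0 :=
  Subtype.ext (coboundary_coboundary f.1)

theorem mergeAt_zero_cons {l : ℕ} (s : T) (t : Fin (l + 1) → T) :
    mergeAt 0 (Fin.cons s t : Fin (l + 2) → T) = Fin.cons (s * t 0) (Fin.tail t) := by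
  ext i
  refine Fin.cases ?_ (fun i => ?_) i
  · simp [mergeAt]
  · simp [mergeAt, Fin.tail]

theorem mergeAt_succ_cons {l : ℕ} (i : Fin l) (s : T) (t : Fin (l + 1) → T) :
    mergeAt i.succ (Fin.cons s t : Fin (l + 2) → T) = Fin.cons s (mergeAt i t) := by
  ext j
  refine Fin.cases ?_ (fun j => ?_) j
  · simp [mergeAt]
  · simp [mergeAt]

theorem mergeAt_last_snoc {l : ℕ} (s : T) (t : Fin (l + 1) → T) :
    mergeAt (Fin.last l) (Fin.snoc t s : Fin (l + 2) → T) =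
      Fin.snoc (Fin.init t) (t (Fin.last l) * s) := by
  ext i
  refine Fin.lastCases ?_ (fun i => ?_) i
  · simp only [mergeAt, lt_self_iff_false, if_false, if_true, Fin.succ_last, Fin.snoc_last,
      Fin.snoc_castSucc]
  · simp only [mergeAt, Fin.castSucc_lt_last, if_true, Fin.snoc_castSucc, Fin.init]

theorem mergeAt_castSucc_snoc {l : ℕ} (i : Fin l) (s : T) (t : Fin (l + 1) → T) :
    mergeAt i.castSucc (Fin.snoc t s : Fin (l + 2) → T) = Fin.snoc (mergeAt i t) s := by
  ext j
  refine Fin.lastCases ?_ (fun j => ?_) j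
  · have h1 : ¬ Fin.last l < i.castSucc := not_lt_of_gt (Fin.castSucc_lt_last i)
    have h2 : Fin.last l ≠ i.castSucc := (Fin.castSucc_ne_last i).symm
    simp only [mergeAt, h1, h2, if_false, Fin.succ_last, Fin.snoc_last]
  · simp only [mergeAt, Fin.castSucc_lt_castSucc_iff, Fin.castSucc_inj, Fin.snoc_castSucc,
      Fin.succ_castSucc]

theorem init_cons {l : ℕ} (s : T) (t : Fin (l + 1) → T) :
    Fin.init (Fin.cons s t : Fin (l + 2) → T) = Fin.cons s (Fin.init t) := by
  funext i
  refine Fin.cases ?_ (fun i => ?_) i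
  · rw [Fin.init, Fin.castSucc_zero, Fin.cons_zero, Fin.cons_zero]
  · rw [Fin.init, ← Fin.succ_castSucc, Fin.cons_succ, Fin.cons_succ]
    rfl

theorem tail_snoc {l : ℕ} (s : T) (t : Fin (l + 1) → T) :
    Fin.tail (Fin.snoc t s : Fin (l + 2) → T) = Fin.snoc (Fin.tail t) s := by
  funext i
  refine Fin.lastCases ?_ (fun i => ?_) i
  · rw [Fin.tail, Fin.succ_last, Fin.snoc_last, Fin.snoc_last]
  · rw [Fin.tail, Fin.succ_castSucc, Fin.snoc_castSucc, Fin.snoc_castSucc]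
    rfl

end

end RelHochschild

/-! ### Vanishing of relative cochains of the triangular algebra of size two -/

namespace TriangularTwo

open RelHochschild

section Cochain

variable {k : Type u} [Field k] {B A M : Type u} [Ring B] [Ring A] [Algebra k B] [Algebra k A]
  [AddCommGroup M] [Module k M] [Module B M] [Module Aᵐᵒᵖ M] [SMulCommClass B Aᵐᵒᵖ M]
  [IsScalarTower k B M] [IsScalarTower k Aᵐᵒᵖ M]
  {N : Type u} [AddCommGroup N] [Module k N] [Module (B ⊗[k] Aᵐᵒᵖ) N]
  [IsScalarTower k (B ⊗[k] Aᵐᵒᵖ) N]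

theorem inB_one_smul (n : N) : inB k B A M 1 • n = n :=
  one_smul (B ⊗[k] Aᵐᵒᵖ) n

theorem inB_one_op_smul (n : N) : MulOpposite.op (inB k B A M 1) • n = 0 := by
  rw [op_smul_eq, inB_a, MulOpposite.op_zero, TensorProduct.tmul_zero]
  exact zero_smul (B ⊗[k] Aᵐᵒᵖ) n

theorem inA_one_op_smul (n : N) : MulOpposite.op (inA k B A M 1) • n = n :=
  one_smul (B ⊗[k] Aᵐᵒᵖ) n

/-- Relative cochains with values in a `B`-`A`-bimodule vanish in degree zero. -/
theorem relCochain_zero_eq_zero (f : relCochain N (diag k B A M) 0) : f = 0 := by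
  apply Subtype.ext
  ext t
  have := f.2 _ inB_one_mem t 0
  rw [gapLeft_zero, inB_one_smul, show (0 : Fin 1) = Fin.last 0 from rfl, gapRight_last,
    inB_one_op_smul] at this
  exact this

/-- The idempotent of `B` acts as the identity on the left of `N`, hence it can be created there and
pushed across the initial gap into the first entry. -/
theorem apply_cons_inB_mul {l : ℕ} (f : relCochain N (diag k B A M) (l + 1))
    (t : Fin (l + 1) → TriangularTwo k B A M) :
    f.1 t = f.1 (Function.update t 0 (inB k B A M 1 * t 0)) := by
  have := f.2 _ inB_one_mem t 0
  rwa [gapLeft_zero, inB_one_smul, ← Fin.castSucc_zero, gapRight_castSucc] at this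

theorem apply_mul_inA {l : ℕ} (f : relCochain N (diag k B A M) (l + 1))
    (t : Fin (l + 1) → TriangularTwo k B A M) :
    f.1 t = f.1 (Function.update t (Fin.last l) (t (Fin.last l) * inA k B A M 1)) := by
  have := f.2 _ inA_one_mem t (Fin.last _)
  rwa [gapRight_last, inA_one_op_smul, ← Fin.succ_last, gapLeft_succ, eq_comm] at this

/-- A relative cochain vanishes on a tuple whose first entry has no component in `B ⊕ M`. -/
theorem apply_eq_zero_of_first {l : ℕ} (f : relCochain N (diag k B A M) (l + 1))
    (t : Fin (l + 1) → TriangularTwo k B A M) (h : inB k B A M 1 * t 0 = 0) : f.1 t = 0 := by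
  rw [apply_cons_inB_mul, h, MultilinearMap.map_update_zero]

/-- A relative cochain vanishes on a tuple whose last entry has no component in `A ⊕ M`. -/
theorem apply_eq_zero_of_last {l : ℕ} (f : relCochain N (diag k B A M) (l + 1))
    (t : Fin (l + 1) → TriangularTwo k B A M) (h : t (Fin.last l) * inA k B A M 1 = 0) :
    f.1 t = 0 := by
  rw [apply_mul_inA, h, MultilinearMap.map_update_zero]

theorem apply_mul_gap {l : ℕ} (f : relCochain N (diag k B A M) (l + 2))
    {r : TriangularTwo k B A M} (hr : r ∈ diag k B A M)
    (t : Fin (l + 2) → TriangularTwo k B A M) (i : Fin (l + 1)) :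
    f.1 (Function.update t i.castSucc (t i.castSucc * r)) =
      f.1 (Function.update t i.succ (r * t i.succ)) := by
  have := f.2 r hr t i.succ.castSucc
  rw [gapRight_castSucc, ← Fin.succ_castSucc, gapLeft_succ] at this
  exact this

/-- A tuple that has reached the vertex of `A` stays there. The idempotent `e_A` moves to the right
one gap at a time: `e_A s = e_A s e_A` by triangularity, so an entry multiplied by `e_A` on the left
hands `e_A` on to the next entry. -/
theorem apply_inA_mul {l : ℕ} (f : relCochain N (diag k B A M) (l + 2)) (i : Fin (l + 1)) :
    ∀ (t : Fin (l + 2) → TriangularTwo k B A M), t 0 * inA k B A M 1 = t 0 →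
      f.1 t = f.1 (Function.update t i.succ (inA k B A M 1 * t i.succ)) := by
  refine Fin.induction ?_ ?_ i
  · intro t ht
    rw [← apply_mul_gap f inA_one_mem, Fin.castSucc_zero, ht, Function.update_eq_self]
  · intro i ih t ht
    have h0 : ∀ x, Function.update t i.castSucc.succ x 0 = t 0 := fun x =>
      Function.update_of_ne (Fin.succ_ne_zero _).symm _ _
    have e : ∀ s : TriangularTwo k B A M,
        inA k B A M 1 * s = inA k B A M 1 * s * inA k B A M 1 := fun s => by
      ext <;> simp
    have hn : i.succ.succ ≠ i.succ.castSucc := by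
      simp [Fin.ext_iff]
    have key := apply_mul_gap f (inA_one_mem (k := k) (B := B) (A := A) (M := M))
      (Function.update t i.succ.castSucc (inA k B A M 1 * t i.succ.castSucc)) i.succ
    rw [Function.update_self, ← e, Function.update_idem, Function.update_of_ne hn] at key
    rw [ih t ht, Fin.succ_castSucc, key, Function.update_comm hn.symm]
    have := ih (Function.update t i.succ.succ (inA k B A M 1 * t i.succ.succ))
      (by rw [Function.update_of_ne (Fin.succ_ne_zero _).symm]; exact ht)
    rw [this, Fin.succ_castSucc, Function.update_of_ne hn.symm]

/-- A relative cochain vanishes on a tuple that begins and ends with elements of `M`. -/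
theorem apply_eq_zero_of_mem_mem {l : ℕ} (f : relCochain N (diag k B A M) (l + 2))
    (t : Fin (l + 2) → TriangularTwo k B A M) (m m' : M) (h : t 0 = inM k B A M m)
    (h' : t (Fin.last _) = inM k B A M m') : f.1 t = 0 := by
  -- As `m e_A = m`, the idempotent `e_A` may be placed in front of the last entry, where `e_A m' =
  -- 0`.
  rw [apply_inA_mul f (Fin.last l) t (by rw [h]; ext <;> simp), Fin.succ_last, h']
  exact MultilinearMap.map_coord_zero _ (Fin.last _) (by
    rw [Function.update_self]; ext <;> simp)

end Cochain

/-! ### Coinduced modules and their injectivity -/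

section Coinduced

variable (k : Type u) [Field k] (E N : Type u) [Ring E] [Algebra k E] [AddCommGroup N] [Module k N]

/-- The coinduced module `Hom_k(E, N)`, with `(x φ)(y) = φ(y x)`. -/
def Coinduced : Type u := E →ₗ[k] N

namespace Coinduced

instance : AddCommGroup (Coinduced k E N) := inferInstanceAs (AddCommGroup (E →ₗ[k] N))

instance : Module k (Coinduced k E N) := inferInstanceAs (Module k (E →ₗ[k] N))

instance : FunLike (Coinduced k E N) E N := inferInstanceAs (FunLike (E →ₗ[k] N) E N)

instance : LinearMapClass (Coinduced k E N) k E N :=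
  inferInstanceAs (LinearMapClass (E →ₗ[k] N) k E N)

variable {k E N}

@[ext] theorem ext {φ ψ : Coinduced k E N} (h : ∀ y, φ y = ψ y) : φ = ψ := LinearMap.ext h

@[simp] theorem add_apply (φ ψ : Coinduced k E N) (y : E) : (φ + ψ) y = φ y + ψ y := rfl

@[simp] theorem smul_apply (c : k) (φ : Coinduced k E N) (y : E) : (c • φ) y = c • φ y := rfl

@[simp] theorem zero_apply (y : E) : (0 : Coinduced k E N) y = 0 := rfl

/-- Evaluation at an element. -/
def eval (y : E) : Coinduced k E N →ₗ[k] N := LinearMap.applyₗ (R := k) y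

@[simp] theorem eval_apply (y : E) (φ : Coinduced k E N) : eval y φ = φ y := rfl

instance : SMul E (Coinduced k E N) := ⟨fun x φ => (φ : E →ₗ[k] N) ∘ₗ LinearMap.mulRight k x⟩

theorem mul_smul_apply (x : E) (φ : Coinduced k E N) (y : E) : (x • φ) y = φ (y * x) := rfl

instance : Module E (Coinduced k E N) where
  one_smul _ := by ext; simp [mul_smul_apply]
  mul_smul _ _ _ := by ext; simp [mul_smul_apply, mul_assoc]
  smul_zero _ := by ext; simp [mul_smul_apply]
  smul_add _ _ _ := by ext; simp [mul_smul_apply]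
  add_smul _ _ _ := by ext; simp [mul_smul_apply, mul_add]
  zero_smul _ := by ext; simp [mul_smul_apply]

instance : IsScalarTower k E (Coinduced k E N) where
  smul_assoc _ _ _ := by ext; simp [mul_smul_apply]

variable (k E N) in
/-- The embedding of an `E`-module `N` into the coinduced module `Hom_k(E, N)`. -/
def unit [Module E N] [IsScalarTower k E N] : N →ₗ[E] Coinduced k E N where
  toFun n := (LinearMap.toSpanSingleton E N n).restrictScalars k
  map_add' _ _ := by ext; exact smul_add _ _ _
  map_smul' x n := by ext y; exact (mul_smul y x n).symm

theorem unit_injective [Module E N] [IsScalarTower k E N] :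
    Function.Injective (unit k E N) := fun n n' h => by
  have := congrArg (fun φ : Coinduced k E N => φ 1) h
  exact (one_smul E n).symm.trans (this.trans (one_smul E n'))

/-- Coinduced modules are injective, since all vector spaces are. -/
instance : Module.Injective E (Coinduced k E N) where
  out X Y _ _ _ _ f hf g := by
    let _ := Module.restrictScalars k E X
    have := IsScalarTower.restrictScalars k E X
    let _ := Module.restrictScalars k E Y
    have := IsScalarTower.restrictScalars k E Y
    -- Evaluation at `1` turns `E`-linear maps into the coinduced module into `k`-linear maps to
    -- `N`. The latter extend along a `k`-linear left inverse `s` of `f`, and `y ↦ (x ↦ h (x y))`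
    -- turns the extension back into an `E`-linear map.
    obtain ⟨s, hs⟩ := (f.restrictScalars k).exists_leftInverse_of_injective
      (LinearMap.ker_eq_bot.2 hf)
    let h : Y →ₗ[k] N := eval 1 ∘ₗ g.restrictScalars k ∘ₗ s
    refine ⟨⟨⟨fun y => h ∘ₗ (LinearMap.toSpanSingleton E Y y).restrictScalars k, ?_⟩, ?_⟩, ?_⟩
    · intro y y'
      ext x
      exact (congrArg h (smul_add x y y')).trans (map_add h _ _)
    · intro x y
      ext z
      exact congrArg h (mul_smul z x y).symm
    · intro x
      ext z
      change (g (s (z • f x))) 1 = g x z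
      rw [← map_smul f, show s (f (z • x)) = z • x from LinearMap.congr_fun hs (z • x), map_smul,
        mul_smul_apply, one_mul]

end Coinduced

end Coinduced

end TriangularTwo

/-! ### The two contractions of cochains with coinduced coefficients -/

namespace TriangularTwo

open RelHochschild

section Homotopy

variable {k : Type u} [Field k] {B A M : Type u} [Ring B] [Ring A] [Algebra k B] [Algebra k A]
  [AddCommGroup M] [Module k M] [Module B M] [Module Aᵐᵒᵖ M] [SMulCommClass B Aᵐᵒᵖ M]
  [IsScalarTower k B M] [IsScalarTower k Aᵐᵒᵖ M]
  {N : Type u} [AddCommGroup N] [Module k N]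

theorem coinduced_smul_tmul (s : TriangularTwo k B A M) (φ : Coinduced k (B ⊗[k] Aᵐᵒᵖ) N)
    (b : B) (a : Aᵐᵒᵖ) : (s • φ) (b ⊗ₜ a) = φ ((b * s.b) ⊗ₜ a) := by
  rw [smul_eq, Coinduced.mul_smul_apply, Algebra.TensorProduct.tmul_mul_tmul, mul_one]

theorem coinduced_op_smul_tmul (s : TriangularTwo k B A M) (φ : Coinduced k (B ⊗[k] Aᵐᵒᵖ) N)
    (b : B) (a : Aᵐᵒᵖ) :
    (MulOpposite.op s • φ) (b ⊗ₜ a) = φ (b ⊗ₜ (a * MulOpposite.op s.a)) := by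
  rw [op_smul_eq, Coinduced.mul_smul_apply, Algebra.TensorProduct.tmul_mul_tmul, mul_one]

theorem coinduced_ext {φ ψ : Coinduced k (B ⊗[k] Aᵐᵒᵖ) N}
    (h : ∀ b a, φ (b ⊗ₜ a) = ψ (b ⊗ₜ a)) : φ = ψ := by
  ext y
  induction y using TensorProduct.induction_on with
  | zero => rw [map_zero, map_zero]
  | tmul b a => exact h b a
  | add x y hx hy => rw [map_add, map_add, hx, hy]

/-- For a linear map `F`, the element `b ⊗ a ↦ F(b)(1 ⊗ a)`. -/
def uncurryLeft (F : B →ₗ[k] Coinduced k (B ⊗[k] Aᵐᵒᵖ) N) : Coinduced k (B ⊗[k] Aᵐᵒᵖ) N :=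
  TensorProduct.lift (LinearMap.lcomp k N
    (Algebra.TensorProduct.includeRight : Aᵐᵒᵖ →ₐ[k] B ⊗[k] Aᵐᵒᵖ).toLinearMap ∘ₗ F)

theorem uncurryLeft_tmul (F : B →ₗ[k] Coinduced k (B ⊗[k] Aᵐᵒᵖ) N) (b : B) (a : Aᵐᵒᵖ) :
    uncurryLeft F (b ⊗ₜ a) = F b (1 ⊗ₜ a) := rfl

/-- For a linear map `F`, the element `b ⊗ a ↦ F(a)(b ⊗ 1)`. -/
def uncurryRight (F : A →ₗ[k] Coinduced k (B ⊗[k] Aᵐᵒᵖ) N) : Coinduced k (B ⊗[k] Aᵐᵒᵖ) N :=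
  TensorProduct.lift (LinearMap.lcomp k N
    (Algebra.TensorProduct.includeLeft : B →ₐ[k] B ⊗[k] Aᵐᵒᵖ).toLinearMap ∘ₗ F ∘ₗ
      (MulOpposite.opLinearEquiv k).symm.toLinearMap).flip

theorem uncurryRight_tmul (F : A →ₗ[k] Coinduced k (B ⊗[k] Aᵐᵒᵖ) N) (b : B) (a : Aᵐᵒᵖ) :
    uncurryRight F (b ⊗ₜ a) = F a.unop (b ⊗ₜ 1) := rfl

/-- The cochain `h f` with `(h f)(s₁, …, s_l)(b ⊗ a) = f(b, s₁, …, s_l)(1 ⊗ a)`. -/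
def contractLeft {l : ℕ}
    (f : MultilinearMap k (fun _ : Fin (l + 1) => TriangularTwo k B A M)
      (Coinduced k (B ⊗[k] Aᵐᵒᵖ) N)) :
    MultilinearMap k (fun _ : Fin l => TriangularTwo k B A M) (Coinduced k (B ⊗[k] Aᵐᵒᵖ) N) :=
  MultilinearMap.mk' (fun s => uncurryLeft (f.toLinearMap (Fin.cons 0 s) 0 ∘ₗ inB k B A M))
    (by
      intro t m x y
      refine coinduced_ext fun b a => ?_
      simp only [uncurryLeft_tmul, LinearMap.comp_apply, MultilinearMap.toLinearMap_apply,
        Fin.update_cons_zero, Coinduced.add_apply]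
      simp [Fin.cons_update])
    (by
      intro t m c x
      refine coinduced_ext fun b a => ?_
      simp only [uncurryLeft_tmul, LinearMap.comp_apply, MultilinearMap.toLinearMap_apply,
        Fin.update_cons_zero, Coinduced.smul_apply]
      simp [Fin.cons_update])

theorem contractLeft_apply {l : ℕ}
    (f : MultilinearMap k (fun _ : Fin (l + 1) => TriangularTwo k B A M)
      (Coinduced k (B ⊗[k] Aᵐᵒᵖ) N)) (s : Fin l → TriangularTwo k B A M) (b : B) (a : Aᵐᵒᵖ) :
    contractLeft f s (b ⊗ₜ a) =
      f (Fin.cons (inB k B A M b) s : Fin (l + 1) → TriangularTwo k B A M) (1 ⊗ₜ a) := by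
  simp only [contractLeft, MultilinearMap.mk'_apply, uncurryLeft_tmul, LinearMap.comp_apply,
    MultilinearMap.toLinearMap_apply, Fin.update_cons_zero]

/-- The cochain `h f` with `(h f)(s₁, …, s_l)(b ⊗ a) = f(s₁, …, s_l, a)(b ⊗ 1)`. -/
def contractRight {l : ℕ}
    (f : MultilinearMap k (fun _ : Fin (l + 1) => TriangularTwo k B A M)
      (Coinduced k (B ⊗[k] Aᵐᵒᵖ) N)) :
    MultilinearMap k (fun _ : Fin l => TriangularTwo k B A M) (Coinduced k (B ⊗[k] Aᵐᵒᵖ) N) :=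
  MultilinearMap.mk'
    (fun s => uncurryRight (f.toLinearMap (Fin.snoc s 0) (Fin.last l) ∘ₗ inA k B A M))
    (by
      intro t m x y
      refine coinduced_ext fun b a => ?_
      simp only [uncurryRight_tmul, LinearMap.comp_apply, MultilinearMap.toLinearMap_apply,
        Fin.update_snoc_last, Coinduced.add_apply]
      simp [Fin.snoc_update])
    (by
      intro t m c x
      refine coinduced_ext fun b a => ?_
      simp only [uncurryRight_tmul, LinearMap.comp_apply, MultilinearMap.toLinearMap_apply,
        Fin.update_snoc_last, Coinduced.smul_apply]
      simp [Fin.snoc_update])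

theorem contractRight_apply {l : ℕ}
    (f : MultilinearMap k (fun _ : Fin (l + 1) => TriangularTwo k B A M)
      (Coinduced k (B ⊗[k] Aᵐᵒᵖ) N)) (s : Fin l → TriangularTwo k B A M) (b : B) (a : Aᵐᵒᵖ) :
    contractRight f s (b ⊗ₜ a) =
      f (Fin.snoc s (inA k B A M a.unop) : Fin (l + 1) → TriangularTwo k B A M) (b ⊗ₜ 1) := by
  simp only [contractRight, MultilinearMap.mk'_apply, uncurryRight_tmul, LinearMap.comp_apply,
    MultilinearMap.toLinearMap_apply, Fin.update_snoc_last]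

theorem inB_mul_diag {r : TriangularTwo k B A M} (hr : r ∈ diag k B A M) (b : B) :
    inB k B A M b * r = inB k B A M (b * r.b) := by
  obtain ⟨β, α, rfl⟩ := hr
  ext <;> simp

theorem diag_mul_inA {r : TriangularTwo k B A M} (hr : r ∈ diag k B A M) (a : A) :
    r * inA k B A M a = inA k B A M (r.a * a) := by
  obtain ⟨β, α, rfl⟩ := hr
  ext <;> simp

/-- The gap `j` of `t` is the gap `j.succ` of `(b, t)`; for the initial gap, the left action of `r`
on the coinduced module becomes multiplication of `b` by `r` from the right. -/
theorem contractLeft_mem {l : ℕ}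
    (f : relCochain (Coinduced k (B ⊗[k] Aᵐᵒᵖ) N) (diag k B A M) (l + 1)) :
    contractLeft f.1 ∈ relCochain (Coinduced k (B ⊗[k] Aᵐᵒᵖ) N) (diag k B A M) l := by
  intro r hr t j
  refine coinduced_ext fun b a => ?_
  have h1 : gapLeft (contractLeft f.1) r t j (b ⊗ₜ a) =
      gapLeft f.1 r (Fin.cons (inB k B A M b) t) j.succ (1 ⊗ₜ a) := by
    refine Fin.cases ?_ (fun i => ?_) j
    · rw [gapLeft_zero, coinduced_smul_tmul, contractLeft_apply, gapLeft_succ, Fin.cons_zero,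
        Fin.update_cons_zero, inB_mul_diag hr]
    · rw [gapLeft_succ, contractLeft_apply, gapLeft_succ, Fin.cons_succ, Fin.cons_update]
  have h2 : gapRight (contractLeft f.1) r t j (b ⊗ₜ a) =
      gapRight f.1 r (Fin.cons (inB k B A M b) t) j.succ (1 ⊗ₜ a) := by
    refine Fin.lastCases ?_ (fun i => ?_) j
    · rw [gapRight_last, coinduced_op_smul_tmul, contractLeft_apply, Fin.succ_last, gapRight_last,
        coinduced_op_smul_tmul]
    · rw [gapRight_castSucc, contractLeft_apply, Fin.succ_castSucc, gapRight_castSucc,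
        Fin.cons_succ, Fin.cons_update]
  rw [h1, h2, f.2 r hr]

theorem contractRight_mem {l : ℕ}
    (f : relCochain (Coinduced k (B ⊗[k] Aᵐᵒᵖ) N) (diag k B A M) (l + 1)) :
    contractRight f.1 ∈ relCochain (Coinduced k (B ⊗[k] Aᵐᵒᵖ) N) (diag k B A M) l := by
  intro r hr t j
  refine coinduced_ext fun b a => ?_
  have h1 : gapLeft (contractRight f.1) r t j (b ⊗ₜ a) =
      gapLeft f.1 r (Fin.snoc t (inA k B A M a.unop)) j.castSucc (b ⊗ₜ 1) := by
    refine Fin.cases ?_ (fun i => ?_) j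
    · rw [gapLeft_zero, coinduced_smul_tmul, contractRight_apply, Fin.castSucc_zero, gapLeft_zero,
        coinduced_smul_tmul]
    · rw [gapLeft_succ, contractRight_apply, ← Fin.succ_castSucc, gapLeft_succ,
        Fin.snoc_castSucc, Fin.snoc_update]
  have h2 : gapRight (contractRight f.1) r t j (b ⊗ₜ a) =
      gapRight f.1 r (Fin.snoc t (inA k B A M a.unop)) j.castSucc (b ⊗ₜ 1) := by
    refine Fin.lastCases ?_ (fun i => ?_) j
    · rw [gapRight_last, coinduced_op_smul_tmul, contractRight_apply, gapRight_castSucc,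
        Fin.snoc_last, Fin.update_snoc_last, diag_mul_inA hr]
      rfl
    · rw [gapRight_castSucc, contractRight_apply, gapRight_castSucc, Fin.snoc_castSucc,
        Fin.snoc_update]
  rw [h1, h2, f.2 r hr]

/-- The first face of `f` at `(b, t)` is `b f(t)`, whose value at `1 ⊗ a` is `f(t)(b ⊗ a)`. In the
second face, `b t₀` has a component in `B`, which cancels against the first face of the contracted
cochain, and a component in `M`, which is the defect on the right. All other faces cancel in pairs.
-/
theorem coboundary_contractLeft_add {l : ℕ}
    (f : MultilinearMap k (fun _ : Fin (l + 1) => TriangularTwo k B A M)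
      (Coinduced k (B ⊗[k] Aᵐᵒᵖ) N)) (t : Fin (l + 1) → TriangularTwo k B A M)
    (b : B) (a : Aᵐᵒᵖ) :
    coboundary k _ _ l (contractLeft f) t (b ⊗ₜ a) +
      contractLeft (coboundary k _ _ (l + 1) f) t (b ⊗ₜ a) =
    f t (b ⊗ₜ a) - f (Fin.cons (inM k B A M (b • (t 0).m)) (Fin.tail t) :
      Fin (l + 1) → TriangularTwo k B A M) (1 ⊗ₜ a) := by
  have hs : ∀ {n : ℕ} (y : B ⊗[k] Aᵐᵒᵖ) (F : Fin n → Coinduced k (B ⊗[k] Aᵐᵒᵖ) N),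
      (∑ i, F i) y = ∑ i, F i y := fun y F => map_sum (Coinduced.eval y) F _
  have hm : inB k B A M b * t 0 = inB k B A M (b * (t 0).b) + inM k B A M (b • (t 0).m) := by
    ext <;> simp
  rw [contractLeft_apply, coboundary_apply, coboundary_apply, Fin.sum_univ_succ]
  simp only [Coinduced.add_apply, Coinduced.smul_apply, hs, coinduced_smul_tmul,
    coinduced_op_smul_tmul, contractLeft_apply, mergeAt_zero_cons, mergeAt_succ_cons, hm,
    MultilinearMap.cons_add, Fin.cons_zero, Fin.tail_cons, inB_b, one_mul, ← Fin.succ_last,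
    Fin.cons_succ, Fin.val_zero, Fin.val_succ, init_cons]
  simp only [pow_succ, mul_neg, mul_one, neg_smul, Finset.sum_neg_distrib, neg_neg, pow_zero,
    one_smul]
  abel

/-- The mirror image of the left contraction. The new entry is now the last one, so the faces before
it keep their signs; this is why a difference occurs here instead of a sum. -/
theorem coboundary_contractRight_sub {l : ℕ}
    (f : MultilinearMap k (fun _ : Fin (l + 1) => TriangularTwo k B A M)
      (Coinduced k (B ⊗[k] Aᵐᵒᵖ) N)) (t : Fin (l + 1) → TriangularTwo k B A M)
    (b : B) (a : Aᵐᵒᵖ) :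
    coboundary k _ _ l (contractRight f) t (b ⊗ₜ a) -
      contractRight (coboundary k _ _ (l + 1) f) t (b ⊗ₜ a) =
    (-1 : k) ^ (l + 1) • (f t (b ⊗ₜ a) - f (Fin.snoc (Fin.init t)
      (inM k B A M (a • (t (Fin.last l)).m)) : Fin (l + 1) → TriangularTwo k B A M)
        (b ⊗ₜ 1)) := by
  have hs : ∀ {n : ℕ} (y : B ⊗[k] Aᵐᵒᵖ) (F : Fin n → Coinduced k (B ⊗[k] Aᵐᵒᵖ) N),
      (∑ i, F i) y = ∑ i, F i y := fun y F => map_sum (Coinduced.eval y) F _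
  have hm : t (Fin.last l) * inA k B A M a.unop =
      inA k B A M ((t (Fin.last l)).a * a.unop) + inM k B A M (a • (t (Fin.last l)).m) := by
    ext <;> simp
  rw [contractRight_apply, coboundary_apply, coboundary_apply, Fin.sum_univ_castSucc]
  have h0 : (Fin.snoc t (inA k B A M a.unop) : Fin (l + 2) → TriangularTwo k B A M) 0 = t 0 := by
    rw [← Fin.castSucc_zero, Fin.snoc_castSucc]
  simp only [Coinduced.add_apply, Coinduced.smul_apply, hs, coinduced_smul_tmul,
    coinduced_op_smul_tmul, contractRight_apply, mergeAt_last_snoc, mergeAt_castSucc_snoc, hm,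
    MultilinearMap.snoc_add, Fin.snoc_last, Fin.init_snoc, inA_a, tail_snoc, h0, MulOpposite.unop_mul,
    MulOpposite.unop_op, Fin.val_last, Fin.val_castSucc, one_mul, MulOpposite.op_unop]
  simp only [pow_succ, mul_neg, mul_one, neg_smul, neg_neg, smul_sub, smul_add]
  abel

end Homotopy

end TriangularTwo

/-! ### Acyclicity of coinduced coefficients -/

namespace TriangularTwo

open RelHochschild CategoryTheory Abelian

section Acyclic

variable {k : Type u} [Field k] {B A M : Type u} [Ring B] [Ring A] [Algebra k B] [Algebra k A]
  [AddCommGroup M] [Module k M] [Module B M] [Module Aᵐᵒᵖ M] [SMulCommClass B Aᵐᵒᵖ M]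
  [IsScalarTower k B M] [IsScalarTower k Aᵐᵒᵖ M]
  {N : Type u} [AddCommGroup N] [Module k N]

/-- With coefficients in a coinduced bimodule, all cocycles of degree at least two are
coboundaries. -/
theorem exists_relCoboundary_eq {l : ℕ}
    (f : relCochain (Coinduced k (B ⊗[k] Aᵐᵒᵖ) N) (diag k B A M) (l + 2))
    (hf : relCoboundary (diag k B A M) (l + 2) f = 0) :
    ∃ g, relCoboundary (diag k B A M) (l + 1) g = f := by
  have hf' : coboundary k _ _ (l + 2) f.1 = 0 := congrArg Subtype.val hf
  have h0 : ∀ {n : ℕ} (t : Fin n → TriangularTwo k B A M) (y : B ⊗[k] Aᵐᵒᵖ),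
      contractLeft (0 : MultilinearMap k (fun _ : Fin (n + 1) => TriangularTwo k B A M)
        (Coinduced k (B ⊗[k] Aᵐᵒᵖ) N)) t y = 0 := fun t y => by
    have : contractLeft (0 : MultilinearMap k (fun _ => TriangularTwo k B A M)
        (Coinduced k (B ⊗[k] Aᵐᵒᵖ) N)) t = 0 := coinduced_ext fun b a => by
      rw [contractLeft_apply]; rfl
    rw [this]; rfl
  have h0' : ∀ {n : ℕ} (t : Fin n → TriangularTwo k B A M) (y : B ⊗[k] Aᵐᵒᵖ),
      contractRight (0 : MultilinearMap k (fun _ : Fin (n + 1) => TriangularTwo k B A M)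
        (Coinduced k (B ⊗[k] Aᵐᵒᵖ) N)) t y = 0 := fun t y => by
    have : contractRight (0 : MultilinearMap k (fun _ => TriangularTwo k B A M)
        (Coinduced k (B ⊗[k] Aᵐᵒᵖ) N)) t = 0 := coinduced_ext fun b a => by
      rw [contractRight_apply]; rfl
    rw [this]; rfl
  let f₁ : relCochain (Coinduced k (B ⊗[k] Aᵐᵒᵖ) N) (diag k B A M) (l + 1) :=
    ⟨contractLeft f.1, contractLeft_mem f⟩
  -- The left contraction replaces `f` by a cohomologous cocycle that depends on its first entry
  -- only through the component in `M`.
  let g := f - relCoboundary (diag k B A M) (l + 1) f₁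
  have hg : ∀ t b a, g.1 t (b ⊗ₜ a) = f.1 (Fin.cons (inM k B A M (b • (t 0).m)) (Fin.tail t) :
      Fin (l + 2) → TriangularTwo k B A M) (1 ⊗ₜ a) := fun t b a => by
    have := coboundary_contractLeft_add f.1 t b a
    rw [hf', h0, add_zero] at this
    change f.1 t (b ⊗ₜ a) - coboundary k _ _ (l + 1) (contractLeft f.1) t (b ⊗ₜ a) = _
    rw [this, sub_sub_cancel]
  have hdg : coboundary k _ _ (l + 2) g.1 = 0 := by
    have : relCoboundary (diag k B A M) (l + 2) g = 0 := by
      rw [map_sub, hf, relCoboundary_relCoboundary, sub_zero]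
    exact congrArg Subtype.val this
  -- The right contraction of `g` leaves a defect that evaluates `f` on a tuple whose first and last
  -- entries lie in `M`. In degree at least two these are different entries, so the defect vanishes;
  -- in degree one the argument breaks down.
  let g₁ : relCochain (Coinduced k (B ⊗[k] Aᵐᵒᵖ) N) (diag k B A M) (l + 1) :=
    ⟨contractRight g.1, contractRight_mem g⟩
  have hg₁ : relCoboundary (diag k B A M) (l + 1) g₁ = (-1 : k) ^ (l + 2) • g := by
    apply Subtype.ext
    ext t : 1
    refine coinduced_ext fun b a => ?_
    have := coboundary_contractRight_sub g.1 t b a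
    rw [hdg, h0', sub_zero, hg _ b 1, apply_eq_zero_of_mem_mem f _ _ (a • (t (Fin.last _)).m)
      (Fin.cons_zero _ _), Coinduced.zero_apply, sub_zero] at this
    · exact this
    · rw [← Fin.succ_last, Fin.cons_succ, Fin.tail, Fin.succ_last, Fin.snoc_last]
  refine ⟨f₁ + (-1 : k) ^ (l + 2) • g₁, ?_⟩
  rw [map_add, map_smul, hg₁, smul_smul, ← mul_pow, neg_one_mul, neg_neg, one_pow, one_smul]
  exact add_sub_cancel _ _

end Acyclic

/-! ### Exactness of relative cochains in the coefficients -/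

section Functoriality

variable {k : Type u} [Field k] {B A M : Type u} [Ring B] [Ring A] [Algebra k B] [Algebra k A]
  [AddCommGroup M] [Module k M] [Module B M] [Module Aᵐᵒᵖ M] [SMulCommClass B Aᵐᵒᵖ M]
  [IsScalarTower k B M] [IsScalarTower k Aᵐᵒᵖ M]
  {N : Type u} [AddCommGroup N] [Module k N] [Module (B ⊗[k] Aᵐᵒᵖ) N]
  [IsScalarTower k (B ⊗[k] Aᵐᵒᵖ) N]
  {N' : Type u} [AddCommGroup N'] [Module k N'] [Module (B ⊗[k] Aᵐᵒᵖ) N']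
  [IsScalarTower k (B ⊗[k] Aᵐᵒᵖ) N']

/-- Since diagonal matrices act on `N` by scalars on either side, the relative conditions survive
composition with an arbitrary `k`-linear map. Exactness thus needs only splittings of vector spaces.
-/
theorem diag_smul (β α : k) (n : N) :
    (⟨algebraMap k B β, 0, algebraMap k A α⟩ : TriangularTwo k B A M) • n = β • n := by
  rw [smul_eq, Algebra.algebraMap_eq_smul_one, ← TensorProduct.smul_tmul', smul_assoc]
  exact congrArg (β • ·) (one_smul (B ⊗[k] Aᵐᵒᵖ) n)

theorem diag_op_smul (β α : k) (n : N) :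
    MulOpposite.op (⟨algebraMap k B β, 0, algebraMap k A α⟩ : TriangularTwo k B A M) • n
      = α • n := by
  rw [op_smul_eq, show (MulOpposite.op (algebraMap k A α)) = α • (1 : Aᵐᵒᵖ) by
    rw [Algebra.algebraMap_eq_smul_one, MulOpposite.op_smul, MulOpposite.op_one],
    TensorProduct.tmul_smul, smul_assoc]
  exact congrArg (α • ·) (one_smul (B ⊗[k] Aᵐᵒᵖ) n)

variable (M) in
/-- Composition of relative cochains with a linear map of the coefficients. -/
def mapCochain (φ : N →ₗ[k] N') (l : ℕ) :
    relCochain N (diag k B A M) l →ₗ[k] relCochain N' (diag k B A M) l where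
  toFun f := ⟨φ.compMultilinearMap f.1, by
    rintro _ ⟨β, α, rfl⟩ t j
    have h1 : gapLeft (φ.compMultilinearMap f.1) ⟨algebraMap k B β, 0, algebraMap k A α⟩ t j =
        φ (gapLeft f.1 ⟨algebraMap k B β, 0, algebraMap k A α⟩ t j) := by
      refine Fin.cases ?_ (fun i => ?_) j
      · rw [gapLeft_zero, gapLeft_zero, diag_smul, diag_smul, map_smul]; rfl
      · rfl
    have h2 : gapRight (φ.compMultilinearMap f.1) ⟨algebraMap k B β, 0, algebraMap k A α⟩ t j =
        φ (gapRight f.1 ⟨algebraMap k B β, 0, algebraMap k A α⟩ t j) := by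
      refine Fin.lastCases ?_ (fun i => ?_) j
      · rw [gapRight_last, gapRight_last, diag_op_smul, diag_op_smul, map_smul]; rfl
      · rw [gapRight_castSucc, gapRight_castSucc]; rfl
    rw [h1, h2, f.2 _ ⟨β, α, rfl⟩]⟩
  map_add' f g := by
    apply Subtype.ext
    ext t
    exact map_add φ _ _
  map_smul' c f := by
    apply Subtype.ext
    ext t
    exact map_smul φ _ _

theorem mapCochain_apply (φ : N →ₗ[k] N') {l : ℕ} (f : relCochain N (diag k B A M) l)
    (t : Fin l → TriangularTwo k B A M) : (mapCochain M φ l f).1 t = φ (f.1 t) := rfl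

theorem relCoboundary_mapCochain (φ : N →ₗ[B ⊗[k] Aᵐᵒᵖ] N') {l : ℕ}
    (f : relCochain N (diag k B A M) l) :
    relCoboundary (diag k B A M) l (mapCochain M (φ.restrictScalars k) l f) =
      mapCochain M (φ.restrictScalars k) (l + 1) (relCoboundary (diag k B A M) l f) := by
  apply Subtype.ext
  ext t
  have hl : ∀ (s : TriangularTwo k B A M) (n : N), φ (s • n) = s • φ n := fun s n =>
    map_smul φ _ n
  have hr : ∀ (s : TriangularTwo k B A M) (n : N),
      φ (MulOpposite.op s • n) = MulOpposite.op s • φ n := fun s n => map_smul φ _ n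
  have hk : ∀ (c : k) (n : N), φ (c • n) = c • φ n := (φ.restrictScalars k).map_smul
  change coboundary k _ _ l (mapCochain M (φ.restrictScalars k) l f).1 t =
    φ (coboundary k _ _ l f.1 t)
  simp only [coboundary_apply, mapCochain_apply, map_add, map_sum, hl, hr, hk,
    LinearMap.restrictScalars_apply]

theorem mapCochain_injective {φ : N →ₗ[k] N'} (h : Function.Injective φ) (l : ℕ) :
    Function.Injective (mapCochain (B := B) (A := A) M φ l) := fun f g hfg => by
  apply Subtype.ext
  ext t
  exact h (congrArg (fun f => f.1 t) hfg)

/-- A `k`-linear section suffices for lifting cochains; it need not respect the bimodule structures,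
and hence not the coboundaries. -/
theorem mapCochain_surjective {φ : N →ₗ[k] N'} (h : Function.Surjective φ) (l : ℕ) :
    Function.Surjective (mapCochain (B := B) (A := A) M φ l) := fun f => by
  obtain ⟨s, hs⟩ := φ.exists_rightInverse_of_surjective (LinearMap.range_eq_top.2 h)
  refine ⟨mapCochain M s l f, ?_⟩
  apply Subtype.ext
  ext t
  exact LinearMap.congr_fun hs (f.1 t)

theorem exists_mapCochain_eq {N'' : Type u} [AddCommGroup N''] [Module k N'']
    [Module (B ⊗[k] Aᵐᵒᵖ) N''] [IsScalarTower k (B ⊗[k] Aᵐᵒᵖ) N'']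
    {φ : N →ₗ[k] N'} {ψ : N' →ₗ[k] N''} (hφ : Function.Injective φ) (h : Function.Exact φ ψ)
    {l : ℕ} (f : relCochain N' (diag k B A M) l) (hf : mapCochain M ψ l f = 0) :
    ∃ g, mapCochain M φ l g = f := by
  obtain ⟨s, hs⟩ := φ.exists_leftInverse_of_injective (LinearMap.ker_eq_bot.2 hφ)
  refine ⟨mapCochain M s l f, ?_⟩
  apply Subtype.ext
  ext t
  obtain ⟨n, hn⟩ := (h (f.1 t)).1 (congrArg (fun f => f.1 t) hf)
  rw [mapCochain_apply, mapCochain_apply, ← hn]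
  exact congrArg φ (LinearMap.congr_fun hs n)

variable (k B A M N) in
/-- The space of relative cocycles. -/
abbrev cocycles (l : ℕ) : Submodule k (relCochain N (diag k B A M) l) :=
  LinearMap.ker (relCoboundary (diag k B A M) l)

variable (k B A M N) in
/-- The coboundaries of degree `l + 1`, as a subspace of the space of cocycles. -/
abbrev coboundaries (l : ℕ) : Submodule k (cocycles k B A M N (l + 1)) :=
  (LinearMap.range (relCoboundary (X := N) (diag k B A M) l)).submoduleOf (cocycles k B A M N (l + 1))

variable (M) in
/-- The action of a bimodule homomorphism on cocycles. -/
def mapCocycles (φ : N →ₗ[B ⊗[k] Aᵐᵒᵖ] N') (l : ℕ) :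
    cocycles k B A M N l →ₗ[k] cocycles k B A M N' l :=
  (mapCochain M (φ.restrictScalars k) l).restrict fun f hf => by
    rw [LinearMap.mem_ker] at hf ⊢
    rw [relCoboundary_mapCochain, hf, map_zero]

end Functoriality

end TriangularTwo

set_option maxSynthPendingDepth 3

/-- If `α` and `ψ` are surjective and `ψ` vanishes exactly where `α` takes values in `W`, then `ψ`
factors through `α` as a surjective map with kernel `W`. -/
theorem LinearMap.exists_surjective_of_factor {R Γ Z V : Type*} [Field R] [AddCommGroup Γ]
    [AddCommGroup Z] [AddCommGroup V] [Module R Γ] [Module R Z] [Module R V] (α : Γ →ₗ[R] Z)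
    (ψ : Γ →ₗ[R] V) (hα : Function.Surjective α) (hψ : Function.Surjective ψ) (W : Submodule R Z)
    (h : ∀ γ, ψ γ = 0 ↔ α γ ∈ W) :
    ∃ Φ : Z →ₗ[R] V, Function.Surjective Φ ∧ LinearMap.ker Φ = W := by
  let Φ : Z →ₗ[R] V := (LinearMap.ker α).liftQ ψ (fun γ hγ => by
    rw [LinearMap.mem_ker] at hγ ⊢
    rw [h, hγ]
    exact W.zero_mem) ∘ₗ (α.quotKerEquivOfSurjective hα).symm.toLinearMap
  have hΦ : ∀ γ, Φ (α γ) = ψ γ := fun γ => by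
    have : (α.quotKerEquivOfSurjective hα).symm (α γ) = Submodule.Quotient.mk γ := by
      rw [LinearEquiv.symm_apply_eq]
      rfl
    simp [Φ, this]
  refine ⟨Φ, fun v => ?_, ?_⟩
  · obtain ⟨γ, rfl⟩ := hψ v
    exact ⟨α γ, hΦ γ⟩
  · ext z
    obtain ⟨γ, rfl⟩ := hα z
    rw [LinearMap.mem_ker, hΦ, h]

/-! ### Cocycles of degree one and `Ext⁰` -/

namespace TriangularTwo

open RelHochschild CategoryTheory Abelian

section Ext

variable {k : Type u} [Field k] {B A M : Type u} [Ring B] [Ring A] [Algebra k B] [Algebra k A]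
  [AddCommGroup M] [Module k M] [Module B M] [Module Aᵐᵒᵖ M] [SMulCommClass B Aᵐᵒᵖ M]
  [IsScalarTower k B M] [IsScalarTower k Aᵐᵒᵖ M]

section

variable {N : Type u} [AddCommGroup N] [Module k N] [Module (B ⊗[k] Aᵐᵒᵖ) N]
  [IsScalarTower k (B ⊗[k] Aᵐᵒᵖ) N]

theorem coboundary_one_apply (f : relCochain N (diag k B A M) 1) (s t : TriangularTwo k B A M) :
    (relCoboundary (diag k B A M) 1 f).1 ![s, t] =
      s • f.1 (fun _ => t) - f.1 (fun _ => s * t) + MulOpposite.op t • f.1 (fun _ => s) := by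
  change coboundary k _ _ 1 f.1 ![s, t] = _
  rw [coboundary_apply]
  have h1 : Fin.tail ![s, t] = fun _ => t := by
    funext i; fin_cases i; rfl
  have h2 : Fin.init ![s, t] = fun _ => s := by
    funext i; fin_cases i; rfl
  have h3 : mergeAt 0 ![s, t] = fun _ => s * t := by
    funext i; fin_cases i; rfl
  simp [h1, h2, h3, sub_eq_add_neg]

/-- This is the cocycle condition at the pair `(b, m)`. Its third term contains `f(b)`, which is
zero because `b e_A = 0`. -/
theorem cocycle_inM_smul (f : cocycles k B A M N 1) (b : B) (m : M) :
    f.1.1 (fun _ => inM k B A M (b • m)) = (b ⊗ₜ[k] (1 : Aᵐᵒᵖ)) • f.1.1 (fun _ => inM k B A M m) := by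
  have h := coboundary_one_apply f.1 (inB k B A M b) (inM k B A M m)
  rw [show relCoboundary (diag k B A M) 1 f.1 = 0 from f.2, apply_eq_zero_of_last f.1
    (fun _ => inB k B A M b) (by ext <;> simp), smul_zero, add_zero,
    show inB k B A M b * inM k B A M m = inM k B A M (b • m) by ext <;> simp] at h
  exact (sub_eq_zero.1 h.symm).symm

theorem cocycle_inM_op_smul (f : cocycles k B A M N 1) (a : Aᵐᵒᵖ) (m : M) :
    f.1.1 (fun _ => inM k B A M (a • m)) = ((1 : B) ⊗ₜ[k] a) • f.1.1 (fun _ => inM k B A M m) := by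
  have h := coboundary_one_apply f.1 (inM k B A M m) (inA k B A M a.unop)
  rw [show relCoboundary (diag k B A M) 1 f.1 = 0 from f.2, apply_eq_zero_of_first f.1
    (fun _ => inA k B A M a.unop) (by ext <;> simp), smul_zero, zero_sub,
    show inM k B A M m * inA k B A M a.unop = inM k B A M (a • m) by ext <;> simp] at h
  rw [← sub_eq_zero, ← neg_eq_zero, neg_sub, sub_eq_add_neg, add_comm]
  exact h.symm

/-- A relative cochain of degree one only sees `e_B s e_A`, the component of `s` in `M`; the
diagonal components contribute nothing. -/
theorem cocycle_ext (f : relCochain N (diag k B A M) 1)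
    (h : ∀ m, f.1 (fun _ => inM k B A M m) = 0) : f = 0 := by
  apply Subtype.ext
  ext t
  have ht : t = Function.update (fun _ => 0) 0
      (inB k B A M (t 0).b + inM k B A M (t 0).m + inA k B A M (t 0).a) := by
    funext i
    fin_cases i
    ext <;> simp
  have hu : ∀ s : TriangularTwo k B A M,
      Function.update (fun _ : Fin 1 => (0 : TriangularTwo k B A M)) 0 s = fun _ => s := by
    intro s
    funext i
    fin_cases i
    rfl
  rw [ht, MultilinearMap.map_update_add, MultilinearMap.map_update_add, hu, hu, hu, h,
    apply_eq_zero_of_last f _ (by ext <;> simp), apply_eq_zero_of_first f _ (by ext <;> simp)]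
  simp

/-- The restriction to `M` of a cochain of degree one. -/
def restrictM (f : relCochain N (diag k B A M) 1) : M →ₗ[k] N :=
  (MultilinearMap.ofSubsingleton k (TriangularTwo k B A M) N (0 : Fin 1)).symm f.1 ∘ₗ inM k B A M

theorem restrictM_apply (f : relCochain N (diag k B A M) 1) (m : M) :
    restrictM f m = f.1 (fun _ => inM k B A M m) := rfl

attribute [local instance] TensorProduct.Algebra.module

theorem restrictM_smul (f : cocycles k B A M N 1) (x : B ⊗[k] Aᵐᵒᵖ) (m : M) :
    restrictM f.1 (x • m) = x • restrictM f.1 m := by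
  induction x using TensorProduct.induction_on with
  | zero =>
    refine (congrArg (restrictM f.1) (zero_smul (B ⊗[k] Aᵐᵒᵖ) m)).trans ?_
    exact (map_zero _).trans (zero_smul (B ⊗[k] Aᵐᵒᵖ) (restrictM f.1 m)).symm
  | tmul b a =>
    rw [TensorProduct.Algebra.smul_def, restrictM_apply, cocycle_inM_smul, cocycle_inM_op_smul,
      ← mul_smul, Algebra.TensorProduct.tmul_mul_tmul, mul_one, one_mul, restrictM_apply]
  | add x y hx hy => rw [add_smul, add_smul, map_add, hx, hy]

/-- A cocycle of degree one restricts to a bimodule homomorphism on `M`. -/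
def homOfCocycle (f : cocycles k B A M N 1) : M →ₗ[B ⊗[k] Aᵐᵒᵖ] N where
  toFun := restrictM f.1
  map_add' := map_add _
  map_smul' := restrictM_smul f

/-- The isomorphism between cocycles of degree one and `Ext⁰`. -/
noncomputable def extOfCocycle : cocycles k B A M N 1 →ₗ[k]
    Ext (ModuleCat.of (B ⊗[k] Aᵐᵒᵖ) M) (ModuleCat.of (B ⊗[k] Aᵐᵒᵖ) N) 0 where
  toFun f := Ext.mk₀ (ModuleCat.ofHom (homOfCocycle f))
  map_add' f g := by
    rw [← Ext.mk₀_add]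
    rfl
  map_smul' c f := by
    refine Eq.trans (congrArg Ext.mk₀ ?_) (Ext.mk₀_smul c (ModuleCat.ofHom (homOfCocycle f)))
    refine ModuleCat.hom_ext (LinearMap.ext fun m => ?_)
    exact (algebraMap_smul (B ⊗[k] Aᵐᵒᵖ) c (restrictM f.1 m)).symm

theorem extOfCocycle_injective :
    Function.Injective (extOfCocycle : cocycles k B A M N 1 →ₗ[k] _) := by
  refine (injective_iff_map_eq_zero _).2 fun f hf => Subtype.ext (cocycle_ext f.1 fun m => ?_)
  have : ModuleCat.ofHom (homOfCocycle f) = 0 := (Ext.mk₀_eq_zero_iff _).1 hf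
  exact congrArg (fun φ => φ.hom m) this

/-- The cochain `s ↦ φ(m)` of degree one, where `m` is the entry of `s` in `M`. -/
def cochainOfLinear (φ : M →ₗ[k] N) : MultilinearMap k (fun _ : Fin 1 => TriangularTwo k B A M) N :=
  MultilinearMap.ofSubsingleton k (TriangularTwo k B A M) N (0 : Fin 1) (φ ∘ₗ projM k B A M)

theorem cochainOfLinear_apply (φ : M →ₗ[k] N) (t : Fin 1 → TriangularTwo k B A M) :
    cochainOfLinear φ t = φ (t 0).m := rfl

theorem cochainOfLinear_mem (φ : M →ₗ[k] N) :
    cochainOfLinear φ ∈ relCochain N (diag k B A M) 1 := by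
  rintro _ ⟨β, α, rfl⟩ t j
  refine Fin.cases ?_ (fun i => ?_) j
  · rw [gapLeft_zero, diag_smul, ← Fin.castSucc_zero, gapRight_castSucc, cochainOfLinear_apply,
      cochainOfLinear_apply, Function.update_self]
    simp
  · obtain rfl : i = 0 := Subsingleton.elim _ _
    rw [gapLeft_succ, show Fin.succ (0 : Fin 1) = Fin.last 1 from rfl, gapRight_last,
      diag_op_smul, cochainOfLinear_apply, cochainOfLinear_apply, Function.update_self]
    simp [Algebra.algebraMap_eq_smul_one]

theorem extOfCocycle_surjective :
    Function.Surjective (extOfCocycle : cocycles k B A M N 1 →ₗ[k] _) := by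
  intro e
  obtain ⟨φ, rfl⟩ := (Ext.mk₀_bijective _ _).2 e
  let φ' : M →ₗ[B ⊗[k] Aᵐᵒᵖ] N := φ.hom
  have hb : ∀ (b : B) (m : M), φ' (b • m) = (b ⊗ₜ[k] (1 : Aᵐᵒᵖ)) • φ' m := fun b m => by
    rw [← map_smul, TensorProduct.Algebra.smul_def, one_smul]
  have ha : ∀ (a : Aᵐᵒᵖ) (m : M), φ' (a • m) = ((1 : B) ⊗ₜ[k] a) • φ' m := fun a m => by
    rw [← map_smul, TensorProduct.Algebra.smul_def, one_smul]
  -- The given action of `k` on `M` is the one through `B`, so linearity over `B ⊗ Aᵒᵖ` implies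
  -- linearity over `k`.
  let ψ : M →ₗ[k] N :=
    { toFun := φ'
      map_add' := map_add φ'
      map_smul' := fun c m => by
        rw [← algebraMap_smul B c m, hb, Algebra.algebraMap_eq_smul_one,
          ← TensorProduct.smul_tmul', smul_assoc]
        exact congrArg (c • ·) (one_smul (B ⊗[k] Aᵐᵒᵖ) _) }
  refine ⟨⟨⟨cochainOfLinear ψ, cochainOfLinear_mem ψ⟩, ?_⟩, congrArg Ext.mk₀ rfl⟩
  rw [LinearMap.mem_ker]
  apply Subtype.ext
  ext t
  obtain ⟨s, t, rfl⟩ : ∃ s s', t = ![s, s'] :=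
    ⟨t 0, t 1, by funext i; fin_cases i <;> rfl⟩
  rw [coboundary_one_apply]
  simp only [cochainOfLinear_apply, mul_m, smul_eq, op_smul_eq]
  change _ - φ' _ + _ = 0
  rw [map_add, hb, ha]
  change _ • φ' _ - _ + _ • φ' _ = 0
  abel

/-- Naturality in the coefficients, required for the first dimension shift, where `Ext⁰` into an
injective bimodule need not vanish. -/
theorem mapCocycles_extOfCocycle {N' : Type u} [AddCommGroup N'] [Module k N']
    [Module (B ⊗[k] Aᵐᵒᵖ) N'] [IsScalarTower k (B ⊗[k] Aᵐᵒᵖ) N'] (p : N →ₗ[B ⊗[k] Aᵐᵒᵖ] N')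
    (f : cocycles k B A M N 1) :
    extOfCocycle (mapCocycles M p 1 f) =
      (extOfCocycle f).comp (Ext.mk₀ (ModuleCat.ofHom p)) (add_zero 0) :=
  (Ext.mk₀_comp_mk₀ (ModuleCat.ofHom (homOfCocycle f)) (ModuleCat.ofHom p)).symm

theorem coboundaries_zero_eq_bot : coboundaries k B A M N 0 = ⊥ := by
  refine (Submodule.eq_bot_iff _).2 ?_
  rintro x ⟨y, hy⟩
  apply Subtype.ext
  rw [relCochain_zero_eq_zero y, map_zero] at hy
  exact hy.symm

theorem ker_extOfCocycle : LinearMap.ker (extOfCocycle : cocycles k B A M N 1 →ₗ[k] _) =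
    coboundaries k B A M N 0 :=
  (LinearMap.ker_eq_bot.2 extOfCocycle_injective).trans coboundaries_zero_eq_bot.symm

end

/-! ### Dimension shifting and the computation of `Ext` -/

section DimensionShift

variable {N I N' : Type u} [AddCommGroup N] [Module k N] [Module (B ⊗[k] Aᵐᵒᵖ) N]
  [IsScalarTower k (B ⊗[k] Aᵐᵒᵖ) N] [AddCommGroup I] [Module k I] [Module (B ⊗[k] Aᵐᵒᵖ) I]
  [IsScalarTower k (B ⊗[k] Aᵐᵒᵖ) I] [AddCommGroup N'] [Module k N'] [Module (B ⊗[k] Aᵐᵒᵖ) N']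
  [IsScalarTower k (B ⊗[k] Aᵐᵒᵖ) N']

/-- Dimension shifting along an exact sequence `0 → N → I → N' → 0` with `I` injective and
acyclic. -/
theorem exists_surjective_succ {i : N →ₗ[B ⊗[k] Aᵐᵒᵖ] I} {p : I →ₗ[B ⊗[k] Aᵐᵒᵖ] N'}
    (P : ModuleCat.{u} (B ⊗[k] Aᵐᵒᵖ)) (hi : Function.Injective i) (hp : Function.Surjective p) (hip : Function.Exact i p) (l : ℕ)
    [Module.Injective (B ⊗[k] Aᵐᵒᵖ) I]
    (hI : ∀ f : relCochain I (diag k B A M) (l + 2), relCoboundary (diag k B A M) (l + 2) f = 0 →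
      ∃ g, relCoboundary (diag k B A M) (l + 1) g = f)
    (Φ : cocycles k B A M N' (l + 1) →ₗ[k]
      Ext P (ModuleCat.of (B ⊗[k] Aᵐᵒᵖ) N') l)
    (hΦ : Function.Surjective Φ) (hker : LinearMap.ker Φ = coboundaries k B A M N' l)
    -- This comparison of images replaces naturality of `Φ`, so that the induction need not carry
    -- naturality along.
    (hrange : LinearMap.range (Φ ∘ₗ mapCocycles M p (l + 1)) =
      LinearMap.range (Ext.postcompOfLinear (Ext.mk₀ (ModuleCat.ofHom p)) k
        P (add_zero l))) :
    ∃ Ψ : cocycles k B A M N (l + 2) →ₗ[k]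
      Ext P (ModuleCat.of (B ⊗[k] Aᵐᵒᵖ) N) (l + 1),
      Function.Surjective Ψ ∧ LinearMap.ker Ψ = coboundaries k B A M N (l + 1) := by
  have hi' : Function.Injective (i.restrictScalars k) := hi
  have hp' : Function.Surjective (p.restrictScalars k) := hp
  have hip' : Function.Exact (i.restrictScalars k) (p.restrictScalars k) := hip
  have hpi : ∀ {n : ℕ} (f : relCochain N (diag k B A M) n),
      mapCochain M (p.restrictScalars k) n (mapCochain M (i.restrictScalars k) n f) = 0 := by
    intro n f
    apply Subtype.ext
    ext t
    exact hip.apply_apply_eq_zero _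
  have hinj : Injective (ModuleCat.of (B ⊗[k] Aᵐᵒᵖ) I) :=
    Module.injective_object_of_injective_module _ _
  let S := ModuleCat.shortComplexOfCompEqZero i p hip.linearMap_comp_eq_zero
  have hS : S.ShortExact := ModuleCat.shortComplex_shortExact S hip hi hp
  let dI := relCoboundary (X := I) (diag k B A M) (l + 1)
  -- The zigzags of the connecting homomorphism: pairs `(x, z)` with `δ x = i z`. The projection `α`
  -- to `z` and the map `β` to `p x` relate cocycles of `N` in degree `l + 2` to cocycles of `N'` in
  -- degree `l + 1`; the class of `z` is to be the connecting image of the class of `p x`.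
  let Γ : Submodule k (relCochain I (diag k B A M) (l + 1) × relCochain N (diag k B A M) (l + 2)) :=
    LinearMap.ker (dI ∘ₗ LinearMap.fst k _ _ -
      mapCochain M (i.restrictScalars k) (l + 2) ∘ₗ LinearMap.snd k _ _)
  have hΓ : ∀ x : Γ, dI x.1.1 = mapCochain M (i.restrictScalars k) (l + 2) x.1.2 := fun x =>
    sub_eq_zero.1 x.2
  let α : Γ →ₗ[k] cocycles k B A M N (l + 2) :=
    (LinearMap.snd k _ _ ∘ₗ Γ.subtype).codRestrict _ fun x => by
      rw [LinearMap.mem_ker]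
      apply mapCochain_injective hi'
      rw [map_zero, ← relCoboundary_mapCochain]
      change relCoboundary _ _ (mapCochain M (i.restrictScalars k) (l + 2) x.1.2) = 0
      rw [← hΓ]
      exact relCoboundary_relCoboundary _ _
  let β : Γ →ₗ[k] cocycles k B A M N' (l + 1) :=
    (mapCochain M (p.restrictScalars k) (l + 1) ∘ₗ LinearMap.fst k _ _ ∘ₗ Γ.subtype).codRestrict _
      fun x => by
        rw [LinearMap.mem_ker]
        change relCoboundary _ _ (mapCochain M (p.restrictScalars k) (l + 1) x.1.1) = 0
        rw [relCoboundary_mapCochain]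
        change mapCochain M _ _ (dI x.1.1) = 0
        rw [hΓ, hpi]
  let ψ : Γ →ₗ[k] Ext P (ModuleCat.of (B ⊗[k] Aᵐᵒᵖ) N) (l + 1) :=
    (Ext.postcompOfLinear hS.extClass k P rfl).comp (Φ.comp β)
  refine LinearMap.exists_surjective_of_factor (Γ := Γ)
    (Z := cocycles k B A M N (l + 2)) α ψ ?_ ?_ _ ?_
  · intro z
    obtain ⟨x, hx⟩ := hI (mapCochain M (i.restrictScalars k) (l + 2) z.1) (by
      rw [relCoboundary_mapCochain, show relCoboundary _ _ z.1 = 0 from z.2, map_zero])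
    exact ⟨⟨(x, z.1), sub_eq_zero.2 hx⟩, rfl⟩
  · intro e
    -- `Ext` of degree `l + 1` into the injective `I` vanishes, so the connecting map is surjective.
    obtain ⟨e', rfl⟩ := Ext.covariant_sequence_exact₁ P hS e
      (Ext.eq_zero_of_injective _) rfl
    obtain ⟨w, rfl⟩ := hΦ e'
    obtain ⟨x, hx⟩ := mapCochain_surjective (B := B) (A := A) (M := M) hp' (l + 1) w.1
    obtain ⟨z, hz⟩ := exists_mapCochain_eq hi' hip' (dI x) (by
      rw [← relCoboundary_mapCochain, hx]
      exact w.2)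
    exact ⟨⟨(x, z), sub_eq_zero.2 hz.symm⟩, congrArg
      (fun w => (Φ w).comp hS.extClass rfl) (Subtype.ext hx)⟩
  · intro γ
    have hrange' := SetLike.ext_iff.1 hrange
    constructor
    · intro h
      obtain ⟨e, he⟩ := Ext.covariant_sequence_exact₃ P hS _ rfl h
      obtain ⟨y, hy⟩ := (hrange' (Φ (β γ))).2 ⟨e, he⟩
      -- The class of `p x` comes from a cocycle `y` of `I`, and `Φ` detects coboundaries.
      have hd : β γ - mapCocycles M p (l + 1) y ∈ coboundaries k B A M N' l := by
        rw [← hker, LinearMap.mem_ker, map_sub, sub_eq_zero]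
        exact hy.symm
      obtain ⟨w', hw'⟩ := hd
      obtain ⟨w, rfl⟩ := mapCochain_surjective (B := B) (A := A) (M := M) hp' l w'
      rw [relCoboundary_mapCochain] at hw'
      -- Correcting `x` by the cocycle `y` and by the coboundary of a lift `w` makes it vanish in
      -- `N'` without changing `δ x`. The result is `i v`, and injectivity of `i` gives `δ v = z`.
      obtain ⟨v, hv⟩ := exists_mapCochain_eq hi' hip'
        (γ.1.1 - y.1 - relCoboundary (diag k B A M) l w) (by
          rw [map_sub, map_sub, hw']
          exact sub_self _)
      refine ⟨v, mapCochain_injective hi' _ ?_⟩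
      rw [← relCoboundary_mapCochain, hv, map_sub, map_sub, relCoboundary_relCoboundary,
        show relCoboundary _ _ y.1 = 0 from y.2, sub_zero, sub_zero]
      exact hΓ γ
    · rintro ⟨v, hv⟩
      -- If `z = δ v`, then `x - i v` is a cocycle of `I` over `p x`; hence the class of `p x` comes
      -- from `Ext` into `I` and is killed by the extension class.
      let y : cocycles k B A M I (l + 1) :=
        ⟨γ.1.1 - mapCochain M (i.restrictScalars k) (l + 1) v, by
          rw [LinearMap.mem_ker, map_sub, relCoboundary_mapCochain, hv, sub_eq_zero]
          exact hΓ γ⟩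
      have hy : mapCocycles M p (l + 1) y = β γ := by
        apply Subtype.ext
        change mapCochain M _ _ (γ.1.1 - mapCochain M (i.restrictScalars k) (l + 1) v) = _
        rw [map_sub, hpi, sub_zero]
        rfl
      obtain ⟨e, he⟩ := (hrange' (Φ (β γ))).1 ⟨y, congrArg Φ hy⟩
      change (Φ (β γ)).comp hS.extClass rfl = 0
      rw [← he]
      change (e.comp (Ext.mk₀ S.g) (add_zero l)).comp hS.extClass rfl = 0
      rw [Ext.comp_assoc_of_second_deg_zero, hS.comp_extClass, Ext.comp_zero]

end DimensionShift

attribute [local instance] TensorProduct.Algebra.module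

variable (k B A M) in
/-- Every bimodule embeds into an injective one that is acyclic for relative cochains. -/
theorem exists_embedding (N : Type u) [AddCommGroup N] [Module k N]
    [Module (B ⊗[k] Aᵐᵒᵖ) N] [IsScalarTower k (B ⊗[k] Aᵐᵒᵖ) N] :
    ∃ (I N' : Type u) (_ : AddCommGroup I) (_ : Module k I) (_ : Module (B ⊗[k] Aᵐᵒᵖ) I)
      (_ : IsScalarTower k (B ⊗[k] Aᵐᵒᵖ) I) (_ : AddCommGroup N') (_ : Module k N')
      (_ : Module (B ⊗[k] Aᵐᵒᵖ) N') (_ : IsScalarTower k (B ⊗[k] Aᵐᵒᵖ) N')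
      (i : N →ₗ[B ⊗[k] Aᵐᵒᵖ] I) (p : I →ₗ[B ⊗[k] Aᵐᵒᵖ] N'),
      Function.Injective i ∧ Function.Surjective p ∧ Function.Exact i p ∧
      Module.Injective (B ⊗[k] Aᵐᵒᵖ) I ∧
      ∀ l, ∀ f : relCochain I (diag k B A M) (l + 2), relCoboundary (diag k B A M) (l + 2) f = 0 →
        ∃ g, relCoboundary (diag k B A M) (l + 1) g = f :=
  ⟨Coinduced k (B ⊗[k] Aᵐᵒᵖ) N,
    Coinduced k (B ⊗[k] Aᵐᵒᵖ) N ⧸ LinearMap.range (Coinduced.unit k (B ⊗[k] Aᵐᵒᵖ) N),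
    inferInstance, inferInstance, inferInstance, inferInstance, inferInstance, inferInstance,
    inferInstance, inferInstance, Coinduced.unit k (B ⊗[k] Aᵐᵒᵖ) N,
    (LinearMap.range (Coinduced.unit k (B ⊗[k] Aᵐᵒᵖ) N)).mkQ, Coinduced.unit_injective,
    Submodule.mkQ_surjective _, LinearMap.exact_map_mkQ_range _, inferInstance,
    fun _ f hf => exists_relCoboundary_eq f hf⟩

/-- The cohomology of the complex of relative cochains is computed by `Ext`. -/
theorem exists_surjective_ext (l : ℕ) : ∀ (N : Type u) [AddCommGroup N] [Module k N]
    [Module (B ⊗[k] Aᵐᵒᵖ) N] [IsScalarTower k (B ⊗[k] Aᵐᵒᵖ) N],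
    ∃ Φ : cocycles k B A M N (l + 1) →ₗ[k]
      Ext (ModuleCat.of (B ⊗[k] Aᵐᵒᵖ) M) (ModuleCat.of (B ⊗[k] Aᵐᵒᵖ) N) l,
      Function.Surjective Φ ∧ LinearMap.ker Φ = coboundaries k B A M N l := by
  induction l with
  | zero =>
    intro N _ _ _ _
    exact ⟨extOfCocycle, extOfCocycle_surjective, ker_extOfCocycle⟩
  | succ l ih =>
    intro N _ _ _ _
    obtain ⟨I, N', _, _, _, _, _, _, _, _, i, p, hi, hp, hip, hinj, hI⟩ :=
      exists_embedding k B A M N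
    -- In the first shift neither image in question need be zero, and naturality of `extOfCocycle`
    -- compares them. In the later ones both are zero.
    cases l with
    | zero =>
      refine exists_surjective_succ _ hi hp hip 0 (hI 0) extOfCocycle extOfCocycle_surjective
        ker_extOfCocycle ?_
      ext e
      constructor
      · rintro ⟨f, rfl⟩
        exact ⟨extOfCocycle f, (mapCocycles_extOfCocycle p f).symm⟩
      · rintro ⟨e, rfl⟩
        obtain ⟨f, rfl⟩ := extOfCocycle_surjective e
        exact ⟨f, mapCocycles_extOfCocycle p f⟩
    | succ l =>
      obtain ⟨Φ, hΦ, hker⟩ := ih N'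
      have hinj : Injective (ModuleCat.of (B ⊗[k] Aᵐᵒᵖ) I) :=
        Module.injective_object_of_injective_module _ _
      refine exists_surjective_succ _ hi hp hip (l + 1) (hI (l + 1)) Φ hΦ hker ?_
      -- The cocycles of `I` have degree at least two here and are coboundaries, while `Ext` of
      -- positive degree into `I` vanishes.
      trans ⊥
      · rw [LinearMap.range_eq_bot]
        ext f
        obtain ⟨g, hg⟩ := hI l f.1 f.2
        rw [LinearMap.comp_apply, LinearMap.zero_apply, ← LinearMap.mem_ker, hker]
        exact ⟨mapCochain M (p.restrictScalars k) _ g,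
          (relCoboundary_mapCochain p g).trans (congrArg _ hg)⟩
      · rw [eq_comm, LinearMap.range_eq_bot]
        ext e
        rw [Ext.eq_zero_of_injective e, map_zero, map_zero]

end Ext

end TriangularTwo

/-! ### Decomposition of relative cochains by idempotents -/

namespace RelHochschild

section

variable {k : Type u} [Field k] {T : Type u} [Ring T] [Algebra k T]
  {X : Type u} [AddCommGroup X] [Module k X] [Module T X] [Module Tᵐᵒᵖ X]
  [SMulCommClass T Tᵐᵒᵖ X] [IsScalarTower k T X] [IsScalarTower k Tᵐᵒᵖ X] {R : Subalgebra k T}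

theorem smul_relCochain {l : ℕ} (f : relCochain X R (l + 1)) {r : T} (hr : r ∈ R)
    (t : Fin (l + 1) → T) : r • f.1 t = f.1 (Function.update t 0 (r * t 0)) := by
  have := f.2 r hr t 0
  rwa [gapLeft_zero, ← Fin.castSucc_zero, gapRight_castSucc] at this

theorem op_smul_relCochain {l : ℕ} (f : relCochain X R (l + 1)) {r : T} (hr : r ∈ R)
    (t : Fin (l + 1) → T) :
    MulOpposite.op r • f.1 t = f.1 (Function.update t (Fin.last l) (t (Fin.last l) * r)) := by
  have := f.2 r hr t (Fin.last _)
  rwa [gapRight_last, ← Fin.succ_last, gapLeft_succ, eq_comm] at this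

theorem relCochain_gap {l : ℕ} (f : relCochain X R (l + 2)) {r : T} (hr : r ∈ R)
    (t : Fin (l + 2) → T) (i : Fin (l + 1)) :
    f.1 (Function.update t i.castSucc (t i.castSucc * r)) =
      f.1 (Function.update t i.succ (r * t i.succ)) := by
  have := f.2 r hr t i.succ.castSucc
  rw [gapRight_castSucc, ← Fin.succ_castSucc, gapLeft_succ] at this
  exact this

/-- The corner `e_p f(t) e_q` of the value of a relative cochain vanishes if `f` vanishes on all
tuples `e_{v₀} t₁ e_{v₁} ⊗ ⋯ ⊗ e_{v_{l-1}} t_l e_{v_l}` with `v₀ = p` and `v_l = q`. -/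
theorem corner_relCochain_eq_zero {ι : Type*} [Fintype ι] [DecidableEq ι] {e : ι → T}
    (he : ∀ i, e i ∈ R) (horth : ∀ i j, i ≠ j → e i * e j = 0) (hidem : ∀ i, e i * e i = e i)
    (hsum : ∑ i, e i = 1) {l : ℕ} (f : relCochain X R l) (p q : ι) (t : Fin l → T)
    (h : ∀ v : Fin (l + 1) → ι, v 0 = p → v (Fin.last l) = q →
      f.1 (fun i => e (v i.castSucc) * t i * e (v i.succ)) = 0) :
    e p • MulOpposite.op (e q) • f.1 t = 0 := by
  cases l with
  | zero =>
    -- In degree zero the value commutes with `e_q`, so the corner is `e_p e_q` times the value: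
    -- zero for `p ≠ q`, and covered by the constant sequence for `p = q`.
    have hq := f.2 (e q) (he q) t 0
    rw [gapLeft_zero, show (0 : Fin 1) = Fin.last 0 from rfl, gapRight_last] at hq
    rw [← hq, ← mul_smul]
    by_cases hpq : p = q
    · subst hpq
      have := h (fun _ => p) rfl rfl
      rw [Subsingleton.elim t (fun i => e p * t i * e p), this, smul_zero]
    · rw [horth p q hpq, zero_smul]
  | succ l =>
    -- Each entry is cut into its blocks `e_u tᵢ e_v`. By multilinearity it suffices to treat one
    -- choice `r` of blocks.
    have ht : t = fun i => ∑ r : ι × ι, e r.1 * t i * e r.2 := by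
      funext i
      rw [Fintype.sum_prod_type]
      simp only [← Finset.mul_sum, ← Finset.sum_mul, hsum, mul_one, one_mul]
    rw [ht, MultilinearMap.map_sum, Finset.smul_sum, Finset.smul_sum]
    refine Finset.sum_eq_zero fun r _ => ?_
    set y : Fin (l + 1) → T := fun i => e (r i).1 * t i * e (r i).2 with hy
    by_cases h0 : p = (r 0).1
    swap
    · rw [smul_comm, smul_relCochain f (he p), hy, ← mul_assoc, ← mul_assoc, horth _ _ h0, zero_mul,
        zero_mul, MultilinearMap.map_update_zero, smul_zero]
    by_cases h1 : (r (Fin.last l)).2 = q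
    swap
    · rw [op_smul_relCochain f (he q), hy, mul_assoc, horth _ _ h1, mul_zero,
        MultilinearMap.map_update_zero, smul_zero]
    -- If adjacent blocks match, `r` comes from one sequence of vertices and the hypothesis applies.
    -- Otherwise an idempotent moved across the bad gap meets an orthogonal one.
    by_cases h2 : ∀ i : Fin l, (r i.castSucc).2 = (r i.succ).1
    · have := h (Fin.cons p (fun i => (r i).2)) (Fin.cons_zero _ _) (by
        rw [← Fin.succ_last, Fin.cons_succ, h1])
      have hv : ∀ i : Fin (l + 1),
          (Fin.cons p (fun i => (r i).2) : Fin (l + 2) → ι) i.castSucc = (r i).1 := by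
        intro i
        refine Fin.cases ?_ (fun i => ?_) i
        · exact h0
        · rw [← Fin.succ_castSucc, Fin.cons_succ, h2]
      simp only [hv, Fin.cons_succ] at this
      rw [this, smul_zero, smul_zero]
    · push Not at h2
      obtain ⟨i, hi⟩ := h2
      cases l with
      | zero => exact i.elim0
      | succ l =>
        have h3 : y i.castSucc = y i.castSucc * e (r i.castSucc).2 := by
          rw [hy, mul_assoc, hidem]
        rw [← Function.update_eq_self i.castSucc y, h3, relCochain_gap f (he _), hy, ← mul_assoc,
          ← mul_assoc, horth _ _ hi, zero_mul, zero_mul, MultilinearMap.map_update_zero, smul_zero,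
          smul_zero]

end

end RelHochschild

/-! ### Homology of a complex and the first page -/

/-- The space `V` computes the homology of `C₀ → C₁ → C₂`. -/
def ComputesHomology {k C₀ C₁ C₂ : Type*} [Field k] [AddCommGroup C₀] [Module k C₀]
    [AddCommGroup C₁] [Module k C₁] [AddCommGroup C₂] [Module k C₂] (d₀ : C₀ →ₗ[k] C₁)
    (d₁ : C₁ →ₗ[k] C₂) (V : Type*) [AddCommGroup V] [Module k V] : Prop :=
  ∃ Φ : LinearMap.ker d₁ →ₗ[k] V, Function.Surjective Φ ∧
    LinearMap.ker Φ = (LinearMap.range d₀).submoduleOf (LinearMap.ker d₁)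

theorem ComputesHomology.prod {k C₀ C₁ C₂ C₀' C₁' C₂' V V' : Type*} [Field k]
    [AddCommGroup C₀] [Module k C₀] [AddCommGroup C₁] [Module k C₁] [AddCommGroup C₂] [Module k C₂]
    [AddCommGroup C₀'] [Module k C₀'] [AddCommGroup C₁'] [Module k C₁'] [AddCommGroup C₂']
    [Module k C₂'] [AddCommGroup V] [Module k V] [AddCommGroup V'] [Module k V']
    {d₀ : C₀ →ₗ[k] C₁} {d₁ : C₁ →ₗ[k] C₂} {d₀' : C₀' →ₗ[k] C₁'} {d₁' : C₁' →ₗ[k] C₂'}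
    (h : ComputesHomology d₀ d₁ V) (h' : ComputesHomology d₀' d₁' V') :
    ComputesHomology (d₀.prodMap d₀') (d₁.prodMap d₁') (V × V') := by
  obtain ⟨Φ, hΦ, hker⟩ := h
  obtain ⟨Φ', hΦ', hker'⟩ := h'
  let π : LinearMap.ker (d₁.prodMap d₁') →ₗ[k] LinearMap.ker d₁ :=
    (LinearMap.fst k _ _ ∘ₗ Submodule.subtype _).codRestrict _ fun x => congrArg Prod.fst x.2
  let π' : LinearMap.ker (d₁.prodMap d₁') →ₗ[k] LinearMap.ker d₁' :=
    (LinearMap.snd k _ _ ∘ₗ Submodule.subtype _).codRestrict _ fun x => congrArg Prod.snd x.2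
  refine ⟨(Φ ∘ₗ π).prod (Φ' ∘ₗ π'), ?_, ?_⟩
  · rintro ⟨v, v'⟩
    obtain ⟨x, rfl⟩ := hΦ v
    obtain ⟨x', rfl⟩ := hΦ' v'
    exact ⟨⟨(x.1, x'.1), Prod.ext x.2 x'.2⟩, rfl⟩
  · ext x
    have h1 : Φ (π x) = 0 ↔ ∃ y, d₀ y = x.1.1 := SetLike.ext_iff.1 hker (π x)
    have h2 : Φ' (π' x) = 0 ↔ ∃ y, d₀' y = x.1.2 := SetLike.ext_iff.1 hker' (π' x)
    constructor
    · intro hx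
      obtain ⟨y, hy⟩ := h1.1 (congrArg Prod.fst hx)
      obtain ⟨y', hy'⟩ := h2.1 (congrArg Prod.snd hx)
      exact ⟨(y, y'), Prod.ext hy hy'⟩
    · rintro ⟨⟨y, y'⟩, hy⟩
      exact Prod.ext (h1.2 ⟨y, congrArg Prod.fst hy⟩) (h2.2 ⟨y', congrArg Prod.snd hy⟩)

/-- The first page of the spectral sequence of a filtered complex is the homology of the associated
graded complex. -/
theorem FilteredComplex.nonempty_page_one_equiv {k : Type u} [Field k] (K : FilteredComplex k)
    (p : ℤ) (n : ℕ) {C₀ C₁ C₂ V : Type*} [AddCommGroup C₀] [Module k C₀]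
    [AddCommGroup C₁] [Module k C₁] [AddCommGroup C₂] [Module k C₂] [AddCommGroup V] [Module k V]
    {d₀ : C₀ →ₗ[k] C₁} {d₁ : C₁ →ₗ[k] C₂} (h : ComputesHomology d₀ d₁ V)
    (g₀ : K.F p n →ₗ[k] C₀) (g₁ : K.F p (n + 1) →ₗ[k] C₁) (g₂ : K.F p (n + 2) →ₗ[k] C₂)
    -- In degree `n` only the image matters, since it provides the coboundaries; in degree `n + 2`
    -- only the kernel matters, since it tests for cocycles.
    (hg₀ : Function.Surjective g₀) (hg₁ : Function.Surjective g₁)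
    (hk₁ : ∀ x, g₁ x = 0 ↔ x.1 ∈ K.F (p + 1) (n + 1))
    (hk₂ : ∀ x, g₂ x = 0 ↔ x.1 ∈ K.F (p + 1) (n + 2))
    (hd₀ : ∀ x, g₁ ⟨K.d n x.1, K.d_mem p n x.1 x.2⟩ = d₀ (g₀ x))
    (hd₁ : ∀ x, g₂ ⟨K.d (n + 1) x.1, K.d_mem p (n + 1) x.1 x.2⟩ = d₁ (g₁ x)) :
    Nonempty (K.page 1 p (n + 1) ≃ₗ[k] V) := by
  obtain ⟨Φ, hΦ, hker⟩ := h
  let γ : K.Z 1 p (n + 1) →ₗ[k] LinearMap.ker d₁ :=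
    (g₁ ∘ₗ Submodule.inclusion (inf_le_left : K.Z 1 p (n + 1) ≤ K.F p (n + 1))).codRestrict _ fun x => by
      rw [LinearMap.mem_ker]
      exact (hd₁ ⟨x.1, x.2.1⟩).symm.trans ((hk₂ _).2 x.2.2)
  have hγ : ∀ x, (γ x).1 = g₁ ⟨x.1, x.2.1⟩ := fun _ => rfl
  have hsurj : Function.Surjective (Φ ∘ₗ γ) := by
    intro v
    obtain ⟨z, rfl⟩ := hΦ v
    obtain ⟨x, hx⟩ := hg₁ z.1
    refine ⟨⟨x.1, x.2, (hk₂ ⟨_, K.d_mem p (n + 1) x.1 x.2⟩).1 ?_⟩, congrArg Φ (Subtype.ext hx)⟩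
    rw [hd₁, hx]
    exact z.2
  refine ⟨(Submodule.quotEquivOfEq _ _ ?_).trans
    ((Φ ∘ₗ γ).quotKerEquivOfSurjective hsurj)⟩
  ext x
  have hx : Φ (γ x) = 0 ↔ ∃ y, d₀ y = g₁ ⟨x.1, x.2.1⟩ := SetLike.ext_iff.1 hker (γ x)
  rw [LinearMap.mem_ker, LinearMap.comp_apply, hx]
  -- For `r = 1` the shift `r - 1` is zero: the denominator of the page is `Fᵖ⁺¹` plus the
  -- coboundaries of `Fᵖ`, because `d` preserves the filtration.
  have e1 : K.F (p + 1 + (1 - 1)) (n + 1 + 1) = K.F (p + 1) (n + 2) := by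
    rw [sub_self, add_zero]
  have e2 : K.F (p - (1 - 1)) n = K.F p n := by
    rw [sub_self, sub_zero]
  constructor
  · intro hm
    obtain ⟨a, ha, b, hb, hab⟩ := Submodule.mem_sup.1 hm
    obtain ⟨y, hy, rfl⟩ := hb.2
    rw [e2] at hy
    refine ⟨g₀ ⟨y, hy⟩, ?_⟩
    have hxa : x.1 = a + K.d n y := hab.symm
    have haF : a ∈ K.F p (n + 1) := K.F_succ_le p (n + 1) ha.1
    have : (⟨x.1, x.2.1⟩ : K.F p (n + 1)) =
        ⟨a, haF⟩ + ⟨K.d n y, K.d_mem p n y hy⟩ := Subtype.ext hxa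
    rw [this, map_add, (hk₁ ⟨a, haF⟩).2 ha.1, zero_add, ← hd₀ ⟨y, hy⟩]
  · rintro ⟨c, hc⟩
    obtain ⟨y, rfl⟩ := hg₀ c
    rw [← hd₀, ← sub_eq_zero, ← map_sub, hk₁] at hc
    have hc' : K.d n y.1 - x.1 ∈ K.F (p + 1) (n + 1) := hc
    refine Submodule.mem_sup.2 ⟨x.1 - K.d n y.1, ⟨?_, ?_⟩, K.d n y.1,
      ⟨K.d_mem p n y.1 y.2, y.1, ?_, rfl⟩, sub_add_cancel _ _⟩
    · rw [← neg_sub]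
      exact Submodule.neg_mem _ hc'
    · rw [e1]
      change K.d (n + 1) (x.1 - K.d n y.1) ∈ K.F (p + 1) (n + 2)
      rw [map_sub, K.d_comp_d, sub_zero]
      exact x.2.2
    · rw [e2]
      exact y.2

/-! ### Trajectories of length at most one -/

namespace LinQuiver

theorem nonempty_path {n : ℕ} (i j : Fin n) (h : i ≤ j) :
    Nonempty (Quiver.Path (V := LinQuiver n) i j) := by
  obtain ⟨i, hi⟩ := i
  obtain ⟨j, hj⟩ := j
  replace h : i ≤ j := h
  induction j, h using Nat.le_induction with
  | base => exact ⟨Quiver.Path.nil⟩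
  | succ j h ih =>
    obtain ⟨γ⟩ := ih (by omega)
    exact ⟨γ.cons (PLift.up rfl)⟩

-- Two strict descents would need three different values.
open Classical in
theorem card_jumps_le_one {n l : ℕ} {v : Fin (l + 1) → Fin n} (hv : Antitone v) (j i : Fin n)
    (h : ∀ a, v a = j ∨ v a = i) :
    (Finset.univ.filter fun a : Fin l => v a.succ ≠ v a.castSucc).card ≤ 1 := by
  rw [Finset.card_le_one]
  simp only [Finset.mem_filter, Finset.mem_univ, true_and]
  have key : ∀ a b : Fin l, a < b → v a.succ ≠ v a.castSucc → v b.succ ≠ v b.castSucc → False := by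
    intro a b hab ha hb
    have h1 := lt_of_le_of_ne (hv a.castSucc_lt_succ.le) ha
    have h2 := lt_of_le_of_ne (hv b.castSucc_lt_succ.le) hb
    have h3 : v b.castSucc ≤ v a.succ := hv (Fin.succ_le_castSucc_iff.2 hab)
    rcases h a.castSucc with p | p <;> rcases h b.castSucc with q | q <;>
      rcases h b.succ with r | r <;> rw [p] at h1 <;> rw [q, r] at h2 <;> rw [q] at h3 <;>
      first
      | exact absurd h2 (lt_irrefl _)
      | exact absurd (h3.trans_lt h1) (lt_irrefl _)
      | exact absurd ((h3.trans_lt h1).trans h2) (lt_irrefl _)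
  intro a ha b hb
  rcases lt_trichotomy a b with hab | hab | hab
  · exact (key a b hab ha hb).elim
  · exact hab
  · exact (key b a hab hb ha).elim

/-- The vertices of a trajectory, as elements of `Fin n`. -/
def Trajectory.index {n l : ℕ} (τ : Trajectory n l) : Fin (l + 1) → Fin n := τ.vertex

theorem antitone_index {n l : ℕ} (τ : Trajectory n l) : Antitone τ.index := by
  refine Fin.antitone_iff_succ_le.2 fun a => ?_
  have h := length_path (τ.path a)
  exact Fin.le_def.2 (by simp only [Trajectory.index]; omega)

open Classical in
theorem Trajectory.length_eq_card_index {n l : ℕ} (τ : Trajectory n l) :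
    τ.length = (Finset.univ.filter fun a : Fin l => τ.index a.succ ≠ τ.index a.castSucc).card := by
  unfold Trajectory.length
  congr 1
  ext i
  simp only [Finset.mem_filter, Finset.mem_univ, true_and]
  exact length_path_ne_zero_iff _

theorem eq_of_no_jump {n l : ℕ} {v : Fin (l + 1) → Fin n} (a b : Fin (l + 1)) (hab : a ≤ b)
    (h : ∀ c : Fin l, a ≤ c.castSucc → c.succ ≤ b → v c.succ = v c.castSucc) : v a = v b := by
  induction b using Fin.induction with
  | zero => rw [Fin.le_zero_iff.1 hab]
  | succ b ih =>
    rcases hab.eq_or_lt with rfl | hab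
    · rfl
    · have hab' : a ≤ b.castSucc := Fin.lt_def.1 hab |> fun h => Fin.le_def.2 (by simpa using Nat.lt_succ_iff.1 h)
      rw [ih hab' fun c h1 h2 => h c h1 (h2.trans b.castSucc_lt_succ.le), h b hab' le_rfl]

theorem Trajectory.index_eq_of_length_eq_zero {n l : ℕ} (τ : Trajectory n l) (h : τ.length = 0)
    (a : Fin (l + 1)) : τ.index a = τ.index 0 := by
  classical
  rw [Trajectory.length_eq_card_index, Finset.card_eq_zero, Finset.filter_eq_empty_iff] at h
  exact (eq_of_no_jump (v := τ.index) 0 a (Fin.zero_le _) fun c _ _ =>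
    not_not.1 (h (Finset.mem_univ c))).symm

/-- The index is constant before and after the only jump. Thus a trajectory of length one involves
two vertices only, and its `M_τ` is visible in a triangular algebra of size two. -/
theorem Trajectory.index_of_length_eq_one {n l : ℕ} (τ : Trajectory n l) (h : τ.length = 1) :
    τ.index (Fin.last l) < τ.index 0 ∧
      ∀ a, τ.index a = τ.index 0 ∨ τ.index a = τ.index (Fin.last l) := by
  classical
  rw [Trajectory.length_eq_card_index, Finset.card_eq_one] at h
  obtain ⟨c, hc⟩ := h
  have hj : ∀ b : Fin l, τ.index b.succ ≠ τ.index b.castSucc ↔ b = c := fun b => by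
    have := Finset.ext_iff.1 hc b
    simpa using this
  have h0 : ∀ a, a ≤ c.castSucc → τ.index a = τ.index 0 := fun a ha =>
    (eq_of_no_jump (v := τ.index) 0 a (Fin.zero_le _) fun b _ hb => by
      by_contra hne
      rw [(hj b).1 hne] at hb
      exact absurd (hb.trans ha) (not_le.2 c.castSucc_lt_succ)).symm
  have h1 : ∀ a, c.succ ≤ a → τ.index a = τ.index (Fin.last l) := fun a ha =>
    eq_of_no_jump (v := τ.index) a (Fin.last l) (Fin.le_last _) fun b hb _ => by
      by_contra hne
      rw [(hj b).1 hne] at hb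
      exact absurd (ha.trans hb) (not_le.2 c.castSucc_lt_succ)
  have h2 := lt_of_le_of_ne (antitone_index τ c.castSucc_lt_succ.le) ((hj c).2 rfl)
  rw [h0 _ le_rfl, h1 _ le_rfl] at h2
  refine ⟨h2, fun a => ?_⟩
  rcases le_or_gt a c.castSucc with ha | ha
  · exact Or.inl (h0 a ha)
  · exact Or.inr (h1 a (Fin.castSucc_lt_iff_succ_le.1 ha))

end LinQuiver

/-! ### The trajectory filtration in terms of idempotents -/

namespace RelHochschild

section

variable {k : Type u} [Field k] {T : Type u} [Ring T] [Algebra k T]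
  {X : Type u} [AddCommGroup X] [Module k X] [Module T X] [Module Tᵐᵒᵖ X]
  [SMulCommClass T Tᵐᵒᵖ X] [IsScalarTower k T X] [IsScalarTower k Tᵐᵒᵖ X] {R : Subalgebra k T}

/-- A complete system of orthogonal idempotents of `T`, contained in `R`, for which `T` is lower
triangular. -/
structure IsTriangularSystem {n : ℕ} (R : Subalgebra k T) (e : Fin n → T) : Prop where
  mem : ∀ i, e i ∈ R
  orth : ∀ i j, i ≠ j → e i * e j = 0
  idem : ∀ i, e i * e i = e i
  sum : ∑ i, e i = 1
  upper : ∀ i j, i < j → ∀ t, e i * t * e j = 0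

variable {n : ℕ} {e : Fin n → T}

-- A non-increasing sequence of vertices is a trajectory of the given length, on which `φ` vanishes
-- by the filtration. A sequence with an ascent makes some entry zero by triangularity. So all
-- sequences of vertices may be treated alike.
open Classical in
theorem IsTriangularSystem.apply_eq_zero (H : IsTriangularSystem R e) {t : ℤ} {l : ℕ}
    {φ : relCochain X R l} (hφ : φ ∈ trajectoryFiltration X R (n := n) e t l)
    (v : Fin (l + 1) → Fin n)
    (hv : Antitone v →
      ((Finset.univ.filter fun a : Fin l => v a.succ ≠ v a.castSucc).card : ℤ) < t)
    (x : Fin l → T) : φ.1 (fun i => e (v i.castSucc) * x i * e (v i.succ)) = 0 := by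
  by_cases hanti : ∀ i : Fin l, v i.succ ≤ v i.castSucc
  · have hp := fun i => LinQuiver.nonempty_path _ _ (hanti i)
    refine hφ ⟨v, fun i => (hp i).some⟩ ?_ _ fun i => ?_
    · rw [LinQuiver.Trajectory.length_eq_card_index]
      exact hv (Fin.antitone_iff_succ_le.2 hanti)
    · change e _ * (e _ * x i * e _) * e _ = e _ * x i * e _
      rw [← mul_assoc, ← mul_assoc, H.idem, mul_assoc, H.idem]
  · push Not at hanti
    obtain ⟨i, hi⟩ := hanti
    exact MultilinearMap.map_coord_zero _ i (H.upper _ _ hi _)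

/-- Cochains in the first step of the filtration take values with zero diagonal corners. -/
theorem IsTriangularSystem.diagonal_corner_eq_zero (H : IsTriangularSystem R e) {l : ℕ}
    {φ : relCochain X R l} (hφ : φ ∈ trajectoryFiltration X R (n := n) e 1 l) (p : Fin n)
    (x : Fin l → T) : e p • MulOpposite.op (e p) • φ.1 x = 0 := by
  classical
  refine corner_relCochain_eq_zero H.mem H.orth H.idem H.sum φ p p x fun v h0 hl => ?_
  refine H.apply_eq_zero hφ v (fun hv => ?_) x
  -- A monotone sequence with equal ends is constant, so it has length zero.
  have hc : ∀ a, v a = p := fun a =>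
    le_antisymm (h0 ▸ hv (Fin.zero_le a)) (hl ▸ hv (Fin.le_last a))
  simp [hc]

theorem trajectoryFiltration_one_zero_eq_zero {φ : relCochain X R 0}
    (hφ : φ ∈ trajectoryFiltration X R (n := n) e 1 0) (i : Fin n) : φ = 0 := by
  apply Subtype.ext
  ext t
  exact hφ ⟨fun _ => i, fun a => a.elim0⟩ (by simp [LinQuiver.Trajectory.length]) t
    fun a => a.elim0

end

end RelHochschild

/-! ### Corners as coefficient bimodules -/

namespace Corner

variable {k : Type u} [Field k] {B A T : Type u} [Ring B] [Ring A] [Ring T]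
  [Algebra k B] [Algebra k A] [Algebra k T] {f : B →ₙₐ[k] T} {g : A →ₙₐ[k] T}
  {X : Type u} [AddCommGroup X] [Module k X] [Module T X] [Module Tᵐᵒᵖ X]
  [SMulCommClass T Tᵐᵒᵖ X] [IsScalarTower k T X] [IsScalarTower k Tᵐᵒᵖ X]

attribute [local instance] TensorProduct.Algebra.module

instance : IsScalarTower k (B ⊗[k] Aᵐᵒᵖ) (Corner f g X) where
  smul_assoc c x z := by
    induction x with
    | zero => simp
    | add x y hx hy => rw [smul_add, add_smul, hx, hy, add_smul, smul_add]
    | tmul b a =>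
      rw [TensorProduct.smul_tmul', TensorProduct.Algebra.smul_def, TensorProduct.Algebra.smul_def,
        smul_assoc]

theorem triangular_smul_val {M : Type u} [AddCommGroup M] [Module k M] [Module B M]
    [Module Aᵐᵒᵖ M] [SMulCommClass B Aᵐᵒᵖ M] [IsScalarTower k B M] [IsScalarTower k Aᵐᵒᵖ M]
    (s : TriangularTwo k B A M) (z : Corner f g X) : (s • z).1 = f s.b • z.1 := by
  rw [TriangularTwo.smul_eq, TensorProduct.Algebra.smul_def, one_smul, smul_def]

theorem triangular_op_smul_val {M : Type u} [AddCommGroup M] [Module k M] [Module B M]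
    [Module Aᵐᵒᵖ M] [SMulCommClass B Aᵐᵒᵖ M] [IsScalarTower k B M] [IsScalarTower k Aᵐᵒᵖ M]
    (s : TriangularTwo k B A M) (z : Corner f g X) :
    (MulOpposite.op s • z).1 = MulOpposite.op (g s.a) • z.1 := by
  rw [TriangularTwo.op_smul_eq, TensorProduct.Algebra.smul_def, one_smul, op_smul_def,
    MulOpposite.unop_op]

variable (f g X) in
/-- The projection `x ↦ f(1) x g(1)` to the corner. -/
def proj : X →ₗ[k] Corner f g X where
  toFun x := ⟨f 1 • MulOpposite.op (g 1) • x, x, rfl⟩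
  map_add' x y := ext' (by
    change f 1 • MulOpposite.op (g 1) • (x + y) =
      f 1 • MulOpposite.op (g 1) • x + f 1 • MulOpposite.op (g 1) • y
    rw [smul_add, smul_add])
  map_smul' c x := ext' (by
    change f 1 • MulOpposite.op (g 1) • c • x = c • f 1 • MulOpposite.op (g 1) • x
    rw [smul_comm _ c x, smul_comm _ c])

theorem proj_val (x : X) : (proj f g X x).1 = f 1 • MulOpposite.op (g 1) • x := rfl

theorem proj_coe (z : Corner f g X) : proj f g X z.1 = z :=
  ext' (by rw [proj_val, right_one, left_one])

variable (f g X) in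
/-- The inclusion of the corner. -/
def incl : Corner f g X →ₗ[k] X where
  toFun z := z.1
  map_add' _ _ := rfl
  map_smul' _ _ := rfl

end Corner

/-! ### Restriction of cochains to an entry below the diagonal, and extension by zero -/

namespace RelHochschild

/-- An off-diagonal entry of a triangular algebra `T`: the algebras `B` and `A` at the diagonal
positions `j > i`, and the bimodule `M` between them. -/
structure OffDiagonalEntry {k : Type u} [Field k] {T : Type u} [Ring T] [Algebra k T]
    (R : Subalgebra k T) {n : ℕ} (e : Fin n → T) {B A : Type u} [Ring B] [Ring A]
    [Algebra k B] [Algebra k A] (f : B →ₙₐ[k] T) (g : A →ₙₐ[k] T)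
    (M : Type u) [AddCommGroup M] [Module k M] [Module B M] [Module Aᵐᵒᵖ M]
    [SMulCommClass B Aᵐᵒᵖ M] [IsScalarTower k B M] [IsScalarTower k Aᵐᵒᵖ M] (j i : Fin n) where
  lt : i < j
  f_one : f 1 = e j
  g_one : g 1 = e i
  h : M →ₗ[k] T
  f_mul_h : ∀ b m, f b * h m = h (b • m)
  h_mul_g : ∀ m a, h m * g a = h (MulOpposite.op a • m)
  ρ : T →ₗ[k] TriangularTwo k B A M
  ρ_add : ∀ s : TriangularTwo k B A M, ρ (f s.b + h s.m + g s.a) = s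
  -- The projection `ρ` forgets all blocks that involve a third vertex, so it can be undone only on
  -- blocks between `j` and `i`.
  add_ρ : ∀ u v x, u = j ∨ u = i → v = j ∨ v = i → e u * x * e v = x →
    f (ρ x).b + h (ρ x).m + g (ρ x).a = x
  ρ_mem : ∀ r ∈ R, ρ r ∈ TriangularTwo.diag k B A M
  -- Multiplicativity is demanded only against `R`: for `₃M₁` a product may pass through the middle
  -- vertex by `μ`, which `ρ` does not see.
  ρ_mul : ∀ r ∈ R, ∀ t, ρ (r * t) = ρ r * ρ t
  ρ_mul' : ∀ r ∈ R, ∀ t, ρ (t * r) = ρ t * ρ r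
  mul_f_one : ∀ r ∈ R, r * f 1 = f (ρ r).b
  g_one_mul : ∀ r ∈ R, g 1 * r = g (ρ r).a
  -- No vertex equals both `j` and `i`. This makes extensions by zero vanish on trajectories of
  -- length zero.
  ρ_e : ∀ v, TriangularTwo.inB k B A M 1 * ρ (e v) = 0 ∨ ρ (e v) * TriangularTwo.inA k B A M 1 = 0

namespace OffDiagonalEntry

open TriangularTwo

variable {k : Type u} [Field k] {T : Type u} [Ring T] [Algebra k T]
  {R : Subalgebra k T} {n : ℕ} {e : Fin n → T} {B A : Type u} [Ring B] [Ring A]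
  [Algebra k B] [Algebra k A] {f : B →ₙₐ[k] T} {g : A →ₙₐ[k] T}
  {M : Type u} [AddCommGroup M] [Module k M] [Module B M] [Module Aᵐᵒᵖ M]
  [SMulCommClass B Aᵐᵒᵖ M] [IsScalarTower k B M] [IsScalarTower k Aᵐᵒᵖ M] {j i : Fin n}
  {X : Type u} [AddCommGroup X] [Module k X] [Module T X] [Module Tᵐᵒᵖ X]
  [SMulCommClass T Tᵐᵒᵖ X] [IsScalarTower k T X] [IsScalarTower k Tᵐᵒᵖ X]

attribute [local instance] TensorProduct.Algebra.module

/-- The embedding of the triangular algebra of size two. -/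
def σ (P : OffDiagonalEntry R e f g M j i) : TriangularTwo k B A M →ₗ[k] T where
  toFun s := f s.b + P.h s.m + g s.a
  map_add' s t := by simp only [add_b, add_m, add_a, map_add]; abel
  map_smul' c s := by simp only [smul_b, smul_m, smul_a, map_smul, smul_add, RingHom.id_apply]

theorem σ_apply (P : OffDiagonalEntry R e f g M j i) (s : TriangularTwo k B A M) : P.σ s = f s.b + P.h s.m + g s.a := rfl

theorem f_mul_g (P : OffDiagonalEntry R e f g M j i) (H : IsTriangularSystem R e)
    (b : B) (a : A) : f b * g a = 0 := by
  rw [← mul_one b, map_mul, ← one_mul a, map_mul, mul_assoc, ← mul_assoc (f 1), P.f_one, P.g_one,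
    H.orth _ _ P.lt.ne', zero_mul, mul_zero]

theorem g_mul_f (P : OffDiagonalEntry R e f g M j i) (H : IsTriangularSystem R e)
    (b : B) (a : A) : g a * f b = 0 := by
  rw [← mul_one a, map_mul, ← one_mul b, map_mul, mul_assoc, ← mul_assoc (g 1), P.f_one, P.g_one,
    H.orth _ _ P.lt.ne, zero_mul, mul_zero]

theorem f_one_mul_h (P : OffDiagonalEntry R e f g M j i) (m : M) : f 1 * P.h m = P.h m := by rw [P.f_mul_h, one_smul]

theorem h_mul_g_one (P : OffDiagonalEntry R e f g M j i) (m : M) : P.h m * g 1 = P.h m := by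
  rw [P.h_mul_g, MulOpposite.op_one, one_smul]

theorem h_mul_f (P : OffDiagonalEntry R e f g M j i) (H : IsTriangularSystem R e)
    (m : M) (b : B) : P.h m * f b = 0 := by
  rw [← P.h_mul_g_one, mul_assoc, P.g_mul_f H, mul_zero]

theorem g_mul_h (P : OffDiagonalEntry R e f g M j i) (H : IsTriangularSystem R e)
    (m : M) (a : A) : g a * P.h m = 0 := by
  rw [← P.f_one_mul_h, ← mul_assoc, P.g_mul_f H, zero_mul]

theorem h_mul_h (P : OffDiagonalEntry R e f g M j i) (H : IsTriangularSystem R e)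
    (m m' : M) : P.h m * P.h m' = 0 := by
  rw [← P.f_one_mul_h m', ← mul_assoc, P.h_mul_f H, zero_mul]

/-- By orthogonality of `e_j` and `e_i` only the products of types `BB`, `BM`, `MA` and `AA`
survive. Elements in the image of `σ` never multiply through a third vertex, so `μ` does not
interfere. -/
theorem σ_mul (P : OffDiagonalEntry R e f g M j i) (H : IsTriangularSystem R e)
    (s t : TriangularTwo k B A M) : P.σ (s * t) = P.σ s * P.σ t := by
  simp only [σ_apply, mul_add, add_mul, P.f_mul_g H, P.g_mul_f H, P.h_mul_f H, P.g_mul_h H,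
    P.h_mul_h H, P.f_mul_h, P.h_mul_g, mul_b, mul_m, mul_a, map_add, map_mul]
  abel

theorem σ_mem (P : OffDiagonalEntry R e f g M j i) (H : IsTriangularSystem R e)
    {r : TriangularTwo k B A M} (hr : r ∈ diag k B A M) : P.σ r ∈ R := by
  obtain ⟨β, α, rfl⟩ := hr
  rw [σ_apply, map_zero, add_zero, Algebra.algebraMap_eq_smul_one, Algebra.algebraMap_eq_smul_one,
    map_smul, map_smul, P.f_one, P.g_one]
  exact R.add_mem (R.smul_mem (H.mem j) β) (R.smul_mem (H.mem i) α)

theorem f_one_mul_σ (P : OffDiagonalEntry R e f g M j i) (H : IsTriangularSystem R e)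
    (s : TriangularTwo k B A M) : f 1 * P.σ s = f s.b + P.h s.m := by
  rw [σ_apply, mul_add, mul_add, P.f_mul_g H, P.f_one_mul_h, ← map_mul, one_mul, add_zero]

theorem σ_mul_g_one (P : OffDiagonalEntry R e f g M j i) (H : IsTriangularSystem R e)
    (s : TriangularTwo k B A M) : P.σ s * g 1 = P.h s.m + g s.a := by
  rw [σ_apply, add_mul, add_mul, P.f_mul_g H, P.h_mul_g_one, ← map_mul, mul_one, zero_add]

theorem e_mul_σ (P : OffDiagonalEntry R e f g M j i) (H : IsTriangularSystem R e)
    {u : Fin n} (hj : u ≠ j) (hi : u ≠ i) (s : TriangularTwo k B A M) :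
    e u * P.σ s = 0 := by
  have hf : ∀ b, e u * f b = 0 := fun b => by
    rw [← one_mul b, map_mul, P.f_one, ← mul_assoc, H.orth _ _ hj, zero_mul]
  have hg : ∀ a, e u * g a = 0 := fun a => by
    rw [← one_mul a, map_mul, P.g_one, ← mul_assoc, H.orth _ _ hi, zero_mul]
  rw [σ_apply, mul_add, mul_add, hf, hg, ← P.f_one_mul_h, ← mul_assoc, hf, zero_mul, add_zero,
    add_zero]

/-- The restriction of a cochain to an entry. -/
def restrictEntry (P : OffDiagonalEntry R e f g M j i) (H : IsTriangularSystem R e) (l : ℕ) :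
    relCochain X R l →ₗ[k] relCochain (Corner f g X) (diag k B A M) l where
  toFun φ := ⟨((Corner.proj f g X).compMultilinearMap φ.1).compLinearMap fun _ => P.σ, by
    intro r hr s a
    have hup : ∀ b x, (fun c => P.σ (Function.update s b x c)) =
        Function.update (fun c => P.σ (s c)) b (P.σ x) := fun b x => by
      funext c
      rw [Function.apply_update fun _ => P.σ]
    have hL : gapLeft (((Corner.proj f g X).compMultilinearMap φ.1).compLinearMap fun _ => P.σ)
        r s a = Corner.proj f g X (gapLeft φ.1 (P.σ r) (fun c => P.σ (s c)) a) := by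
      refine Fin.cases ?_ (fun b => ?_) a
      · apply Corner.ext'
        rw [gapLeft_zero, gapLeft_zero, Corner.triangular_smul_val, Corner.proj_val,
          ← smul_comm (P.σ r), ← mul_smul, P.f_one_mul_σ H]
        -- A diagonal `r` has no component in `M`, so `σ r` acts on the corner through `f` alone,
        -- just as `r` does.
        obtain ⟨β, α, rfl⟩ := hr
        change f (algebraMap k B β) • (f 1 • MulOpposite.op (g 1) • φ.1 _) = _
        rw [map_zero, add_zero, ← mul_smul, ← map_mul, mul_one]
      · rw [gapLeft_succ, gapLeft_succ, ← P.σ_mul H, ← hup]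
        rfl
    have hR : gapRight (((Corner.proj f g X).compMultilinearMap φ.1).compLinearMap fun _ => P.σ)
        r s a = Corner.proj f g X (gapRight φ.1 (P.σ r) (fun c => P.σ (s c)) a) := by
      refine Fin.lastCases ?_ (fun b => ?_) a
      · apply Corner.ext'
        rw [gapRight_last, gapRight_last, Corner.triangular_op_smul_val, Corner.proj_val,
          ← mul_smul (MulOpposite.op (g 1)), ← MulOpposite.op_mul, P.σ_mul_g_one H]
        obtain ⟨β, α, rfl⟩ := hr
        change MulOpposite.op (g (algebraMap k A α)) • (f 1 • MulOpposite.op (g 1) • φ.1 _) = _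
        rw [map_zero, zero_add, ← smul_comm (f 1), ← mul_smul (MulOpposite.op _),
          ← MulOpposite.op_mul, ← map_mul, one_mul]
      · rw [gapRight_castSucc, gapRight_castSucc, ← P.σ_mul H, ← hup]
        rfl
    rw [hL, hR, φ.2 _ (P.σ_mem H hr)]⟩
  map_add' φ ψ := by
    apply Subtype.ext
    ext s
    exact map_add (Corner.proj f g X) _ _
  map_smul' c φ := by
    apply Subtype.ext
    ext s
    exact map_smul (Corner.proj f g X) c _

theorem restrictEntry_apply (P : OffDiagonalEntry R e f g M j i) (H : IsTriangularSystem R e)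
    {l : ℕ} (φ : relCochain X R l) (s : Fin l → TriangularTwo k B A M) :
    (P.restrictEntry H l φ).1 s = Corner.proj f g X (φ.1 fun c => P.σ (s c)) := rfl

/-- On the first step of the filtration, the restriction to an entry commutes with the
coboundary. -/
theorem restrictEntry_relCoboundary (P : OffDiagonalEntry R e f g M j i)
    (H : IsTriangularSystem R e) {l : ℕ} {φ : relCochain X R l}
    (hφ : φ ∈ trajectoryFiltration X R (n := n) e 1 l) :
    P.restrictEntry H (l + 1) (relCoboundary R l φ) =
      relCoboundary (diag k B A M) l (P.restrictEntry H l φ) := by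
  -- In the outer faces, `σ` of an entry acts also through its component in `M`, which acts by zero
  -- on the corner bimodule. The extra term contains `e_i φ e_i` on the left and `e_j φ e_j` on the
  -- right, and these diagonal corners vanish on `F¹`.
  have hdiag : ∀ p x, e p • MulOpposite.op (e p) • φ.1 x = 0 := fun p x =>
    H.diagonal_corner_eq_zero hφ p x
  apply Subtype.ext
  ext s
  rw [restrictEntry_apply]
  change Corner.proj f g X (coboundary k T X l φ.1 _) = coboundary k _ _ l _ s
  rw [coboundary_apply, coboundary_apply, map_add, map_add, map_sum]
  congr 1
  · congr 1
    · apply Corner.ext'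
      change f 1 • MulOpposite.op (g 1) • P.σ (s 0) • φ.1 _ =
        (s 0 • (P.restrictEntry H l φ).1 (Fin.tail s)).1
      rw [Corner.triangular_smul_val, restrictEntry_apply, Corner.proj_val,
        ← smul_comm (P.σ (s 0)), ← mul_smul, P.f_one_mul_σ H, add_smul,
        ← P.h_mul_g_one, mul_smul (P.h _), P.g_one, hdiag, smul_zero, add_zero, ← mul_smul,
        ← map_mul, mul_one]
      rfl
    · refine Finset.sum_congr rfl fun a _ => ?_
      rw [map_smul]
      congr 1
      change _ = Corner.proj f g X (φ.1 fun c => P.σ (mergeAt a s c))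
      congr 2
      funext c
      simp only [mergeAt]
      split_ifs
      · rfl
      · rw [P.σ_mul H]
      · rfl
  · rw [map_smul]
    congr 1
    apply Corner.ext'
    change f 1 • MulOpposite.op (g 1) • MulOpposite.op (P.σ (s (Fin.last l))) • φ.1 _ =
        (MulOpposite.op (s (Fin.last l)) • (P.restrictEntry H l φ).1 (Fin.init s)).1
    rw [Corner.triangular_op_smul_val, restrictEntry_apply, Corner.proj_val,
      ← mul_smul (MulOpposite.op (g 1)), ← MulOpposite.op_mul, P.σ_mul_g_one H,
      ← P.f_one_mul_h, MulOpposite.op_add, add_smul, smul_add, MulOpposite.op_mul, mul_smul,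
      smul_comm (f 1), P.f_one, hdiag, smul_zero, zero_add, ← P.f_one,
      ← smul_comm (f 1), ← mul_smul (MulOpposite.op (g _)), ← MulOpposite.op_mul,
      ← map_mul, one_mul]
    rfl

/-- The extension by zero of a cochain from an entry. -/
def extendEntry (P : OffDiagonalEntry R e f g M j i) (l : ℕ) :
    relCochain (Corner f g X) (diag k B A M) l →ₗ[k] relCochain X R l where
  toFun c := ⟨((Corner.incl f g X).compMultilinearMap c.1).compLinearMap fun _ => P.ρ, by
    intro r hr t a
    have hup : ∀ b x, (fun c => P.ρ (Function.update t b x c)) =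
        Function.update (fun c => P.ρ (t c)) b (P.ρ x) := fun b x => by
      funext c
      rw [Function.apply_update fun _ => P.ρ]
    have hL : gapLeft (((Corner.incl f g X).compMultilinearMap c.1).compLinearMap fun _ => P.ρ)
        r t a = Corner.incl f g X (gapLeft c.1 (P.ρ r) (fun c => P.ρ (t c)) a) := by
      refine Fin.cases ?_ (fun b => ?_) a
      · rw [gapLeft_zero, gapLeft_zero]
        change r • (c.1 fun c => P.ρ (t c)).1 = (P.ρ r • c.1 _).1
        rw [Corner.triangular_smul_val, ← P.mul_f_one r hr, mul_smul, Corner.left_one]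
      · rw [gapLeft_succ, gapLeft_succ, ← P.ρ_mul' r hr, ← hup]
        rfl
    have hR : gapRight (((Corner.incl f g X).compMultilinearMap c.1).compLinearMap fun _ => P.ρ)
        r t a = Corner.incl f g X (gapRight c.1 (P.ρ r) (fun c => P.ρ (t c)) a) := by
      refine Fin.lastCases ?_ (fun b => ?_) a
      · rw [gapRight_last, gapRight_last]
        change MulOpposite.op r • (c.1 fun c => P.ρ (t c)).1 = (MulOpposite.op (P.ρ r) • c.1 _).1
        rw [Corner.triangular_op_smul_val, ← P.g_one_mul r hr, MulOpposite.op_mul, mul_smul,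
          Corner.right_one]
      · rw [gapRight_castSucc, gapRight_castSucc, ← P.ρ_mul r hr, ← hup]
        rfl
    rw [hL, hR, c.2 _ (P.ρ_mem r hr)]⟩
  map_add' φ ψ := by
    apply Subtype.ext
    ext s
    exact map_add (Corner.incl f g X) _ _
  map_smul' c φ := by
    apply Subtype.ext
    ext s
    exact map_smul (Corner.incl f g X) c _

theorem extendEntry_apply (P : OffDiagonalEntry R e f g M j i) {l : ℕ}
    (c : relCochain (Corner f g X) (diag k B A M) l) (t : Fin l → T) :
    (P.extendEntry l c).1 t = (c.1 fun a => P.ρ (t a)).1 := rfl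

/-- On a trajectory of length zero all entries lie in one `e_v T e_v`. Since `ρ (e_v)` misses `B` or
`A`, either the first or the last entry makes the relative cochain vanish; in degree zero there are
no nonzero cochains from the entry. -/
theorem extendEntry_mem (P : OffDiagonalEntry R e f g M j i) (H : IsTriangularSystem R e) {l : ℕ}
    (c : relCochain (Corner f g X) (diag k B A M) l) :
    P.extendEntry l c ∈ trajectoryFiltration X R (n := n) e 1 l := by
  intro τ hτ x hx
  rw [extendEntry_apply]
  cases l with
  | zero =>
    rw [relCochain_zero_eq_zero c]
    rfl
  | succ l =>
    have hv := τ.index_eq_of_length_eq_zero (by omega)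
    have hx' : ∀ a, e (τ.index 0) * x a * e (τ.index 0) = x a := fun a => by
      have h : e (τ.index a.castSucc) * x a * e (τ.index a.succ) = x a := hx a
      rwa [hv a.castSucc, hv a.succ] at h
    rcases P.ρ_e (τ.index 0) with h0 | h0
    · rw [apply_eq_zero_of_first c]
      · rfl
      · rw [← hx' 0, mul_assoc, P.ρ_mul _ (H.mem _), ← mul_assoc, h0, zero_mul]
    · rw [apply_eq_zero_of_last c]
      · rfl
      · rw [← hx' (Fin.last l), P.ρ_mul' _ (H.mem _), mul_assoc, h0, mul_zero]

theorem restrictEntry_extendEntry (P : OffDiagonalEntry R e f g M j i)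
    (H : IsTriangularSystem R e) {l : ℕ} (c : relCochain (Corner f g X) (diag k B A M) l) :
    P.restrictEntry H l (P.extendEntry l c) = c := by
  apply Subtype.ext
  ext s
  rw [restrictEntry_apply, extendEntry_apply, Corner.proj_coe]
  congr 1
  funext a
  exact P.ρ_add (s a)

/-- The extension takes values in another corner of `X`, which the projection to `e_j X e_i` kills.
-/
theorem restrictEntry_extendEntry_of_ne (P : OffDiagonalEntry R e f g M j i)
    (H : IsTriangularSystem R e) {B' A' M' : Type u} [Ring B'] [Ring A'] [Algebra k B']
    [Algebra k A'] {f' : B' →ₙₐ[k] T} {g' : A' →ₙₐ[k] T} [AddCommGroup M'] [Module k M']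
    [Module B' M'] [Module A'ᵐᵒᵖ M'] [SMulCommClass B' A'ᵐᵒᵖ M'] [IsScalarTower k B' M']
    [IsScalarTower k A'ᵐᵒᵖ M'] {j' i' : Fin n} (P' : OffDiagonalEntry R e f' g' M' j' i')
    (hne : j ≠ j' ∨ i ≠ i') {l : ℕ} (c : relCochain (Corner f' g' X) (diag k B' A' M') l) :
    P.restrictEntry H l (P'.extendEntry l c) = 0 := by
  apply Subtype.ext
  ext s
  apply Corner.ext'
  rw [restrictEntry_apply, extendEntry_apply, Corner.proj_val]
  generalize c.1 _ = z
  change _ = (0 : X)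
  rcases hne with h | h
  · rw [smul_comm, ← Corner.left_one z, ← mul_smul (f 1), P.f_one, P'.f_one, H.orth _ _ h,
      zero_smul, smul_zero]
  · rw [← Corner.right_one z, ← mul_smul (MulOpposite.op _), ← MulOpposite.op_mul, P.g_one,
      P'.g_one, H.orth _ _ h.symm, MulOpposite.op_zero, zero_smul, smul_zero]

/-- Restriction to an entry kills the second step of the filtration. -/
theorem restrictEntry_eq_zero (P : OffDiagonalEntry R e f g M j i) (H : IsTriangularSystem R e)
    {l : ℕ} {φ : relCochain X R l} (hφ : φ ∈ trajectoryFiltration X R (n := n) e 2 l) :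
    P.restrictEntry H l φ = 0 := by
  classical
  apply Subtype.ext
  ext s
  apply Corner.ext'
  rw [restrictEntry_apply, Corner.proj_val, P.f_one, P.g_one]
  refine corner_relCochain_eq_zero H.mem H.orth H.idem H.sum φ j i _ fun v h0 hl => ?_
  -- A descending sequence within `{j, i}` jumps at most once, so `F²` kills it. A sequence through
  -- another vertex `u` gives zero because `e_u` annihilates the image of `σ`.
  by_cases hv : ∀ a, v a = j ∨ v a = i
  · refine H.apply_eq_zero hφ v (fun ha => ?_) _
    have := LinQuiver.card_jumps_le_one ha j i hv
    have h2 : ∀ m : ℕ, m ≤ 1 → (m : ℤ) < 2 := by omega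
    exact h2 _ (by convert this)
  · push Not at hv
    obtain ⟨a, ha⟩ := hv
    obtain rfl | ⟨b, rfl⟩ := a.eq_castSucc_or_eq_last.symm
    · exact absurd hl ha.2
    · exact MultilinearMap.map_coord_zero _ b (by rw [P.e_mul_σ H ha.1 ha.2, zero_mul])

/-- A cochain with zero restriction to an entry vanishes on the tuples of elements of the triangular
algebra of size two of this entry, that begin and end in the corresponding rows and columns. -/
theorem apply_eq_zero_of_restrictEntry_eq_zero (P : OffDiagonalEntry R e f g M j i)
    (H : IsTriangularSystem R e) {l : ℕ} {φ : relCochain X R (l + 1)}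
    (hφ : P.restrictEntry H (l + 1) φ = 0) (v : Fin (l + 2) → Fin n) (h0 : v 0 = j)
    (hl : v (Fin.last _) = i) (hv : ∀ a, v a = j ∨ v a = i) (x : Fin (l + 1) → T)
    (hx : ∀ a, e (v a.castSucc) * x a * e (v a.succ) = x a) : φ.1 x = 0 := by
  have h1 : (P.restrictEntry H (l + 1) φ).1 (fun a => P.ρ (x a)) = 0 := by rw [hφ]; rfl
  have h2 := congrArg Subtype.val h1
  rw [restrictEntry_apply, Corner.proj_val, P.f_one, P.g_one] at h2
  -- All blocks lie between `j` and `i`, so `ρ` loses nothing. As the tuple begins at `j` and ends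
  -- at `i`, the projection of the value to the corner loses nothing either.
  have h3 : (fun a => P.σ (P.ρ (x a))) = x := funext fun a =>
    P.add_ρ _ _ _ (hv _) (hv _) (hx a)
  have h4 : x (Fin.last l) * e i = x (Fin.last l) := by
    rw [← hx (Fin.last l), Fin.succ_last, hl, mul_assoc, H.idem]
  have h5 : e j * x 0 = x 0 := by
    rw [← hx 0, Fin.castSucc_zero, h0, ← mul_assoc, ← mul_assoc, H.idem]
  rw [h3, op_smul_relCochain φ (H.mem i), h4, Function.update_eq_self,
    smul_relCochain φ (H.mem j), h5, Function.update_eq_self] at h2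
  exact h2

end OffDiagonalEntry

end RelHochschild

/-! ### The three entries below the diagonal -/

namespace Triangular

open RelHochschild

variable {k : Type u} [Field k]
    {A₁ A₂ A₃ : Type u} [Ring A₁] [Ring A₂] [Ring A₃] [Algebra k A₁] [Algebra k A₂] [Algebra k A₃]
    {M₂₁ M₃₂ M₃₁ : Type u}
    [AddCommGroup M₂₁] [Module k M₂₁] [Module A₂ M₂₁] [Module A₁ᵐᵒᵖ M₂₁]
    [SMulCommClass A₂ A₁ᵐᵒᵖ M₂₁] [IsScalarTower k A₂ M₂₁] [IsScalarTower k A₁ᵐᵒᵖ M₂₁]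
    [AddCommGroup M₃₂] [Module k M₃₂] [Module A₃ M₃₂] [Module A₂ᵐᵒᵖ M₃₂]
    [SMulCommClass A₃ A₂ᵐᵒᵖ M₃₂] [IsScalarTower k A₃ M₃₂] [IsScalarTower k A₂ᵐᵒᵖ M₃₂]
    [AddCommGroup M₃₁] [Module k M₃₁] [Module A₃ M₃₁] [Module A₁ᵐᵒᵖ M₃₁]
    [SMulCommClass A₃ A₁ᵐᵒᵖ M₃₁] [IsScalarTower k A₃ M₃₁] [IsScalarTower k A₁ᵐᵒᵖ M₃₁]
    (D : TriangularDatum k A₁ A₂ A₃ M₂₁ M₃₂ M₃₁)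

/-- The diagonal idempotents, indexed by `Fin 3`. -/
def idempotent (i : Fin 3) : Triangular D := e D i

theorem idempotent_zero : idempotent D 0 = ⟨1, 0, 0, 0, 0, 0⟩ := rfl

theorem idempotent_one : idempotent D 1 = ⟨0, 1, 0, 0, 0, 0⟩ := rfl

theorem idempotent_two : idempotent D 2 = ⟨0, 0, 1, 0, 0, 0⟩ := rfl

theorem isTriangularSystem : IsTriangularSystem (diagonal D) (idempotent D) where
  mem i := Algebra.subset_adjoin ⟨i, rfl⟩
  orth i j h := by
    fin_cases i <;> fin_cases j <;>
      first
      | exact absurd rfl h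
      | simp [idempotent_zero, idempotent_one, idempotent_two, mul_def, zero_def]
  idem i := e_mul_e D i
  sum := by
    simp [Fin.sum_univ_three, idempotent_zero, idempotent_one, idempotent_two, add_def, one_def]
  upper i j h t := by
    fin_cases i <;> fin_cases j <;>
      first
      | exact absurd h (by decide)
      | simp [idempotent_zero, idempotent_one, idempotent_two, mul_def, zero_def]

theorem exists_of_mem_diagonal {r : Triangular D} (hr : r ∈ diagonal D) :
    ∃ a b c : k, r = ⟨algebraMap k A₁ a, algebraMap k A₂ b, algebraMap k A₃ c, 0, 0, 0⟩ := by
  induction hr using Algebra.adjoin_induction with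
  | mem x hx =>
    obtain ⟨i, rfl⟩ := hx
    match i with
    | (0 : Fin 3) => exact ⟨1, 0, 0, by simp only [map_one, map_zero]; rfl⟩
    | (1 : Fin 3) => exact ⟨0, 1, 0, by simp only [map_one, map_zero]; rfl⟩
    | (2 : Fin 3) => exact ⟨0, 0, 1, by simp only [map_one, map_zero]; rfl⟩
  | algebraMap c =>
    exact ⟨c, c, c, by simp [Algebra.algebraMap_eq_smul_one, smul_def, one_def]⟩
  | add x y _ _ hx hy =>
    obtain ⟨a, b, c, rfl⟩ := hx
    obtain ⟨a', b', c', rfl⟩ := hy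
    exact ⟨a + a', b + b', c + c', by simp [add_def]⟩
  | mul x y _ _ hx hy =>
    obtain ⟨a, b, c, rfl⟩ := hx
    obtain ⟨a', b', c', rfl⟩ := hy
    exact ⟨a * a', b * b', c * c', by simp [mul_def]⟩

/-- The entry `₂M₁`. -/
def entry₂₁ : OffDiagonalEntry (diagonal D) (idempotent D) (ι₂ D) (ι₁ D) M₂₁ 1 0 where
  lt := by decide
  f_one := rfl
  g_one := rfl
  h := { toFun := fun m => ⟨0, 0, 0, m, 0, 0⟩
         map_add' := fun _ _ => by simp [add_def]
         map_smul' := fun _ _ => by simp [smul_def] }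
  f_mul_h b m := by simp [ι₂, mul_def]
  h_mul_g m a := by simp [ι₁, mul_def]
  ρ := { toFun := fun t => ⟨t.a₂, t.m₂₁, t.a₁⟩
         map_add' := fun _ _ => rfl
         map_smul' := fun _ _ => rfl }
  ρ_add s := by ext <;> simp [ι₁, ι₂, add_def]
  add_ρ u v x hu hv hx := by
    rw [← hx]
    rcases hu with rfl | rfl <;> rcases hv with rfl | rfl <;>
      simp [ι₁, ι₂, idempotent_zero, idempotent_one, mul_def, add_def]
  ρ_mem r hr := by
    obtain ⟨a, b, c, rfl⟩ := exists_of_mem_diagonal D hr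
    exact ⟨b, a, rfl⟩
  ρ_mul r hr t := by ext <;> simp [mul_def, add_comm]
  ρ_mul' r hr t := by ext <;> simp [mul_def, add_comm]
  mul_f_one r hr := by
    obtain ⟨a, b, c, rfl⟩ := exists_of_mem_diagonal D hr
    simp [ι₂, mul_def]
  g_one_mul r hr := by
    obtain ⟨a, b, c, rfl⟩ := exists_of_mem_diagonal D hr
    simp [ι₁, mul_def]
  ρ_e v := by
    fin_cases v
    · left; ext <;> simp [idempotent_zero]
    · right; ext <;> simp [idempotent_one]
    · left; ext <;> simp [idempotent_two]

/-- The entry `₃M₂`. -/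
def entry₃₂ : OffDiagonalEntry (diagonal D) (idempotent D) (ι₃ D) (ι₂ D) M₃₂ 2 1 where
  lt := by decide
  f_one := rfl
  g_one := rfl
  h := { toFun := fun m => ⟨0, 0, 0, 0, m, 0⟩
         map_add' := fun _ _ => by simp [add_def]
         map_smul' := fun _ _ => by simp [smul_def] }
  f_mul_h b m := by simp [ι₃, mul_def]
  h_mul_g m a := by simp [ι₂, mul_def]
  ρ := { toFun := fun t => ⟨t.a₃, t.m₃₂, t.a₂⟩
         map_add' := fun _ _ => rfl
         map_smul' := fun _ _ => rfl }
  ρ_add s := by ext <;> simp [ι₂, ι₃, add_def]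
  add_ρ u v x hu hv hx := by
    rw [← hx]
    rcases hu with rfl | rfl <;> rcases hv with rfl | rfl <;>
      simp [ι₂, ι₃, idempotent_one, idempotent_two, mul_def, add_def]
  ρ_mem r hr := by
    obtain ⟨a, b, c, rfl⟩ := exists_of_mem_diagonal D hr
    exact ⟨c, b, rfl⟩
  ρ_mul r hr t := by ext <;> simp [mul_def, add_comm]
  ρ_mul' r hr t := by ext <;> simp [mul_def, add_comm]
  mul_f_one r hr := by
    obtain ⟨a, b, c, rfl⟩ := exists_of_mem_diagonal D hr
    simp [ι₃, mul_def]
  g_one_mul r hr := by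
    obtain ⟨a, b, c, rfl⟩ := exists_of_mem_diagonal D hr
    simp [ι₂, mul_def]
  ρ_e v := by
    fin_cases v
    · left; ext <;> simp [idempotent_zero]
    · left; ext <;> simp [idempotent_one]
    · right; ext <;> simp [idempotent_two]

/-- The entry `₃M₁`. -/
def entry₃₁ : OffDiagonalEntry (diagonal D) (idempotent D) (ι₃ D) (ι₁ D) M₃₁ 2 0 where
  lt := by decide
  f_one := rfl
  g_one := rfl
  h := { toFun := fun m => ⟨0, 0, 0, 0, 0, m⟩
         map_add' := fun _ _ => by simp [add_def]
         map_smul' := fun _ _ => by simp [smul_def] }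
  f_mul_h b m := by simp [ι₃, mul_def]
  h_mul_g m a := by simp [ι₁, mul_def]
  ρ := { toFun := fun t => ⟨t.a₃, t.m₃₁, t.a₁⟩
         map_add' := fun _ _ => rfl
         map_smul' := fun _ _ => rfl }
  ρ_add s := by ext <;> simp [ι₁, ι₃, add_def]
  add_ρ u v x hu hv hx := by
    rw [← hx]
    rcases hu with rfl | rfl <;> rcases hv with rfl | rfl <;>
      simp [ι₁, ι₃, idempotent_zero, idempotent_two, mul_def, add_def]
  ρ_mem r hr := by
    obtain ⟨a, b, c, rfl⟩ := exists_of_mem_diagonal D hr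
    exact ⟨c, a, rfl⟩
  -- The term `μ` in the product vanishes because `r` has no entries below the diagonal; without
  -- this the projection is not multiplicative.
  ρ_mul r hr t := by
    obtain ⟨a, b, c, rfl⟩ := exists_of_mem_diagonal D hr
    ext <;> simp [mul_def]
  ρ_mul' r hr t := by
    obtain ⟨a, b, c, rfl⟩ := exists_of_mem_diagonal D hr
    ext <;> simp [mul_def]
  mul_f_one r hr := by
    obtain ⟨a, b, c, rfl⟩ := exists_of_mem_diagonal D hr
    simp [ι₃, mul_def]
  g_one_mul r hr := by
    obtain ⟨a, b, c, rfl⟩ := exists_of_mem_diagonal D hr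
    simp [ι₁, mul_def]
  ρ_e v := by
    fin_cases v
    · left; ext <;> simp [idempotent_zero]
    · left; ext <;> simp [idempotent_one]
    · right; ext <;> simp [idempotent_two]

end Triangular

/-! ### The first page of the spectral sequence -/

namespace RelHochschild

attribute [local instance] TensorProduct.Algebra.module

theorem computesHomology_corner {k : Type u} [Field k] {B A T M : Type u} [Ring B] [Ring A]
    [Ring T] [Algebra k B] [Algebra k A] [Algebra k T] [AddCommGroup M] [Module k M] [Module B M]
    [Module Aᵐᵒᵖ M] [SMulCommClass B Aᵐᵒᵖ M] [IsScalarTower k B M] [IsScalarTower k Aᵐᵒᵖ M]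
    (f : B →ₙₐ[k] T) (g : A →ₙₐ[k] T)
    (X : Type u) [AddCommGroup X] [Module k X] [Module T X] [Module Tᵐᵒᵖ X]
    [SMulCommClass T Tᵐᵒᵖ X] [IsScalarTower k T X] [IsScalarTower k Tᵐᵒᵖ X] (l : ℕ) :
    ComputesHomology
      (relCoboundary (X := Corner f g X) (TriangularTwo.diag k B A M) l)
      (relCoboundary (X := Corner f g X) (TriangularTwo.diag k B A M) (l + 1))
      (BimoduleExt k B A M (Corner f g X) l) :=
  TriangularTwo.exists_surjective_ext l (Corner f g X)

end RelHochschild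

namespace Triangular

open RelHochschild

section

variable {k : Type u} [Field k]
    {A₁ A₂ A₃ : Type u} [Ring A₁] [Ring A₂] [Ring A₃] [Algebra k A₁] [Algebra k A₂] [Algebra k A₃]
    {M₂₁ M₃₂ M₃₁ : Type u}
    [AddCommGroup M₂₁] [Module k M₂₁] [Module A₂ M₂₁] [Module A₁ᵐᵒᵖ M₂₁]
    [SMulCommClass A₂ A₁ᵐᵒᵖ M₂₁] [IsScalarTower k A₂ M₂₁] [IsScalarTower k A₁ᵐᵒᵖ M₂₁]
    [AddCommGroup M₃₂] [Module k M₃₂] [Module A₃ M₃₂] [Module A₂ᵐᵒᵖ M₃₂]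
    [SMulCommClass A₃ A₂ᵐᵒᵖ M₃₂] [IsScalarTower k A₃ M₃₂] [IsScalarTower k A₂ᵐᵒᵖ M₃₂]
    [AddCommGroup M₃₁] [Module k M₃₁] [Module A₃ M₃₁] [Module A₁ᵐᵒᵖ M₃₁]
    [SMulCommClass A₃ A₁ᵐᵒᵖ M₃₁] [IsScalarTower k A₃ M₃₁] [IsScalarTower k A₁ᵐᵒᵖ M₃₁]
    (D : TriangularDatum k A₁ A₂ A₃ M₂₁ M₃₂ M₃₁)
    (X : Type u) [AddCommGroup X] [Module k X] [Module (Triangular D) X]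
    [Module (Triangular D)ᵐᵒᵖ X] [SMulCommClass (Triangular D) (Triangular D)ᵐᵒᵖ X]
    [IsScalarTower k (Triangular D) X] [IsScalarTower k (Triangular D)ᵐᵒᵖ X]

attribute [local instance] TensorProduct.Algebra.module

/-- The restriction of cochains to the three entries below the diagonal. -/
def restrictEntries (l : ℕ) : relCochain X (diagonal D) l →ₗ[k]
    relCochain (Corner (ι₂ D) (ι₁ D) X) (TriangularTwo.diag k A₂ A₁ M₂₁) l ×
    relCochain (Corner (ι₃ D) (ι₂ D) X) (TriangularTwo.diag k A₃ A₂ M₃₂) l ×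
    relCochain (Corner (ι₃ D) (ι₁ D) X) (TriangularTwo.diag k A₃ A₁ M₃₁) l :=
  ((entry₂₁ D).restrictEntry (isTriangularSystem D) l).prod
    (((entry₃₂ D).restrictEntry (isTriangularSystem D) l).prod
      ((entry₃₁ D).restrictEntry (isTriangularSystem D) l))

-- The sum of the three extensions by zero is a preimage: each restriction undoes its own extension
-- and kills the two others, whose values lie in different corners.
variable {X} in
theorem exists_restrictEntries_eq {l : ℕ}
    (z : relCochain (Corner (ι₂ D) (ι₁ D) X) (TriangularTwo.diag k A₂ A₁ M₂₁) l ×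
      relCochain (Corner (ι₃ D) (ι₂ D) X) (TriangularTwo.diag k A₃ A₂ M₃₂) l ×
      relCochain (Corner (ι₃ D) (ι₁ D) X) (TriangularTwo.diag k A₃ A₁ M₃₁) l) :
    ∃ φ ∈ trajectoryFiltration X (diagonal D) (n := 3) (idempotent D) 1 l,
      restrictEntries D X l φ = z := by
  have H := isTriangularSystem D
  obtain ⟨x, y, z⟩ := z
  refine ⟨(entry₂₁ D).extendEntry l x + ((entry₃₂ D).extendEntry l y +
      (entry₃₁ D).extendEntry l z),
    Submodule.add_mem _ ((entry₂₁ D).extendEntry_mem H x)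
      (Submodule.add_mem _ ((entry₃₂ D).extendEntry_mem H y) ((entry₃₁ D).extendEntry_mem H z)), ?_⟩
  refine Prod.ext ?_ (Prod.ext ?_ ?_)
  · change (entry₂₁ D).restrictEntry H l _ = x
    rw [map_add, map_add, OffDiagonalEntry.restrictEntry_extendEntry,
      (entry₂₁ D).restrictEntry_extendEntry_of_ne H (entry₃₂ D) (by decide),
      (entry₂₁ D).restrictEntry_extendEntry_of_ne H (entry₃₁ D) (by decide), add_zero, add_zero]
  · change (entry₃₂ D).restrictEntry H l _ = y
    rw [map_add, map_add, OffDiagonalEntry.restrictEntry_extendEntry,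
      (entry₃₂ D).restrictEntry_extendEntry_of_ne H (entry₂₁ D) (by decide),
      (entry₃₂ D).restrictEntry_extendEntry_of_ne H (entry₃₁ D) (by decide), add_zero, zero_add]
  · change (entry₃₁ D).restrictEntry H l _ = z
    rw [map_add, map_add, OffDiagonalEntry.restrictEntry_extendEntry,
      (entry₃₁ D).restrictEntry_extendEntry_of_ne H (entry₂₁ D) (by decide),
      (entry₃₁ D).restrictEntry_extendEntry_of_ne H (entry₃₂ D) (by decide), zero_add, zero_add]

-- Every trajectory of length one has end points `q < p` and stays in `{p, q}`, so it belongs to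
-- exactly one of the three entries, whose restriction controls `φ` there. Length zero is taken care
-- of by `F¹`.
variable {D X} in
theorem restrictEntries_eq_zero_iff {l : ℕ} {φ : relCochain X (diagonal D) (l + 1)}
    (hφ : φ ∈ trajectoryFiltration X (diagonal D) (n := 3) (idempotent D) 1 (l + 1)) :
    restrictEntries D X (l + 1) φ = 0 ↔
      φ ∈ trajectoryFiltration X (diagonal D) (n := 3) (idempotent D) 2 (l + 1) := by
  have H := isTriangularSystem D
  constructor
  · intro h τ hτ x hx
    by_cases h1 : τ.length = 1
    · obtain ⟨hlt, hv⟩ := τ.index_of_length_eq_one h1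
      have key : ∀ p q : Fin 3, q < p → (p = 1 ∧ q = 0) ∨ (p = 2 ∧ q = 1) ∨ (p = 2 ∧ q = 0) := by
        decide
      have hv' : ∀ a, τ.index a = τ.index 0 ∨ τ.index a = τ.index (Fin.last _) := hv
      rcases key _ _ hlt with ⟨hp, hq⟩ | ⟨hp, hq⟩ | ⟨hp, hq⟩ <;>
        rw [hp, hq] at hv'
      · exact (entry₂₁ D).apply_eq_zero_of_restrictEntry_eq_zero H (congrArg (fun z => z.1) h)
          τ.index hp hq hv' x hx
      · exact (entry₃₂ D).apply_eq_zero_of_restrictEntry_eq_zero H (congrArg (fun z => z.2.1) h)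
          τ.index hp hq hv' x hx
      · exact (entry₃₁ D).apply_eq_zero_of_restrictEntry_eq_zero H (congrArg (fun z => z.2.2) h)
          τ.index hp hq hv' x hx
    · exact hφ τ (by omega) x hx
  · intro h
    exact Prod.ext ((entry₂₁ D).restrictEntry_eq_zero H h)
      (Prod.ext ((entry₃₂ D).restrictEntry_eq_zero H h) ((entry₃₁ D).restrictEntry_eq_zero H h))

variable {D X} in
theorem restrictEntries_relCoboundary {l : ℕ} {φ : relCochain X (diagonal D) l}
    (hφ : φ ∈ trajectoryFiltration X (diagonal D) (n := 3) (idempotent D) 1 l) :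
    restrictEntries D X (l + 1) (relCoboundary (diagonal D) l φ) =
      (relCoboundary (TriangularTwo.diag k A₂ A₁ M₂₁) l).prodMap
        ((relCoboundary (TriangularTwo.diag k A₃ A₂ M₃₂) l).prodMap
          (relCoboundary (TriangularTwo.diag k A₃ A₁ M₃₁) l)) (restrictEntries D X l φ) :=
  have H := isTriangularSystem D
  Prod.ext ((entry₂₁ D).restrictEntry_relCoboundary H hφ)
    (Prod.ext ((entry₃₂ D).restrictEntry_relCoboundary H hφ)
      ((entry₃₁ D).restrictEntry_relCoboundary H hφ))

theorem nonempty_page_one_one_equiv (l : ℕ) :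
    Nonempty ((filteredComplex D X).page 1 1 (l + 1) ≃ₗ[k]
      BimoduleExt k A₂ A₁ M₂₁ (Corner (ι₂ D) (ι₁ D) X) l ×
      BimoduleExt k A₃ A₂ M₃₂ (Corner (ι₃ D) (ι₂ D) X) l ×
      BimoduleExt k A₃ A₁ M₃₁ (Corner (ι₃ D) (ι₁ D) X) l) := by
  refine (filteredComplex D X).nonempty_page_one_equiv 1 l
    ((computesHomology_corner (ι₂ D) (ι₁ D) X l).prod
      ((computesHomology_corner (ι₃ D) (ι₂ D) X l).prod
        (computesHomology_corner (ι₃ D) (ι₁ D) X l)))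
    (restrictEntries D X l ∘ₗ Submodule.subtype _)
    (restrictEntries D X (l + 1) ∘ₗ Submodule.subtype _)
    (restrictEntries D X (l + 2) ∘ₗ Submodule.subtype _) ?_ ?_ ?_ ?_ ?_ ?_
  · intro z
    obtain ⟨φ, hφ, h⟩ := exists_restrictEntries_eq D z
    exact ⟨⟨φ, hφ⟩, h⟩
  · intro z
    obtain ⟨φ, hφ, h⟩ := exists_restrictEntries_eq D z
    exact ⟨⟨φ, hφ⟩, h⟩
  · exact fun φ => restrictEntries_eq_zero_iff φ.2
  · exact fun φ => restrictEntries_eq_zero_iff φ.2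
  · exact fun φ => restrictEntries_relCoboundary φ.2
  · exact fun φ => restrictEntries_relCoboundary φ.2

/-- Trajectories of a single vertex have length zero, so `F¹` is zero in degree zero. -/
theorem subsingleton_page_one_one_zero : Subsingleton ((filteredComplex D X).page 1 1 0) := by
  have : Subsingleton ((filteredComplex D X).Z 1 1 0) := by
    refine subsingleton_of_forall_eq 0 fun z => Subtype.ext ?_
    exact trajectoryFiltration_one_zero_eq_zero (n := 3) (e := idempotent D) z.2.1 0
  exact (Submodule.Quotient.mk_surjective _).subsingleton

end

end Triangular

theorem mainTheorem4 {k : Type u} [Field k]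
    {A₁ A₂ A₃ : Type u} [Ring A₁] [Ring A₂] [Ring A₃] [Algebra k A₁] [Algebra k A₂] [Algebra k A₃]
    {M₂₁ M₃₂ M₃₁ : Type u}
    [AddCommGroup M₂₁] [Module k M₂₁] [Module A₂ M₂₁] [Module A₁ᵐᵒᵖ M₂₁]
    [SMulCommClass A₂ A₁ᵐᵒᵖ M₂₁] [IsScalarTower k A₂ M₂₁] [IsScalarTower k A₁ᵐᵒᵖ M₂₁]
    [AddCommGroup M₃₂] [Module k M₃₂] [Module A₃ M₃₂] [Module A₂ᵐᵒᵖ M₃₂]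
    [SMulCommClass A₃ A₂ᵐᵒᵖ M₃₂] [IsScalarTower k A₃ M₃₂] [IsScalarTower k A₂ᵐᵒᵖ M₃₂]
    [AddCommGroup M₃₁] [Module k M₃₁] [Module A₃ M₃₁] [Module A₁ᵐᵒᵖ M₃₁]
    [SMulCommClass A₃ A₁ᵐᵒᵖ M₃₁] [IsScalarTower k A₃ M₃₁] [IsScalarTower k A₁ᵐᵒᵖ M₃₁]
    (D : TriangularDatum k A₁ A₂ A₃ M₂₁ M₃₂ M₃₁)
    (X : Type u) [AddCommGroup X] [Module k X] [Module (Triangular D) X]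
    [Module (Triangular D)ᵐᵒᵖ X] [SMulCommClass (Triangular D) (Triangular D)ᵐᵒᵖ X]
    [IsScalarTower k (Triangular D) X] [IsScalarTower k (Triangular D)ᵐᵒᵖ X] :
    (∀ l : ℕ, Nonempty ((Triangular.filteredComplex D X).page 1 1 (l + 1) ≃ₗ[k]
      BimoduleExt k A₂ A₁ M₂₁ (Corner (Triangular.ι₂ D) (Triangular.ι₁ D) X) l ×
      BimoduleExt k A₃ A₂ M₃₂ (Corner (Triangular.ι₃ D) (Triangular.ι₂ D) X) l ×
      BimoduleExt k A₃ A₁ M₃₁ (Corner (Triangular.ι₃ D) (Triangular.ι₁ D) X) l)) ∧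
    Subsingleton ((Triangular.filteredComplex D X).page 1 1 0) :=
  ⟨Triangular.nonempty_page_one_one_equiv D X, Triangular.subsingleton_page_one_one_zero D X⟩
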